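/- The following is a theorem of ZF (no form of the Axiom of Choice is used); that is, it holds in every model of ZF, all notions being interpreted in the model. A complete ordered field $\mathbb{R}$ exists, and for $\mathbb{R}$ any such field and $\mathbb{C}=\mathbb{R}[i]$ the following is true. Let $X$ be a power Dedekind-finite set, i.e. a set such that every injective function from the power set $\mathcal{P}(X)$ to itself is surjective. Let $\ell^2(X)$ be the space of all $\eta:X\to\mathbb{C}$ with $\sum_{x\in X}|\eta(x)|^2<\infty$ (the sum being the supremum of the sums over finite subsets of $X$), with norm $\|\eta\|=\bigl(\sum_{x\in X}|\eta(x)|^2\bigr)^{1/2}$, and let $T$ be a bounded linear operator on $\ell^2(X)$. Then the spectrum $$\sigma(T)=\{\lambda\in\mathbb{C} : T-\lambda 1 \text{ has no two-sided inverse among the bounded linear operators on } \ell^2(X)\}$$ is finite (in bijection with a natural number), and every $\lambda\in\sigma(T)$ is an eigenvalue of $T$, i.e. $T\eta=\lambda\eta$ for some nonzero $\eta\in\ell^2(X)$. -/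

import Mathlib

universe u v w

/-! # Models of ZF

A model of ZF is a nonempty type `V` with a binary relation `∈` that satisfies the axioms of
Zermelo-Fraenkel set theory without any form of the axiom of choice. A statement is a theorem of
ZF exactly when it holds in every such model. Everything below is interpreted inside `V`: all sets,
functions, operators and bijections that are quantified over are elements of `V`.
-/

namespace ZF

/-- The relation symbols of the language of set theory: one binary symbol. -/
inductive SetRel : ℕ → Type
  | mem : SetRel 2

/-- The first-order language of set theory. -/
def setLanguage : FirstOrder.Language := ⟨fun _ => Empty, SetRel⟩

instance setStructure (V : Type u) [Membership V V] : setLanguage.Structure V where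
  funMap := fun {_} f => nomatch f
  RelMap := fun {_} r => match r with
    | SetRel.mem => fun x => x 0 ∈ x 1

/-- `V` is a model of ZF. In the two schemas "definable" means definable by a first-order formula
of the language of set theory with arbitrary parameters from `V`. -/
class IsModel (V : Type u) [Membership V V] : Prop where
  extensionality : ∀ x y : V, (∀ z : V, z ∈ x ↔ z ∈ y) → x = y
  foundation : ∀ x : V, (∃ y : V, y ∈ x) → ∃ y : V, y ∈ x ∧ ∀ z : V, z ∈ x → z ∉ y
  pairing : ∀ x y : V, ∃ p : V, ∀ z : V, z ∈ p ↔ z = x ∨ z = y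
  union : ∀ x : V, ∃ u : V, ∀ z : V, z ∈ u ↔ ∃ y : V, y ∈ x ∧ z ∈ y
  powerset : ∀ x : V, ∃ p : V, ∀ y : V, y ∈ p ↔ ∀ z : V, z ∈ y → z ∈ x
  infinity : ∃ i : V, (∃ e : V, e ∈ i ∧ ∀ z : V, z ∉ e) ∧
    ∀ x : V, x ∈ i → ∃ y : V, y ∈ i ∧ ∀ z : V, z ∈ y ↔ z ∈ x ∨ z = x
  separation : ∀ P : Set V, (Set.univ : Set V).Definable₁ setLanguage P →
    ∀ a : V, ∃ b : V, ∀ x : V, x ∈ b ↔ x ∈ a ∧ x ∈ P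
  replacement : ∀ P : Set (V × V), (Set.univ : Set V).Definable₂ setLanguage P →
    ∀ a : V, (∀ x : V, x ∈ a → ∃! y : V, (x, y) ∈ P) →
      ∃ b : V, ∀ y : V, y ∈ b ↔ ∃ x : V, x ∈ a ∧ (x, y) ∈ P

/-! ## Objects of the model -/

/-- The type of elements of the set `A` of the model. -/
def El {V : Type u} [Membership V V] (A : V) : Type u := {x : V // x ∈ A}

/-- `p` is the Kuratowski pair `{{a}, {a, b}}`. -/
def IsPair {V : Type u} [Membership V V] (p a b : V) : Prop :=
  ∀ z : V, z ∈ p ↔ (∀ t : V, t ∈ z ↔ t = a) ∨ (∀ t : V, t ∈ z ↔ t = a ∨ t = b)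

/-- `Codes v a` says that the set `v` of the model is the object `a`. -/
class Coded (V : Type u) (α : Type v) where
  Codes : V → α → Prop

section Coded

variable {V : Type u} [Membership V V] {α : Type v} {β : Type w}

/-- A set of the model is itself. -/
instance codedSelf : Coded V V := ⟨fun v x => v = x⟩

instance codedEl (A : V) : Coded V (El A) := ⟨fun v x => v = x.1⟩

/-- Pairs are coded as Kuratowski pairs. -/
instance codedProd [Coded V α] [Coded V β] : Coded V (α × β) :=
  ⟨fun v p => ∃ a b : V, Coded.Codes a p.1 ∧ Coded.Codes b p.2 ∧ IsPair v a b⟩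

/-- A collection `S` is coded as the set of the codes of its members. -/
instance codedSet [Coded V α] : Coded V (Set α) :=
  ⟨fun v S => ∀ z : V, z ∈ v ↔ ∃ a ∈ S, Coded.Codes z a⟩

/-- A function is coded as its graph. -/
instance codedFun [Coded V α] [Coded V β] : Coded V (α → β) :=
  ⟨fun v f => ∀ z : V, z ∈ v ↔ ∃ a : α, Coded.Codes z (a, f a)⟩

instance codedSubtype [Coded V α] (p : α → Prop) : Coded V (Subtype p) :=
  ⟨fun v a => Coded.Codes v a.1⟩

/-- A complex number is coded as the pair of its real and imaginary parts. -/
instance codedQuadratic [Coded V α] (a b : α) : Coded V (QuadraticAlgebra α a b) :=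
  ⟨fun v z => Coded.Codes v (z.re, z.im)⟩

end Coded

/-- The object `a` (a collection, a function, ...) belongs to the model. -/
def Internal (V : Type u) {α : Type v} [Coded V α] (a : α) : Prop :=
  ∃ v : V, Coded.Codes v a

/-- The subsets of `α` that belong to the model. -/
abbrev ISet (V : Type u) [Membership V V] (α : Type v) [Coded V α] : Type v :=
  {S : Set α // Internal V S}

/-- The functions from `α` to `β` that belong to the model. -/
abbrev IFun (V : Type u) [Membership V V] (α : Type v) (β : Type w) [Coded V α] [Coded V β] :
    Type (max v w) :=
  {f : α → β // Internal V f}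

/-! ## Finiteness -/

/-- An inductive set: it contains `∅` and is closed under `x ↦ x ∪ {x}`. -/
def IsInductive {V : Type u} [Membership V V] (i : V) : Prop :=
  (∀ e : V, (∀ z : V, z ∉ e) → e ∈ i) ∧
    ∀ x y : V, x ∈ i → (∀ z : V, z ∈ y ↔ z ∈ x ∨ z = x) → y ∈ i

/-- `n` is a (von Neumann) natural number of the model. -/
def IsNat {V : Type u} [Membership V V] (n : V) : Prop :=
  ∀ i : V, IsInductive i → n ∈ i

/-- A finite set of the model: one in bijection, in the model, with a natural number. -/
def IsFinite (V : Type u) [Membership V V] {α : Type v} [Coded V α] (S : Set α) : Prop :=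
  ∃ n : V, IsNat n ∧ ∃ f : El n → α, Internal V f ∧ Function.Injective f ∧ Set.range f = S

/-- Dedekind-finiteness: every injective function from the set to itself is surjective. -/
def DedekindFinite (V : Type u) [Membership V V] (α : Type v) [Coded V α] : Prop :=
  ∀ f : α → α, Internal V f → Function.Injective f → Function.Surjective f

/-- `X` is power Dedekind-finite: the power set of `X` is Dedekind-finite. -/
def PowerDedekindFinite {V : Type u} [Membership V V] (X : V) : Prop :=
  DedekindFinite V (ISet V (El X))

/-! ## Real and complex numbers -/

/-- A field of real numbers of the model: an ordered field that belongs to the model and in which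
every nonempty set of the model that is bounded above has a least upper bound. (ZF proves that it
exists and is unique up to a unique isomorphism.) -/
structure RealField (V : Type u) [Membership V V] where
  carrier : V
  [field : Field (El carrier)]
  [linearOrder : LinearOrder (El carrier)]
  [isStrictOrderedRing : IsStrictOrderedRing (El carrier)]
  internal_add : Internal V (fun p : El carrier × El carrier => p.1 + p.2)
  internal_mul : Internal V (fun p : El carrier × El carrier => p.1 * p.2)
  internal_le : Internal V {p : El carrier × El carrier | p.1 ≤ p.2}
  exists_isLUB : ∀ S : ISet V (El carrier), S.1.Nonempty → BddAbove S.1 → ∃ r, IsLUB S.1 r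

attribute [instance] RealField.field RealField.linearOrder RealField.isStrictOrderedRing

section Operators

variable {V : Type u} [Membership V V]

/-- The real numbers. -/
abbrev RealField.Re (R : RealField V) : Type u := El R.carrier

/-- The complex numbers `re + im * i` with `i ^ 2 = -1`. -/
abbrev RealField.Cx (R : RealField V) : Type u := QuadraticAlgebra R.Re (-1) 0

/-- `s` is the sum of `g x` over `x ∈ F`, for a finite set `F`: there is a function `σ` of the
model on the subsets of `X` with `σ ∅ = 0` and `σ (A ∪ {x}) = σ A + g x` whenever `x ∉ A` and
`A ∪ {x} ⊆ F`, and `σ F = s`. -/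
def IsFinSum (R : RealField V) {X : V} (g : El X → R.Re) (F : ISet V (El X)) (s : R.Re) : Prop :=
  ∃ σ : ISet V (El X) → R.Re, Internal V σ ∧
    (∀ A : ISet V (El X), A.1 = ∅ → σ A = 0) ∧
    (∀ (A B : ISet V (El X)) (x : El X), x ∉ A.1 → B.1 = insert x A.1 → B.1 ⊆ F.1 →
      σ B = σ A + g x) ∧
    σ F = s

/-- The sums of `|η x| ^ 2` over the finite subsets of `X`. -/
def finiteSums (R : RealField V) {X : V} (η : El X → R.Cx) : Set R.Re :=
  {s | ∃ F : ISet V (El X), IsFinite V F.1 ∧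
    IsFinSum R (fun x => (η x).re ^ 2 + (η x).im ^ 2) F s}

/-- `ℓ²(X)`: the functions from `X` to the complex numbers, in the model, with
`∑ |η x| ^ 2 < ∞`, where the sum is the supremum of the sums over finite subsets. -/
abbrev L2 (R : RealField V) (X : V) : Type u :=
  {η : IFun V (El X) R.Cx // BddAbove (finiteSums R η.1)}

/-- The value of the vector `η` at `x`. -/
abbrev coord {R : RealField V} {X : V} (η : L2 R X) (x : El X) : R.Cx := η.1.1 x

/-- `r` is the square of the norm of `η`. -/
def IsNormSq {R : RealField V} {X : V} (η : L2 R X) (r : R.Re) : Prop :=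
  IsLUB (finiteSums R η.1.1) r

/-- `T` is a bounded linear operator of the model on `ℓ²(X)`. -/
structure IsBoundedOperator {R : RealField V} {X : V} (T : L2 R X → L2 R X) : Prop where
  internal : Internal V T
  map_add : ∀ η ζ θ : L2 R X, (∀ x, coord θ x = coord η x + coord ζ x) →
    ∀ x, coord (T θ) x = coord (T η) x + coord (T ζ) x
  map_smul : ∀ (c : R.Cx) (η θ : L2 R X), (∀ x, coord θ x = c * coord η x) →
    ∀ x, coord (T θ) x = c * coord (T η) x
  bounded : ∃ M : R.Re, ∀ (η : L2 R X) (a b : R.Re), IsNormSq η a → IsNormSq (T η) b →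
    b ≤ M ^ 2 * a

/-- `T - c` has a two-sided inverse `S` among the bounded operators on `ℓ²(X)`. -/
def IsInvertibleSub {R : RealField V} {X : V} (T : L2 R X → L2 R X) (c : R.Cx) : Prop :=
  ∃ S : L2 R X → L2 R X, IsBoundedOperator S ∧
    (∀ η ζ : L2 R X, (∀ x, coord ζ x = coord (T η) x - c * coord η x) → S ζ = η) ∧
    ∀ (η : L2 R X) (x : El X), coord (T (S η)) x - c * coord (S η) x = coord η x

/-- The spectrum of `T`. -/
def opSpectrum {R : RealField V} {X : V} (T : L2 R X → L2 R X) : Set R.Cx :=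
  {c | ¬ IsInvertibleSub T c}

/-- `c` is an eigenvalue of `T`. -/
def IsEigenvalue {R : RealField V} {X : V} (T : L2 R X → L2 R X) (c : R.Cx) : Prop :=
  ∃ η : L2 R X, (∃ x, coord η x ≠ 0) ∧ ∀ x, coord (T η) x = c * coord η x

end Operators

end ZF

set_option synthInstance.maxSize 1000000000
set_option synthInstance.maxHeartbeats 400000
set_option linter.unusedSectionVars false
set_option linter.unusedVariables false

namespace ZF

/-! ## Definable predicates of the model -/

/-! Let A_0, A_1, … be a sequence of subsets of a power Dedekind-finite set X. If infinitely many
A_n separated two points that no earlier set separates, these A_n would be pairwise distinct and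
give an injection of ω into the power set of X, which shifting along the sequence excludes
(`not_injective_of_dedekindFinite`). So an initial segment separates all points that the sequence
separates (`exists_initial_segment_separating`), and a function on X whose values are determined by
a sequence of subsets has finite range (`kFin_irange_of_sequence`). This covers functions into ω, ℝ
and ℂ. In particular first hitting times are bounded (`exists_bound_hitting`).

There are two consequences for ℓ²(X). The least n with n|η(x)|² ≥ 1 is bounded on the support of η,
so |η|² is bounded below there and summability makes the support finite: ℓ²(X) is the space of
finitely supported functions (`L2.isFiniteCoord`). Likewise, for fixed v, the first k with (T^k
v)(y) ≠ 0 is bounded in y, so all T^k v live on one finite set and some monic polynomial in T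
annihilates v. The minimal polynomial of the basis vector e_x is unique, hence a function of x; its
degree is bounded and its coefficients have finite range, so only finitely many polynomials occur.
Their product p satisfies p(T) = 0 (`IsFiniteCoord.exists_annihilator`).

For p of least positive degree and a scalar c, write p = k + (z - c)q. If k ≠ 0, then -k⁻¹ q(T) is a
bounded inverse of T - c. If k = 0, then q(T) ≠ 0 by minimality, and every nonzero value of q(T) is
an eigenvector for c. (In degree 0 the space is zero.) So the spectrum consists of eigenvalues, and
eigenvalues are zeros of p.

All of this has to happen inside V, whose ω may be nonstandard: induction, recursion and finiteness
apply only to objects of V. The classes `IType`, `IPred` and `IMap` say that types, predicates and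
functions belong to V; their instances derive this from separation, by way of the definability class
`Dfn`. Powers T^n with n in the ω of V, and polynomials in T, come from recursion in V (`horner`).
The field ℝ is built in V from Cauchy sequences of rationals, with internal quotients in place of
choices. -/

/-- `P` is definable with parameters, as a predicate of a tuple of objects indexed by `ι`. -/
class Dfn {V : Type u} [Membership V V] {ι : Type} (P : (ι → V) → Prop) : Prop where
  out : (Set.univ : Set V).Definable setLanguage {v | P v}

/-- `t` is a variable or a parameter. -/
class Atom {V : Type u} {ι : Type} (t : (ι → V) → V) : Prop where
  out : (∃ i, t = fun v => v i) ∨ ∃ c, t = fun _ => c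

section Definability

open FirstOrder FirstOrder.Language

variable {V : Type u} [Membership V V] {ι : Type}

instance Atom.var (i : ι) : Atom (V := V) (fun v => v i) := ⟨.inl ⟨i, rfl⟩⟩

instance Atom.const (c : V) : Atom (fun _ : ι → V => c) := ⟨.inr ⟨c, rfl⟩⟩

/-- A quantifier enlarges the index type `ι` to `ι ⊕ Fin 1`. The atoms of the outer context have to
remain atoms in the inner one. -/
instance Atom.reindex {κ : Type} (g : ι → κ) (t : (ι → V) → V) [h : Atom t] :
    Atom (fun w : κ → V => t fun i => w (g i)) := by
  rcases h.out with ⟨i, rfl⟩ | ⟨c, rfl⟩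
  · exact Atom.var _
  · exact Atom.const _

theorem Atom.exists_term {t : (ι → V) → V} (h : Atom t) :
    ∃ s : (setLanguage[[(Set.univ : Set V)]]).Term ι, ∀ v : ι → V, s.realize v = t v := by
  rcases h.out with ⟨i, rfl⟩ | ⟨c, rfl⟩
  · exact ⟨Term.var i, fun v => rfl⟩
  · exact ⟨(setLanguage.con (⟨c, trivial⟩ : (Set.univ : Set V))).term, fun v => by simp⟩

instance Dfn.mem (s t : (ι → V) → V) [hs : Atom s] [ht : Atom t] : Dfn fun v => s v ∈ t v := by
  obtain ⟨s', hs'⟩ := hs.exists_term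
  obtain ⟨t', ht'⟩ := ht.exists_term
  refine ⟨Relations.formula (L := setLanguage[[(Set.univ : Set V)]]) (n := 2)
    (Sum.inl SetRel.mem) ![s', t'], ?_⟩
  ext v
  have h : s v ∈ t v ↔ Term.realize v s' ∈ Term.realize v t' := by rw [hs', ht']
  exact h.trans (Formula.realize_rel (L := setLanguage[[(Set.univ : Set V)]]) (k := 2)
    (R := Sum.inl SetRel.mem) (ts := ![s', t']) (v := v)).symm

instance Dfn.eq (s t : (ι → V) → V) [hs : Atom s] [ht : Atom t] : Dfn fun v => s v = t v := by
  obtain ⟨s', hs'⟩ := hs.exists_term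
  obtain ⟨t', ht'⟩ := ht.exists_term
  refine ⟨s'.equal t', ?_⟩
  ext v
  simp [hs', ht', Formula.realize_equal]

instance Dfn.and (P Q : (ι → V) → Prop) [hP : Dfn P] [hQ : Dfn Q] : Dfn fun v => P v ∧ Q v :=
  ⟨hP.out.inter hQ.out⟩

instance Dfn.or (P Q : (ι → V) → Prop) [hP : Dfn P] [hQ : Dfn Q] : Dfn fun v => P v ∨ Q v :=
  ⟨hP.out.union hQ.out⟩

instance Dfn.not (P : (ι → V) → Prop) [hP : Dfn P] : Dfn fun v => ¬ P v :=
  ⟨hP.out.compl⟩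

instance Dfn.imp (P Q : (ι → V) → Prop) [hP : Dfn P] [hQ : Dfn Q] : Dfn fun v => P v → Q v := by
  simp only [imp_iff_not_or]
  infer_instance

instance Dfn.iff (P Q : (ι → V) → Prop) [hP : Dfn P] [hQ : Dfn Q] : Dfn fun v => P v ↔ Q v := by
  simp only [iff_iff_implies_and_implies]
  infer_instance

/-- The bound variable becomes the last coordinate of a longer tuple. In this form instance search
can strip the quantifiers of a formula one by one. -/
instance Dfn.exists (P : (ι → V) → V → Prop)
    [h : Dfn fun w : ι ⊕ Fin 1 → V => P (fun i => w (Sum.inl i)) (w (Sum.inr 0))] :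
    Dfn fun v => ∃ y, P v y := by
  constructor
  convert! h.out.exists_of_finite using 1
  ext v
  exact ⟨fun ⟨y, hy⟩ => ⟨fun _ => y, hy⟩, fun ⟨u, hu⟩ => ⟨u 0, hu⟩⟩

instance Dfn.forall (P : (ι → V) → V → Prop)
    [h : Dfn fun w : ι ⊕ Fin 1 → V => P (fun i => w (Sum.inl i)) (w (Sum.inr 0))] :
    Dfn fun v => ∀ y, P v y := by
  have : Dfn fun v => ¬ ∃ y, ¬ P v y := inferInstance
  simpa only [not_exists, not_not] using this

instance Dfn.isPair (p a b : (ι → V) → V) [Atom p] [Atom a] [Atom b] :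
    Dfn fun v => IsPair (p v) (a v) (b v) := by
  unfold IsPair
  infer_instance

instance Dfn.isInductive (t : (ι → V) → V) [Atom t] : Dfn fun v => IsInductive (t v) := by
  unfold IsInductive
  infer_instance

instance Dfn.isNat (t : (ι → V) → V) [Atom t] : Dfn fun v => IsNat (t v) := by
  unfold IsNat
  infer_instance

end Definability

/-! ### Separation, Kuratowski pairs and products in the model -/

section Axioms

variable {V : Type u} [Membership V V] [IsModel V]

theorem exists_sep (P : V → Prop) [h : Dfn fun v : Fin 1 → V => P (v 0)] (a : V) :
    ∃ b : V, ∀ x, x ∈ b ↔ x ∈ a ∧ P x :=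
  IsModel.separation {x | P x} h.out a

theorem exists_pair (a b : V) : ∃ p, IsPair p a b := by
  obtain ⟨s, hs⟩ := IsModel.pairing a a
  obtain ⟨t, ht⟩ := IsModel.pairing a b
  obtain ⟨p, hp⟩ := IsModel.pairing s t
  refine ⟨p, fun z => ?_⟩
  rw [hp]
  simp only [or_self] at hs
  constructor
  · rintro (rfl | rfl)
    · exact .inl hs
    · exact .inr ht
  · rintro (h | h)
    · exact .inl (IsModel.extensionality _ _ fun t => by rw [h, hs])
    · exact .inr (IsModel.extensionality _ _ fun u => by rw [h, ht])

/-- The Kuratowski pair. -/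
noncomputable def pr (a b : V) : V := (exists_pair a b).choose

theorem isPair_pr (a b : V) : IsPair (pr a b) a b := (exists_pair a b).choose_spec

theorem isPair_iff {p a b : V} : IsPair p a b ↔ p = pr a b := by
  refine ⟨fun h => IsModel.extensionality _ _ fun z => ?_, ?_⟩
  · rw [h z, isPair_pr a b z]
  · rintro rfl
    exact isPair_pr a b

/-- The intersection of a Kuratowski pair is `{a}` and its union is `{a, b}`; from these two sets
`pr_inj` recovers the components. -/
theorem exists_mem_pr_iff {a b t : V} : (∀ z, z ∈ pr a b → t ∈ z) ↔ t = a := by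
  obtain ⟨s, hs⟩ := IsModel.pairing a a
  simp only [or_self] at hs
  constructor
  · intro h
    exact (hs t).1 (h s ((isPair_pr a b s).2 (.inl hs)))
  · rintro rfl z hz
    rcases (isPair_pr _ b z).1 hz with h | h <;> simp [h]

theorem exists_mem_pr_iff' {a b t : V} : (∃ z, z ∈ pr a b ∧ t ∈ z) ↔ t = a ∨ t = b := by
  obtain ⟨s, hs⟩ := IsModel.pairing a b
  constructor
  · rintro ⟨z, hz, ht⟩
    rcases (isPair_pr a b z).1 hz with h | h <;> simp_all
  · intro h
    exact ⟨s, (isPair_pr a b s).2 (.inr hs), (hs t).2 h⟩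

theorem pr_inj {a b c d : V} : pr a b = pr c d ↔ a = c ∧ b = d := by
  refine ⟨fun h => ?_, by rintro ⟨rfl, rfl⟩; rfl⟩
  have hac : a = c := by
    have := exists_mem_pr_iff (a := a) (b := b) (t := a)
    rw [h, exists_mem_pr_iff] at this
    exact this.2 rfl
  subst hac
  refine ⟨rfl, ?_⟩
  have key : ∀ t, t = a ∨ t = b ↔ t = a ∨ t = d := fun t => by
    rw [← exists_mem_pr_iff', h, exists_mem_pr_iff']
  rcases (key b).1 (.inr rfl) with h1 | h1
  · rcases (key d).2 (.inr rfl) with h2 | h2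
    · rw [h1, h2]
    · exact h2.symm
  · exact h1

/-- A Kuratowski pair is a set of subsets of A ∪ B, so separation inside the double power set
suffices. -/
theorem exists_prod (A B : V) : ∃ c : V, ∀ z, z ∈ c ↔ ∃ a b, a ∈ A ∧ b ∈ B ∧ z = pr a b := by
  obtain ⟨p, hp⟩ := IsModel.pairing A B
  obtain ⟨U, hU⟩ := IsModel.union p
  obtain ⟨Q, hQ⟩ := IsModel.powerset U
  obtain ⟨Q', hQ'⟩ := IsModel.powerset Q
  obtain ⟨c, hc⟩ := exists_sep (fun z => ∃ a b, a ∈ A ∧ b ∈ B ∧ IsPair z a b) Q'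
  refine ⟨c, fun z => ?_⟩
  simp only [hc, isPair_iff, and_iff_right_iff_imp]
  rintro ⟨a, b, ha, hb, rfl⟩
  rw [hQ']
  intro z hz
  rw [hQ]
  intro t ht
  rw [hU]
  rcases exists_mem_pr_iff'.1 ⟨z, hz, ht⟩ with rfl | rfl
  · exact ⟨A, (hp A).2 (.inl rfl), ha⟩
  · exact ⟨B, (hp B).2 (.inr rfl), hb⟩

end Axioms

/-! ## Internal types -/

/-- The elements of `α` are coded by the elements of a set of the model. -/
class IType (V : Type u) [Membership V V] (α : Type v) [Coded V α] : Prop where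
  exists_code : ∀ a : α, ∃ v : V, ∀ w : V, Coded.Codes w a ↔ w = v
  codes_inj : ∀ (v : V) (a b : α), Coded.Codes v a → Coded.Codes v b → a = b
  exists_carrier : ∃ c : V, ∀ v : V, v ∈ c ↔ ∃ a : α, Coded.Codes v a

/-- The function `f` belongs to the model. -/
class IMap (V : Type u) [Membership V V] {α : Type v} {β : Type w} [Coded V α] [Coded V β]
    (f : α → β) : Prop where
  out : Internal V f

/-- The predicate `P` belongs to the model. -/
class IPred (V : Type u) [Membership V V] {α : Type v} [Coded V α] (P : α → Prop) : Prop where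
  out : Internal V {a | P a}

/-! ### Codes of elements; products, power sets and function spaces as internal types -/

section Codes

variable {V : Type u} [Membership V V]

section

variable {α : Type v} [Coded V α] [IType V α]

variable (V) in
/-- The code of an element of an internal type. -/
noncomputable def cd (a : α) : V := (IType.exists_code (V := V) a).choose

theorem codes_iff {v : V} {a : α} : Coded.Codes v a ↔ v = cd V a :=
  (IType.exists_code (V := V) a).choose_spec v

theorem cd_inj {a b : α} : cd V a = cd V b ↔ a = b :=
  ⟨fun h => IType.codes_inj (V := V) _ a b (codes_iff.2 rfl) (codes_iff.2 h), fun h => h ▸ rfl⟩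

variable (V α) in
/-- The set of the model whose elements code the elements of `α`. -/
noncomputable def car : V := (IType.exists_carrier (V := V) (α := α)).choose

theorem mem_car {v : V} : v ∈ car V α ↔ ∃ a : α, v = cd V a := by
  rw [car, (IType.exists_carrier (V := V) (α := α)).choose_spec v]
  simp only [codes_iff]

/-- Membership in a parameter is an atomic formula, so an internal predicate enters formulas as `cd
V a ∈ v`. Together with the converse `IPred.of_dfn`, this reduces closure properties to writing down
a formula. -/
theorem IPred.exists_set {P : α → Prop} (h : IPred V P) : ∃ v : V, ∀ a, P a ↔ cd V a ∈ v := by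
  obtain ⟨v, hv⟩ := h.out
  refine ⟨v, fun a => ?_⟩
  rw [hv]
  simp only [Set.mem_ofPred_eq, codes_iff, cd_inj]
  simp

variable [IsModel V]

theorem IPred.of_dfn {P : α → Prop} (Q : V → Prop) [Dfn fun v : Fin 1 → V => Q (v 0)]
    (h : ∀ a, P a ↔ Q (cd V a)) : IPred V P := by
  obtain ⟨b, hb⟩ := exists_sep Q (car V α)
  refine ⟨b, fun z => ?_⟩
  simp only [hb, mem_car, codes_iff, Set.mem_ofPred_eq, h]
  constructor
  · rintro ⟨⟨a, rfl⟩, h⟩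
    exact ⟨a, h, rfl⟩
  · rintro ⟨a, h, rfl⟩
    exact ⟨⟨a, rfl⟩, h⟩

end

variable [IsModel V] {α : Type v} {β : Type w} [Coded V α] [Coded V β] [IType V α] [IType V β]

theorem codes_prod {v : V} {p : α × β} : Coded.Codes v p ↔ v = pr (cd V p.1) (cd V p.2) := by
  change (∃ a b : V, Coded.Codes a p.1 ∧ Coded.Codes b p.2 ∧ IsPair v a b) ↔ _
  simp only [codes_iff, isPair_iff]
  simp

instance : IType V (α × β) where
  exists_code p := ⟨_, fun _ => codes_prod⟩
  codes_inj v p q hp hq := by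
    rw [codes_prod] at hp hq
    rw [hp, pr_inj, cd_inj, cd_inj] at hq
    exact Prod.ext hq.1 hq.2
  exists_carrier := by
    obtain ⟨c, hc⟩ := exists_prod (car V α) (car V β)
    refine ⟨c, fun v => ?_⟩
    simp only [hc, mem_car, codes_prod]
    constructor
    · rintro ⟨_, _, ⟨a, rfl⟩, ⟨b, rfl⟩, h⟩
      exact ⟨(a, b), h⟩
    · rintro ⟨p, h⟩
      exact ⟨_, _, ⟨_, rfl⟩, ⟨_, rfl⟩, h⟩

theorem cd_prod (p : α × β) : cd V p = pr (cd V p.1) (cd V p.2) :=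
  (codes_prod.1 (codes_iff.2 rfl))

theorem codes_fun {v : V} {f : α → β} :
    Coded.Codes v f ↔ ∀ z, z ∈ v ↔ ∃ a, z = pr (cd V a) (cd V (f a)) := by
  change (∀ z : V, z ∈ v ↔ ∃ a : α, Coded.Codes z (a, f a)) ↔ _
  simp only [codes_prod]

theorem codes_set {v : V} {S : Set α} :
    Coded.Codes v S ↔ ∀ z, z ∈ v ↔ ∃ a ∈ S, z = cd V a := by
  change (∀ z : V, z ∈ v ↔ ∃ a ∈ S, Coded.Codes z a) ↔ _
  simp only [codes_iff]

theorem IMap.exists_set {f : α → β} (h : IMap V f) :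
    ∃ v : V, ∀ a y, pr (cd V a) y ∈ v ↔ y = cd V (f a) := by
  obtain ⟨v, hv⟩ := h.out
  rw [codes_fun] at hv
  refine ⟨v, fun a y => ?_⟩
  rw [hv]
  simp only [pr_inj, cd_inj]
  constructor
  · rintro ⟨_, rfl, h⟩
    exact h
  · exact fun h => ⟨a, rfl, h⟩

theorem IMap.of_dfn {f : α → β} (Q : V → V → Prop) [Dfn fun v : Fin 2 → V => Q (v 0) (v 1)]
    (h : ∀ a b, b = f a ↔ Q (cd V a) (cd V b)) : IMap V f := by
  have : Dfn fun v : Fin 1 → V => ∃ x y, Q x y ∧ IsPair (v 0) x y := by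
    -- The variable `Q` is opaque to instance search, so its definability is moved by hand to the
    -- context that two quantifiers create.
    have h : Dfn fun v : (Fin 1 ⊕ Fin 1) ⊕ Fin 1 → V => Q (v (Sum.inl (Sum.inr 0))) (v (Sum.inr 0)) :=
      ⟨(Dfn.out (P := fun v : Fin 2 → V => Q (v 0) (v 1))).preimage_comp
        ![Sum.inl (Sum.inr 0), Sum.inr 0]⟩
    infer_instance
  obtain ⟨c, hc⟩ := exists_sep (fun z => ∃ x y, Q x y ∧ IsPair z x y) (car V (α × β))
  refine ⟨c, codes_fun.2 fun z => ?_⟩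
  simp only [hc, mem_car, isPair_iff, cd_prod]
  constructor
  · rintro ⟨⟨p, rfl⟩, x, y, hxy, h'⟩
    rw [pr_inj] at h'
    rw [← h'.1, ← h'.2, ← h] at hxy
    exact ⟨p.1, by rw [hxy]⟩
  · rintro ⟨a, rfl⟩
    exact ⟨⟨(a, f a), rfl⟩, _, _, (h _ _).1 rfl, rfl⟩

instance : IType V (ISet V α) where
  exists_code S := by
    obtain ⟨v, hv⟩ := S.2
    refine ⟨v, fun w => ⟨fun hw => IsModel.extensionality _ _ fun z => ?_, ?_⟩⟩
    · exact (codes_set.1 hw z).trans (codes_set.1 hv z).symm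
    · rintro rfl
      exact hv
  codes_inj v S T hS hT := by
    refine Subtype.ext (Set.ext fun a => ?_)
    have h := (codes_set.1 hS (cd V a)).symm.trans (codes_set.1 hT (cd V a))
    simpa [cd_inj] using h
  exists_carrier := by
    obtain ⟨p, hp⟩ := IsModel.powerset (car V α)
    refine ⟨p, fun v => ?_⟩
    rw [hp]
    constructor
    · intro h
      have hv : Coded.Codes v {a : α | cd V a ∈ v} := codes_set.2 fun z => by
        constructor
        · intro hz
          obtain ⟨a, rfl⟩ := mem_car.1 (h z hz)
          exact ⟨a, hz, rfl⟩
        · rintro ⟨a, ha, rfl⟩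
          exact ha
      exact ⟨⟨_, v, hv⟩, hv⟩
    · rintro ⟨S, hS⟩ z hz
      obtain ⟨a, -, rfl⟩ := (codes_set.1 hS z).1 hz
      exact mem_car.2 ⟨a, rfl⟩

theorem cd_mem_cd {a : α} {S : ISet V α} : cd V a ∈ cd V S ↔ a ∈ S.1 := by
  have h' : Coded.Codes (cd V S) S := codes_iff.2 rfl
  have h : Coded.Codes (cd V S) S.1 := h'
  rw [codes_set.1 h]
  simp [cd_inj]

instance : IType V (IFun V α β) where
  exists_code f := by
    obtain ⟨v, hv⟩ := f.2
    refine ⟨v, fun w => ⟨fun hw => IsModel.extensionality _ _ fun z => ?_, ?_⟩⟩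
    · exact (codes_fun.1 hw z).trans (codes_fun.1 hv z).symm
    · rintro rfl
      exact hv
  codes_inj v f g hf hg := by
    refine Subtype.ext (funext fun a => ?_)
    have h := (codes_fun.1 hf (pr (cd V a) (cd V (f.1 a)))).symm.trans (codes_fun.1 hg _)
    obtain ⟨b, hb⟩ := h.1 ⟨a, rfl⟩
    rw [pr_inj, cd_inj, cd_inj] at hb
    rw [hb.2, hb.1]
  exists_carrier := by
    obtain ⟨p, hp⟩ := IsModel.powerset (car V (α × β))
    -- Functional graphs are cut out of the power set of the product. Unique existence is written
    -- with `∃`, `∀` and `↔`, the connectives for which `Dfn` has instances.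
    obtain ⟨c, hc⟩ := exists_sep (fun v => ∀ x, x ∈ car V α →
      ∃ y, ∀ y', y' = y ↔ ∃ z, z ∈ v ∧ IsPair z x y') p
    refine ⟨c, fun v => ?_⟩
    simp only [hc, hp, isPair_iff]
    constructor
    · rintro ⟨h, h'⟩
      have h' : ∀ a : α, ∃ b : β, ∀ b', b' = b ↔ pr (cd V a) (cd V b') ∈ v := fun a => by
        obtain ⟨y, hy⟩ := h' (cd V a) (mem_car.2 ⟨a, rfl⟩)
        obtain ⟨z, hz, rfl⟩ := (hy y).1 rfl
        obtain ⟨p, hp⟩ := mem_car.1 (h _ hz)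
        rw [cd_prod, pr_inj] at hp
        refine ⟨p.2, fun b' => ?_⟩
        rw [← cd_inj (V := V), ← hp.2, hy]
        simp
      choose f hf using h'
      have hv : Coded.Codes v f := codes_fun.2 fun z => by
        constructor
        · intro hz
          obtain ⟨p, rfl⟩ := mem_car.1 (h z hz)
          rw [cd_prod] at hz ⊢
          exact ⟨p.1, by rw [(hf p.1 p.2).2 hz]⟩
        · rintro ⟨a, rfl⟩
          exact (hf a _).1 rfl
      exact ⟨⟨f, v, hv⟩, hv⟩
    · rintro ⟨f, hf⟩
      have hf' := codes_fun.1 hf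
      constructor
      · intro z hz
        obtain ⟨a, rfl⟩ := (hf' z).1 hz
        exact mem_car.2 ⟨(a, f.1 a), by rw [cd_prod]⟩
      · intro x hx
        obtain ⟨a, rfl⟩ := mem_car.1 hx
        refine ⟨cd V (f.1 a), fun y => ?_⟩
        simp only [hf', exists_eq_right, pr_inj, cd_inj]
        constructor
        · rintro rfl
          exact ⟨a, rfl, rfl⟩
        · rintro ⟨_, rfl, h⟩
          exact h

theorem mem_cd_fun {a : α} {y : V} {f : IFun V α β} :
    pr (cd V a) y ∈ cd V f ↔ y = cd V (f.1 a) := by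
  have h' : Coded.Codes (cd V f) f := codes_iff.2 rfl
  have h : Coded.Codes (cd V f) f.1 := h'
  rw [codes_fun.1 h]
  simp only [pr_inj, cd_inj]
  constructor
  · rintro ⟨_, rfl, h⟩
    exact h
  · exact fun h => ⟨a, rfl, h⟩

end Codes

/-! ## Closure properties of internal predicates and functions -/

section Closure

variable {V : Type u} [Membership V V] [IsModel V]
variable {α β γ : Type u} [Coded V α] [Coded V β] [Coded V γ]
  [IType V α] [IType V β] [IType V γ]

/-- The proposition need not be expressible in the model: its extension is either everything or
empty, and both are sets of the model. -/
instance (priority := high) IPred.const (p : Prop) : IPred V fun _ : α => p := by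
  obtain ⟨e, he⟩ := IsModel.infinity (V := V)
  obtain ⟨z, -, hz⟩ := he.1
  by_cases hp : p
  · exact IPred.of_dfn (fun x => ¬ x ∈ z) fun a => by simp [hp, hz]
  · exact IPred.of_dfn (fun x => x ∈ z) fun a => by simp [hp, hz]

instance IPred.and (P Q : α → Prop) [hP : IPred V P] [hQ : IPred V Q] :
    IPred V fun a => P a ∧ Q a := by
  obtain ⟨s, hs⟩ := hP.exists_set
  obtain ⟨t, ht⟩ := hQ.exists_set
  exact IPred.of_dfn (fun x => x ∈ s ∧ x ∈ t) fun a => by rw [hs, ht]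

instance IPred.not (P : α → Prop) [hP : IPred V P] : IPred V fun a => ¬ P a := by
  obtain ⟨s, hs⟩ := hP.exists_set
  exact IPred.of_dfn (fun x => ¬ x ∈ s) fun a => by rw [hs]

instance IPred.or (P Q : α → Prop) [hP : IPred V P] [hQ : IPred V Q] :
    IPred V fun a => P a ∨ Q a := by
  obtain ⟨s, hs⟩ := hP.exists_set
  obtain ⟨t, ht⟩ := hQ.exists_set
  exact IPred.of_dfn (fun x => x ∈ s ∨ x ∈ t) fun a => by rw [hs, ht]

instance IPred.imp (P Q : α → Prop) [hP : IPred V P] [hQ : IPred V Q] :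
    IPred V fun a => P a → Q a := by
  simp only [imp_iff_not_or]
  infer_instance

instance IPred.iff (P Q : α → Prop) [hP : IPred V P] [hQ : IPred V Q] :
    IPred V fun a => P a ↔ Q a := by
  simp only [iff_iff_implies_and_implies]
  infer_instance

instance IPred.exists (P : α → β → Prop) [h : IPred V fun p : α × β => P p.1 p.2] :
    IPred V fun a => ∃ b, P a b := by
  obtain ⟨s, hs⟩ := h.exists_set
  refine IPred.of_dfn (fun x => ∃ y z, z ∈ s ∧ IsPair z x y ∧ y ∈ car V β) fun a => ?_
  simp only [isPair_iff, mem_car]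
  constructor
  · rintro ⟨b, hb⟩
    exact ⟨_, _, (hs (a, b)).1 hb, cd_prod _, b, rfl⟩
  · rintro ⟨_, _, hz, rfl, b, rfl⟩
    exact ⟨b, (hs (a, b)).2 (by rwa [cd_prod])⟩

instance IPred.forall (P : α → β → Prop) [h : IPred V fun p : α × β => P p.1 p.2] :
    IPred V fun a => ∀ b, P a b := by
  have : IPred V fun a => ¬ ∃ b, ¬ P a b := inferInstance
  simpa only [not_exists, not_not] using this

instance (priority := high) IMap.id : IMap V fun a : α => a :=
  IMap.of_dfn (fun x y => y = x) fun a b => by rw [cd_inj]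

instance (priority := high) IMap.const (b : β) : IMap V fun _ : α => b :=
  IMap.of_dfn (fun _ y => y = cd V b) fun a b => by rw [cd_inj]

theorem IMap.comp' (g : β → γ) (f : α → β) (hg : IMap V g) (hf : IMap V f) :
    IMap V fun a => g (f a) := by
  obtain ⟨s, hs⟩ := hg.exists_set
  obtain ⟨t, ht⟩ := hf.exists_set
  refine IMap.of_dfn (fun x z => ∃ y p q, p ∈ t ∧ q ∈ s ∧ IsPair p x y ∧ IsPair q y z)
    fun a b => ?_
  simp only [isPair_iff]
  constructor
  · rintro rfl
    exact ⟨_, _, _, (ht a _).2 rfl, (hs (f a) _).2 rfl, rfl, rfl⟩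
  · rintro ⟨y, _, _, hp, hq, rfl, rfl⟩
    rw [ht] at hp
    subst hp
    rwa [hs, cd_inj] at hq

theorem IPred.comp' (P : β → Prop) (f : α → β) (hP : IPred V P) (hf : IMap V f) :
    IPred V fun a => P (f a) := by
  obtain ⟨s, hs⟩ := hP.exists_set
  obtain ⟨t, ht⟩ := hf.exists_set
  refine IPred.of_dfn (fun x => ∃ y p, p ∈ t ∧ y ∈ s ∧ IsPair p x y) fun a => ?_
  simp only [isPair_iff]
  constructor
  · exact fun h => ⟨_, _, (ht a _).2 rfl, (hs (f a)).1 h, rfl⟩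
  · rintro ⟨y, _, hp, hy, rfl⟩
    rw [ht] at hp
    subst hp
    rwa [hs]

/-- The pattern `g (f a)` fits almost every term, hence the low priority. -/
instance (priority := low) IMap.comp (g : β → γ) (f : α → β) [hg : IMap V g] [hf : IMap V f] :
    IMap V fun a => g (f a) :=
  IMap.comp' g f hg hf

instance (priority := low) IPred.comp (P : β → Prop) (f : α → β) [hP : IPred V P]
    [hf : IMap V f] : IPred V fun a => P (f a) :=
  IPred.comp' P f hP hf

instance IMap.prodMk (f : α → β) (g : α → γ) [hf : IMap V f] [hg : IMap V g] :
    IMap V fun a => (f a, g a) := by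
  obtain ⟨s, hs⟩ := hf.exists_set
  obtain ⟨t, ht⟩ := hg.exists_set
  refine IMap.of_dfn (fun x y => ∃ y₁ y₂ p q, p ∈ s ∧ q ∈ t ∧ IsPair p x y₁ ∧ IsPair q x y₂ ∧
    IsPair y y₁ y₂) fun a b => ?_
  simp only [isPair_iff]
  constructor
  · rintro rfl
    exact ⟨_, _, _, _, (hs a _).2 rfl, (ht a _).2 rfl, rfl, rfl, cd_prod _⟩
  · rintro ⟨_, _, _, _, hp, hq, rfl, rfl, h⟩
    rw [hs] at hp
    rw [ht] at hq
    rw [cd_prod, hp, hq, pr_inj, cd_inj, cd_inj] at h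
    exact Prod.ext h.1 h.2

instance IMap.fst (f : α → β × γ) [hf : IMap V f] : IMap V fun a => (f a).1 := by
  refine IMap.comp' (fun p : β × γ => p.1) f ?_ hf
  refine IMap.of_dfn (fun x y => ∃ z, IsPair x y z) fun a b => ?_
  simp only [isPair_iff, cd_prod a, pr_inj, cd_inj]
  simp [eq_comm]

instance IMap.snd (f : α → β × γ) [hf : IMap V f] : IMap V fun a => (f a).2 := by
  refine IMap.comp' (fun p : β × γ => p.2) f ?_ hf
  refine IMap.of_dfn (fun x y => ∃ z, IsPair x z y) fun a b => ?_
  simp only [isPair_iff, cd_prod a, pr_inj, cd_inj]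
  simp [eq_comm]

instance (priority := high) IMap.prodFst : IMap V (Prod.fst : α × β → α) := IMap.fst _

instance (priority := high) IMap.prodSnd : IMap V (Prod.snd : α × β → β) := IMap.snd _

/-- A relation applied to two functions. -/
theorem IPred.comp₂ (P : β → γ → Prop) (f : α → β) (g : α → γ)
    (hP : IPred V fun p : β × γ => P p.1 p.2) (hf : IMap V f) (hg : IMap V g) :
    IPred V fun a => P (f a) (g a) :=
  IPred.comp' (fun p : β × γ => P p.1 p.2) (fun a => (f a, g a)) hP inferInstance

theorem IMap.comp₂ {δ : Type u} [Coded V δ] [IType V δ] (h : β → γ → δ) (f : α → β) (g : α → γ)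
    (hh : IMap V fun p : β × γ => h p.1 p.2) (hf : IMap V f) (hg : IMap V g) :
    IMap V fun a => h (f a) (g a) :=
  IMap.comp' (fun p : β × γ => h p.1 p.2) (fun a => (f a, g a)) hh inferInstance

instance IPred.eq (f g : α → β) [hf : IMap V f] [hg : IMap V g] :
    IPred V fun a => f a = g a := by
  refine IPred.comp₂ (fun x y : β => x = y) f g ?_ hf hg
  refine IPred.of_dfn (fun x => ∃ y, IsPair x y y) fun p => ?_
  simp only [isPair_iff, cd_prod, pr_inj]
  constructor
  · intro h
    exact ⟨_, rfl, by rw [h]⟩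
  · rintro ⟨y, h₁, h₂⟩
    rw [← cd_inj (V := V), h₁, h₂]

instance IMap.prodMkLeft (b : β) : IMap V fun x : γ => (b, x) :=
  IMap.prodMk (fun _ => b) fun x => x

instance IPred.mem (f : α → β) (S : α → ISet V β) [hf : IMap V f] [hS : IMap V S] :
    IPred V fun a => f a ∈ (S a).1 := by
  refine IPred.comp₂ (fun (x : β) (S : ISet V β) => x ∈ S.1) f S ?_ hf hS
  refine IPred.of_dfn (fun x => ∃ y z, IsPair x y z ∧ y ∈ z) fun p => ?_
  simp only [isPair_iff, cd_prod, pr_inj]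
  constructor
  · intro h
    exact ⟨_, _, ⟨rfl, rfl⟩, cd_mem_cd.2 h⟩
  · rintro ⟨_, _, ⟨rfl, rfl⟩, h⟩
    exact cd_mem_cd.1 h

instance IMap.app (F : α → IFun V β γ) (f : α → β) [hF : IMap V F] [hf : IMap V f] :
    IMap V fun a => (F a).1 (f a) := by
  refine IMap.comp₂ (fun (F : IFun V β γ) (x : β) => F.1 x) F f ?_ hF hf
  refine IMap.of_dfn (fun x y => ∃ g b p, IsPair x g b ∧ IsPair p b y ∧ p ∈ g) fun p c => ?_
  simp only [isPair_iff, cd_prod, pr_inj]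
  constructor
  · rintro rfl
    exact ⟨_, _, _, ⟨rfl, rfl⟩, rfl, mem_cd_fun.2 rfl⟩
  · rintro ⟨_, _, _, ⟨rfl, rfl⟩, rfl, h⟩
    rwa [mem_cd_fun, cd_inj] at h

/-- This is how unique existence yields a function of the model. The values are picked outside by
`choose`; since the graph is an internal relation, the function is internal, and no choice is made
inside the model. -/
theorem IMap.of_graph {f : α → β} (P : α → β → Prop) (hP : IPred V fun p : α × β => P p.1 p.2)
    (h : ∀ a b, b = f a ↔ P a b) : IMap V f := by
  obtain ⟨s, hs⟩ := hP.exists_set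
  refine IMap.of_dfn (fun x y => ∃ z, IsPair z x y ∧ z ∈ s) fun a b => ?_
  simp only [isPair_iff, exists_eq_left]
  rw [h, hs (a, b), cd_prod]

instance IFun.iMap (f : IFun V α β) : IMap V f.1 := ⟨f.2⟩

instance ISet.iPred (S : ISet V α) : IPred V fun a => a ∈ S.1 := ⟨S.2⟩

variable (V) in
/-- The set of the model given by an internal predicate. -/
def iset (P : α → Prop) [h : IPred V P] : ISet V α := ⟨{a | P a}, h.out⟩

@[simp] theorem mem_iset {P : α → Prop} [IPred V P] {a : α} :
    a ∈ (iset V P : ISet V α).1 ↔ P a := Iff.rfl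

variable (V) in
/-- The function of the model given by an internal function. -/
def ifun (f : α → β) [h : IMap V f] : IFun V α β := ⟨f, h.out⟩

@[simp] theorem ifun_apply {f : α → β} [IMap V f] {a : α} : (ifun V f : IFun V α β).1 a = f a := rfl

theorem ISet.ext' {S T : ISet V α} (h : ∀ a, a ∈ S.1 ↔ a ∈ T.1) : S = T :=
  Subtype.ext (Set.ext h)

theorem IFun.ext' {f g : IFun V α β} (h : ∀ a, f.1 a = g.1 a) : f = g :=
  Subtype.ext (funext h)

instance IMap.iset (P : α → β → Prop) [h : ∀ a, IPred V (P a)]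
    [h' : IPred V fun p : α × β => P p.1 p.2] : IMap V fun a => (iset V (P a) : ISet V β) := by
  refine IMap.of_graph (fun a S => ∀ b, b ∈ S.1 ↔ P a b) ?_ fun a S => ?_
  · have := IPred.comp' (fun p : α × β => P p.1 p.2)
      (fun p : (α × ISet V β) × β => (p.1.1, p.2)) h' inferInstance
    infer_instance
  · constructor
    · rintro rfl b
      rfl
    · exact fun h => ISet.ext' fun b => h b

instance IMap.ifun (f : α → β → γ) [h : ∀ a, IMap V (f a)]
    [h' : IMap V fun p : α × β => f p.1 p.2] : IMap V fun a => (ifun V (f a) : IFun V β γ) := by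
  refine IMap.of_graph (fun a F => ∀ b, F.1 b = f a b) ?_ fun a F => ?_
  · have := IMap.comp' (fun p : α × β => f p.1 p.2)
      (fun p : (α × IFun V β γ) × β => (p.1.1, p.2)) h' inferInstance
    infer_instance
  · constructor
    · rintro rfl b
      rfl
    · exact fun h => IFun.ext' fun b => h b

instance IMap.ite (P : α → Prop) [∀ a, Decidable (P a)] (f g : α → β) [hP : IPred V P]
    [hf : IMap V f] [hg : IMap V g] : IMap V fun a => if P a then f a else g a := by
  refine IMap.of_graph (fun a b => (P a ∧ b = f a) ∨ (¬ P a ∧ b = g a)) ?_ fun a b => ?_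
  · infer_instance
  · by_cases h : P a <;> simp [h]

end Closure

/-! ### Subtypes, elements of a set of the model, complex numbers -/

section Subtypes

variable {V : Type u} [Membership V V] [IsModel V]
variable {α β : Type u} [Coded V α] [Coded V β] [IType V α] [IType V β]

theorem codes_subtype {p : α → Prop} {v : V} {a : Subtype p} :
    Coded.Codes v a ↔ v = cd V a.1 :=
  codes_iff (V := V) (a := a.1)

instance (p : α → Prop) [h : IPred V p] : IType V (Subtype p) where
  exists_code a := ⟨_, fun _ => codes_subtype⟩
  codes_inj v a b ha hb := by
    rw [codes_subtype] at ha hb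
    exact Subtype.ext (cd_inj.1 (ha.symm.trans hb))
  exists_carrier := by
    obtain ⟨s, hs⟩ := h.out
    refine ⟨s, fun v => ?_⟩
    rw [hs]
    exact ⟨fun ⟨a, ha, hv⟩ => ⟨⟨a, ha⟩, hv⟩, fun ⟨a, hv⟩ => ⟨a.1, a.2, hv⟩⟩

theorem cd_subtype {p : α → Prop} [IPred V p] (a : Subtype p) : cd V a = cd V a.1 :=
  codes_subtype.1 (codes_iff.2 rfl)

instance IMap.subtypeVal {p : α → Prop} [IPred V p] (f : β → Subtype p) [hf : IMap V f] :
    IMap V fun b => (f b).1 := by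
  refine IMap.comp' (fun a : Subtype p => a.1) f ?_ hf
  refine IMap.of_dfn (fun x y => y = x) fun a b => ?_
  rw [cd_subtype, cd_inj]

instance (priority := high) IMap.val {p : α → Prop} [IPred V p] :
    IMap V (Subtype.val : Subtype p → α) := IMap.subtypeVal _

instance IMap.subtypeMk {p : α → Prop} [IPred V p] (f : β → α) (h : ∀ b, p (f b))
    [hf : IMap V f] : IMap V fun b => (⟨f b, h b⟩ : Subtype p) :=
  IMap.of_graph (fun b a => a.1 = f b) inferInstance fun b a => by rw [Subtype.ext_iff]

instance (A : V) : IType V (El A) where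
  exists_code a := ⟨a.1, fun _ => Iff.rfl⟩
  codes_inj _ _ _ h h' := Subtype.ext (h.symm.trans h')
  exists_carrier := ⟨A, fun v => ⟨fun h => ⟨⟨v, h⟩, rfl⟩, fun ⟨a, h⟩ => h ▸ a.2⟩⟩

theorem cd_el {A : V} (a : El A) : cd V a = a.1 :=
  (codes_iff.1 (rfl : Coded.Codes a.1 a)).symm

instance (a b : α) : IType V (QuadraticAlgebra α a b) where
  exists_code z := IType.exists_code (z.re, z.im)
  codes_inj v z w hz hw := by
    have := IType.codes_inj v (z.re, z.im) (w.re, w.im) hz hw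
    simp only [Prod.mk.injEq] at this
    exact QuadraticAlgebra.ext this.1 this.2
  exists_carrier := by
    obtain ⟨c, hc⟩ := IType.exists_carrier (V := V) (α := α × α)
    refine ⟨c, fun v => (hc v).trans ⟨fun ⟨p, hp⟩ => ⟨⟨p.1, p.2⟩, hp⟩, fun ⟨z, hz⟩ =>
      ⟨(z.re, z.im), hz⟩⟩⟩

theorem cd_quadratic {a b : α} (z : QuadraticAlgebra α a b) : cd V z = cd V (z.re, z.im) :=
  codes_iff.1 (codes_iff.2 rfl : Coded.Codes (cd V z) z)

theorem iMap_quadratic_toProd {a b : α} :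
    IMap V fun z : QuadraticAlgebra α a b => (z.re, z.im) := by
  refine IMap.of_dfn (fun x y => y = x) fun z p => ?_
  rw [cd_quadratic, cd_inj]

instance IMap.re {a b : α} (f : β → QuadraticAlgebra α a b) [hf : IMap V f] :
    IMap V fun x => (f x).re := by
  have := IMap.comp' _ f iMap_quadratic_toProd hf
  exact IMap.fst fun x => ((f x).re, (f x).im)

instance IMap.im {a b : α} (f : β → QuadraticAlgebra α a b) [hf : IMap V f] :
    IMap V fun x => (f x).im := by
  have := IMap.comp' _ f iMap_quadratic_toProd hf
  exact IMap.snd fun x => ((f x).re, (f x).im)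

instance IMap.quadraticMk {a b : α} (f g : β → α) [IMap V f] [IMap V g] :
    IMap V fun x => (⟨f x, g x⟩ : QuadraticAlgebra α a b) :=
  IMap.of_graph (fun x z => z.re = f x ∧ z.im = g x) inferInstance fun x z =>
    QuadraticAlgebra.ext_iff

/-- If `π : α → β` is surjective, then `β` can be coded by its fibres. -/
abbrev codedOfSurj (π : α → β) : Coded V β := ⟨fun v b => Coded.Codes v {a | π a = b}⟩

end Subtypes

/-! ### Quotients by internal equivalence relations -/

section Quotients

variable {V : Type u} [Membership V V] [IsModel V]
variable {α β γ : Type u} [Coded V α] [IType V α] [Coded V γ] [IType V γ]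

/-- A point of the quotient is coded by its fibre, which is a set of the model because the
equivalence relation is internal. The fibres are a definable part of the power set, so no
representatives have to be chosen. -/
theorem iType_of_surj (π : α → β) (hπ : Function.Surjective π)
    (h : IPred V fun p : α × α => π p.1 = π p.2) : @IType V _ β (codedOfSurj π) := by
  have h₁ : ∀ a : α, IPred V fun a' => π a' = π a := fun a =>
    IPred.comp' (fun p : α × α => π p.1 = π p.2) (fun a' => (a', a)) h inferInstance
  have h₂ : IPred V fun S : ISet V α => ∃ a, ∀ a', a' ∈ S.1 ↔ π a' = π a := by
    have := IPred.comp' (fun p : α × α => π p.1 = π p.2)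
      (fun p : (ISet V α × α) × α => (p.2, p.1.2)) h inferInstance
    infer_instance
  let : Coded V β := codedOfSurj π
  constructor
  · intro b
    obtain ⟨a, rfl⟩ := hπ b
    exact IType.exists_code (iset V fun a' => π a' = π a)
  · intro v b b' hb hb'
    obtain ⟨a, rfl⟩ := hπ b
    have := (codes_set.1 hb (cd V a)).symm.trans (codes_set.1 hb' (cd V a))
    simpa [cd_inj] using this
  · obtain ⟨s, hs⟩ := h₂.out
    refine ⟨s, fun v => (hs v).trans ?_⟩
    constructor
    · rintro ⟨S, ⟨a, ha⟩, hv⟩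
      refine ⟨π a, ?_⟩
      have : {a' | π a' = π a} = S.1 := Set.ext fun a' => (ha a').symm
      change Coded.Codes v {a' | π a' = π a}
      rw [this]
      exact hv
    · rintro ⟨b, hb⟩
      obtain ⟨a, rfl⟩ := hπ b
      exact ⟨iset V fun a' => π a' = π a, ⟨a, fun a' => Iff.rfl⟩, hb⟩

/-- As points of `β` are coded by their fibres, the graph of `π` is the membership relation between
codes. -/
theorem iMap_of_surj (π : α → β) (hπ : Function.Surjective π)
    (h : IPred V fun p : α × α => π p.1 = π p.2) :
    @IMap V _ α β _ (codedOfSurj π) π := by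
  let : Coded V β := codedOfSurj π
  have : IType V β := iType_of_surj π hπ h
  refine IMap.of_dfn (fun x y => x ∈ y) fun a b => ?_
  have hb' : Coded.Codes (cd V b) b := codes_iff.2 rfl
  have hb : Coded.Codes (cd V b) {a | π a = b} := hb'
  rw [codes_set.1 hb]
  simp [cd_inj, eq_comm]

variable [Coded V β] [IType V β]

/-- Functions on a quotient are internal if they are internal on representatives. -/
theorem IMap.of_comp_surj {π : α → β} (hπ : Function.Surjective π) [IMap V π] {f : β → γ}
    (h : IMap V fun a => f (π a)) : IMap V f := by
  refine IMap.of_graph (fun b c => ∃ a, π a = b ∧ f (π a) = c) ?_ fun b c => ?_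
  · have := IMap.comp' (fun a => f (π a)) (fun p : (β × γ) × α => p.2) h inferInstance
    infer_instance
  · obtain ⟨a, rfl⟩ := hπ b
    constructor
    · rintro rfl
      exact ⟨a, rfl, rfl⟩
    · rintro ⟨a', h₁, rfl⟩
      rw [h₁]

end Quotients

/-! ## Internal algebraic operations -/

section Algebra

variable {V : Type u} [Membership V V] {α β γ : Type u} [Coded V α] [Coded V β] [Coded V γ]

/-- Addition belongs to the model. -/
class IAdd (V : Type u) [Membership V V] (α : Type u) [Coded V α] [Add α] : Prop where
  out : IMap V fun p : α × α => p.1 + p.2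

/-- Multiplication belongs to the model. -/
class IMul (V : Type u) [Membership V V] (α : Type u) [Coded V α] [Mul α] : Prop where
  out : IMap V fun p : α × α => p.1 * p.2

/-- The order belongs to the model. -/
class ILE (V : Type u) [Membership V V] (α : Type u) [Coded V α] [LE α] : Prop where
  out : IPred V fun p : α × α => p.1 ≤ p.2

variable [IsModel V] [IType V α] [IType V β] [IType V γ]

instance IMap.add [Add α] [h : IAdd V α] (f g : γ → α) [hf : IMap V f] [hg : IMap V g] :
    IMap V fun x => f x + g x :=
  IMap.comp₂ (fun a b : α => a + b) f g h.out hf hg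

instance IMap.mul [Mul α] [h : IMul V α] (f g : γ → α) [hf : IMap V f] [hg : IMap V g] :
    IMap V fun x => f x * g x :=
  IMap.comp₂ (fun a b : α => a * b) f g h.out hf hg

instance IPred.le [LE α] [h : ILE V α] (f g : γ → α) [hf : IMap V f] [hg : IMap V g] :
    IPred V fun x => f x ≤ g x :=
  IPred.comp₂ (fun a b : α => a ≤ b) f g h.out hf hg

instance IMap.addLeft [Add α] [IAdd V α] (a : α) : IMap V fun x : α => a + x :=
  IMap.add (fun _ => a) fun x => x

instance IMap.mulLeft [Mul α] [IMul V α] (a : α) : IMap V fun x : α => a * x :=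
  IMap.mul (fun _ => a) fun x => x

instance IPred.lt [LinearOrder α] [h : ILE V α] (f g : γ → α) [hf : IMap V f] [hg : IMap V g] :
    IPred V fun x => f x < g x := by
  simp only [← not_le]
  infer_instance

instance IPred.ltLeft [LinearOrder α] [ILE V α] (a : α) : IPred V fun x : α => a < x :=
  IPred.lt (fun _ => a) fun x => x

instance IMap.neg [AddCommGroup α] [h : IAdd V α] (f : γ → α) [hf : IMap V f] :
    IMap V fun x => -f x :=
  IMap.of_graph (fun x y => y + f x = 0) (by infer_instance) fun x y => eq_neg_iff_add_eq_zero

instance IMap.sub [AddCommGroup α] [h : IAdd V α] (f g : γ → α) [hf : IMap V f]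
    [hg : IMap V g] : IMap V fun x => f x - g x := by
  simp only [sub_eq_add_neg]
  infer_instance

instance IMap.inv [Field α] [h : IMul V α] (f : γ → α) [hf : IMap V f] :
    IMap V fun x => (f x)⁻¹ := by
  -- The first alternative accounts for the convention `0⁻¹ = 0`.
  refine IMap.of_graph (fun x y => (f x = 0 ∧ y = 0) ∨ y * f x = 1) (by infer_instance) fun x y => ?_
  constructor
  · rintro rfl
    by_cases h : f x = 0
    · simp [h]
    · exact .inr (inv_mul_cancel₀ h)
  · rintro (⟨h, rfl⟩ | h)
    · simp [h]
    · exact eq_inv_of_mul_eq_one_left h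

instance IMap.abs [AddCommGroup α] [LinearOrder α] [IsOrderedAddMonoid α] [IAdd V α] [ILE V α]
    (f : γ → α) [hf : IMap V f] : IMap V fun x => |f x| := by
  refine IMap.of_graph (fun x y => (0 ≤ f x ∧ y = f x) ∨ (f x ≤ 0 ∧ y = -f x)) (by infer_instance)
    fun x y => ?_
  constructor
  · rintro rfl
    rcases le_total 0 (f x) with h | h
    · exact .inl ⟨h, abs_of_nonneg h⟩
    · exact .inr ⟨h, abs_of_nonpos h⟩
  · rintro (⟨h, rfl⟩ | ⟨h, rfl⟩)
    · exact (abs_of_nonneg h).symm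
    · exact (abs_of_nonpos h).symm

instance IMap.sq [Monoid α] [h : IMul V α] (f : γ → α) [hf : IMap V f] :
    IMap V fun x => f x ^ 2 := by
  simp only [pow_two]
  infer_instance

end Algebra

/-! ## Natural numbers -/

section Naturals

variable {V : Type u} [Membership V V] [IsModel V]

theorem exists_succ (x : V) : ∃ y : V, ∀ z, z ∈ y ↔ z ∈ x ∨ z = x := by
  obtain ⟨s, hs⟩ := IsModel.pairing x x
  obtain ⟨p, hp⟩ := IsModel.pairing x s
  obtain ⟨u, hu⟩ := IsModel.union p
  refine ⟨u, fun z => ?_⟩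
  simp only [or_self] at hs
  rw [hu]
  simp [hp, hs]

/-- Foundation for the set {a, b}. It is what makes the successor injective. -/
theorem not_mem_mem (a b : V) (h : a ∈ b) : b ∉ a := by
  intro h'
  obtain ⟨p, hp⟩ := IsModel.pairing a b
  obtain ⟨y, hy, hy'⟩ := IsModel.foundation p ⟨a, (hp a).2 (.inl rfl)⟩
  rcases (hp y).1 hy with rfl | rfl
  · exact hy' b ((hp _).2 (.inr rfl)) h'
  · exact hy' a ((hp _).2 (.inl rfl)) h

variable (V) in
theorem exists_omega : ∃ w : V, ∀ n, n ∈ w ↔ IsNat n := by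
  obtain ⟨i, ⟨e, hei, he⟩, hi⟩ := IsModel.infinity (V := V)
  have h : IsInductive i := by
    refine ⟨fun e' he' => ?_, fun x y hx hy => ?_⟩
    · rwa [IsModel.extensionality e' e fun z => by simp [he, he']]
    · obtain ⟨y', hy', h⟩ := hi x hx
      rwa [IsModel.extensionality y y' fun z => by rw [h, hy]]
  obtain ⟨w, hw⟩ := exists_sep (fun n => IsNat n) i
  exact ⟨w, fun n => (hw n).trans (and_iff_right_of_imp fun hn => hn i h)⟩

variable (V) in
/-- The set of natural numbers of the model. -/
noncomputable def omega : V := (exists_omega V).choose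

theorem mem_omega {n : V} : n ∈ omega V ↔ IsNat n := (exists_omega V).choose_spec n

variable (V) in
/-- The natural numbers of the model. -/
def INat : Type u := El (omega V)

noncomputable instance : Coded V (INat V) := codedEl _

instance : IType V (INat V) := inferInstanceAs (IType V (El (omega V)))

namespace INat

theorem cd_eq (n : INat V) : cd V n = n.1 := cd_el (A := omega V) n

noncomputable instance : Zero (INat V) := by
  have h : ∃ e : V, e ∈ omega V ∧ ∀ z, z ∉ e := by
    obtain ⟨i, ⟨e, -, he⟩, -⟩ := IsModel.infinity (V := V)
    exact ⟨e, mem_omega.2 fun j hj => hj.1 e he, he⟩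
  exact ⟨⟨h.choose, h.choose_spec.1⟩⟩

theorem not_mem_zero (z : V) : z ∉ (0 : INat V).1 := by
  have h : ∃ e : V, e ∈ omega V ∧ ∀ z, z ∉ e := by
    obtain ⟨i, ⟨e, -, he⟩, -⟩ := IsModel.infinity (V := V)
    exact ⟨e, mem_omega.2 fun j hj => hj.1 e he, he⟩
  exact h.choose_spec.2 z

/-- The successor. -/
noncomputable def succ (n : INat V) : INat V :=
  ⟨(exists_succ n.1).choose, mem_omega.2 fun i hi =>
    hi.2 n.1 _ (mem_omega.1 n.2 i hi) (exists_succ n.1).choose_spec⟩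

theorem mem_succ {n : INat V} {z : V} : z ∈ (succ n).1 ↔ z ∈ n.1 ∨ z = n.1 :=
  (exists_succ n.1).choose_spec z

instance iMap_succ : IMap V (succ (V := V)) := by
  refine IMap.of_dfn (fun x y => ∀ z, z ∈ y ↔ z ∈ x ∨ z = x) fun a b => ?_
  rw [cd_eq, cd_eq]
  constructor
  · rintro rfl z
    exact mem_succ
  · exact fun h => Subtype.ext (IsModel.extensionality _ _ fun z => by rw [h, mem_succ])

theorem succ_ne_zero (n : INat V) : succ n ≠ 0 := fun h =>
  not_mem_zero n.1 (h ▸ mem_succ.2 (.inr rfl))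

theorem succ_inj {m n : INat V} (h : succ m = succ n) : m = n := by
  by_contra hne
  have h1 : m.1 ∈ (succ n).1 := h ▸ mem_succ.2 (.inr rfl)
  have h2 : n.1 ∈ (succ m).1 := h ▸ mem_succ.2 (.inr rfl)
  rw [mem_succ] at h1 h2
  rcases h1 with h1 | h1
  · rcases h2 with h2 | h2
    · exact not_mem_mem _ _ h1 h2
    · exact hne (Subtype.ext h2.symm)
  · exact hne (Subtype.ext h1)

/-- The numbers satisfying `P` form an inductive set of the model, and natural numbers belong to
every such set. That `P` is internal is essential: the natural numbers of `V` may be nonstandard. -/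
theorem induction_succ (P : INat V → Prop) [hP : IPred V P] (zero : P 0)
    (step : ∀ n, P n → P (succ n)) (n : INat V) : P n := by
  obtain ⟨s, hs⟩ := hP.out
  rw [codes_set] at hs
  have key : IsInductive s := by
    refine ⟨fun e he => ?_, fun x y hx hy => ?_⟩
    · refine (hs e).2 ⟨0, zero, ?_⟩
      rw [cd_eq]
      exact IsModel.extensionality _ _ fun z => by simp [he, not_mem_zero]
    · obtain ⟨n, hn, rfl⟩ := (hs x).1 hx
      refine (hs y).2 ⟨succ n, step n hn, ?_⟩
      rw [cd_eq]
      exact IsModel.extensionality _ _ fun z => by rw [hy, mem_succ, cd_eq]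
  obtain ⟨m, hm, h⟩ := (hs n.1).1 (mem_omega.1 n.2 s key)
  rw [cd_eq] at h
  rwa [Subtype.ext h]

/-! ### Recursion on the natural numbers of the model -/

section Recursion

variable {α : Type u} [Coded V α] [IType V α]

/-- The graph is the least relation `G` that contains `(0, a)` and is closed under `(n, x) ↦ (succ
n, s x)`. That `G` is single-valued follows by induction, since leastness leaves no other pairs in
it. -/
theorem exists_rec (a : α) (s : α → α) [IMap V s] :
    ∃ h : IFun V (INat V) α, h.1 0 = a ∧ ∀ n, h.1 (succ n) = s (h.1 n) := by
  let C : ISet V (INat V × α) → Prop := fun Z =>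
    (0, a) ∈ Z.1 ∧ ∀ (n : INat V) (x : α), (n, x) ∈ Z.1 → (succ n, s x) ∈ Z.1
  have hC : IPred V C := inferInstanceAs (IPred V fun Z : ISet V (INat V × α) =>
    (0, a) ∈ Z.1 ∧ ∀ (n : INat V) (x : α), (n, x) ∈ Z.1 → (succ n, s x) ∈ Z.1)
  let G : INat V → α → Prop := fun n x => ∀ Z : ISet V (INat V × α), C Z → (n, x) ∈ Z.1
  have hG : IPred V fun p : INat V × α => G p.1 p.2 := inferInstanceAs
    (IPred V fun p : INat V × α => ∀ Z : ISet V (INat V × α), C Z → (p.1, p.2) ∈ Z.1)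
  have zero : G 0 a := fun Z hZ => hZ.1
  have step : ∀ n x, G n x → G (succ n) (s x) := fun n x h Z hZ => hZ.2 n x (h Z hZ)
  -- Leastness of `G` is applied to the set of pairs that are initial or the successor of a pair in
  -- `G`.
  have cases : ∀ n x, G n x → (n = 0 ∧ x = a) ∨ ∃ m y, G m y ∧ n = succ m ∧ x = s y := by
    intro n x h
    have := IPred.comp' (fun p : INat V × α => G p.1 p.2)
      (fun p : ((INat V × α) × INat V) × α => (p.1.2, p.2)) hG inferInstance
    exact h (iset V fun p : INat V × α =>
      (p.1 = 0 ∧ p.2 = a) ∨ ∃ m y, G m y ∧ p.1 = succ m ∧ p.2 = s y)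
      ⟨.inl ⟨rfl, rfl⟩, by
        rintro n x (⟨rfl, rfl⟩ | ⟨m, y, h, rfl, rfl⟩)
        · exact .inr ⟨0, _, zero, rfl, rfl⟩
        · exact .inr ⟨_, _, step _ _ h, rfl, rfl⟩⟩
  have key : ∀ n, ∃ x, ∀ y, y = x ↔ G n y := by
    refine induction_succ _ ?_ ?_
    · refine ⟨a, fun y => ⟨?_, fun h => ?_⟩⟩
      · rintro rfl
        exact zero
      · rcases cases _ _ h with h | ⟨m, _, _, h, _⟩
        · exact h.2
        · exact absurd h.symm (succ_ne_zero m)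
    · rintro n ⟨x, hx⟩
      refine ⟨s x, fun y => ⟨?_, fun h => ?_⟩⟩
      · rintro rfl
        exact step _ _ ((hx x).1 rfl)
      · rcases cases _ _ h with h | ⟨m, z, hz, h', rfl⟩
        · exact absurd h.1 (succ_ne_zero n)
        · rw [← succ_inj h', ← hx] at hz
          rw [hz]
  choose h hh using key
  have : IMap V h := IMap.of_graph G hG fun n x => hh n x
  exact ⟨ifun V h, ((hh 0 a).2 zero).symm, fun n => ((hh _ _).2 (step _ _ ((hh n _).1 rfl))).symm⟩

/-- The function defined by recursion with initial value `a` and step `s`. -/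
noncomputable def recFun (a : α) (s : α → α) [IMap V s] : IFun V (INat V) α :=
  (exists_rec a s).choose

theorem recFun_zero (a : α) (s : α → α) [IMap V s] : (recFun a s : IFun V (INat V) α).1 0 = a :=
  (exists_rec a s).choose_spec.1

theorem recFun_succ (a : α) (s : α → α) [IMap V s] (n : INat V) :
    (recFun a s).1 (succ n) = s ((recFun a s).1 n) :=
  (exists_rec a s).choose_spec.2 n

end Recursion

noncomputable instance : One (INat V) := ⟨succ 0⟩

/-- Addition, with the second summand as the recursion variable. -/
noncomputable def addFun : IFun V (INat V) (IFun V (INat V) (INat V)) :=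
  recFun (ifun V fun m => m) fun f => ifun V fun m => succ (f.1 m)

/-- The sum. -/
protected noncomputable def add (m n : INat V) : INat V := (addFun.1 n).1 m

noncomputable instance : Add (INat V) := ⟨INat.add⟩

instance : IAdd V (INat V) :=
  ⟨inferInstanceAs (IMap V fun p : INat V × INat V => (addFun.1 p.2).1 p.1)⟩

protected theorem add_zero (m : INat V) : m + 0 = m := by
  change (addFun.1 0).1 m = m
  rw [addFun, recFun_zero, ifun_apply]

theorem add_succ (m n : INat V) : m + succ n = succ (m + n) := by
  change (addFun.1 (succ n)).1 m = succ ((addFun.1 n).1 m)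
  rw [addFun, recFun_succ, ifun_apply]

theorem add_one (m : INat V) : m + 1 = succ m := by
  change m + succ 0 = _
  rw [add_succ, INat.add_zero]

/-- Multiplication, with the second factor as the recursion variable. -/
noncomputable def mulFun : IFun V (INat V) (IFun V (INat V) (INat V)) :=
  recFun (ifun V fun _ => 0) fun f => ifun V fun m => f.1 m + m

/-- The product. -/
protected noncomputable def mul (m n : INat V) : INat V := (mulFun.1 n).1 m

noncomputable instance : Mul (INat V) := ⟨INat.mul⟩

instance : IMul V (INat V) :=
  ⟨inferInstanceAs (IMap V fun p : INat V × INat V => (mulFun.1 p.2).1 p.1)⟩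

protected theorem mul_zero (m : INat V) : m * 0 = 0 := by
  change (mulFun.1 0).1 m = 0
  rw [mulFun, recFun_zero, ifun_apply]

theorem mul_succ (m n : INat V) : m * succ n = m * n + m := by
  change (mulFun.1 (succ n)).1 m = (mulFun.1 n).1 m + m
  rw [mulFun, recFun_succ, ifun_apply]

theorem induction (P : INat V → Prop) [hP : IPred V P] (zero : P 0)
    (step : ∀ n, P n → P (n + 1)) (n : INat V) : P n :=
  induction_succ P zero (fun n h => add_one n ▸ step n h) n

protected theorem add_assoc (a b c : INat V) : a + b + c = a + (b + c) := by
  refine induction_succ (fun c : INat V => a + b + c = a + (b + c)) ?_ (fun n h => ?_) c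
  · simp only [INat.add_zero]
  · simp only [add_succ, h]

protected theorem zero_add (a : INat V) : 0 + a = a := by
  refine induction_succ (fun a : INat V => 0 + a = a) ?_ (fun n h => ?_) a
  · simp only [INat.add_zero]
  · simp only [add_succ, h]

theorem succ_add (a b : INat V) : succ a + b = succ (a + b) := by
  refine induction_succ (fun b : INat V => succ a + b = succ (a + b)) ?_ (fun n h => ?_) b
  · simp only [INat.add_zero]
  · simp only [add_succ, h]

protected theorem add_comm (a b : INat V) : a + b = b + a := by
  refine induction_succ (fun b : INat V => a + b = b + a) ?_ (fun n h => ?_) b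
  · simp only [INat.add_zero, INat.zero_add]
  · simp only [add_succ, succ_add, h]

protected theorem add_mul (a b c : INat V) : (a + b) * c = a * c + b * c := by
  refine induction_succ (fun c : INat V => (a + b) * c = a * c + b * c) ?_ (fun n h => ?_) c
  · simp only [INat.mul_zero, INat.add_zero]
  · simp only [mul_succ, h, INat.add_assoc]
    rw [← INat.add_assoc (b * n), INat.add_comm (b * n) a, INat.add_assoc]

protected theorem zero_mul (a : INat V) : 0 * a = 0 := by
  refine induction_succ (fun a : INat V => 0 * a = 0) ?_ (fun n h => ?_) a
  · simp only [INat.mul_zero]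
  · simp only [mul_succ, h, INat.add_zero]

protected theorem one_mul (a : INat V) : 1 * a = a := by
  refine induction_succ (fun a : INat V => 1 * a = a) ?_ (fun n h => ?_) a
  · simp only [INat.mul_zero]
  · simp only [mul_succ, h, add_one]

protected theorem mul_comm (a b : INat V) : a * b = b * a := by
  refine induction_succ (fun b : INat V => a * b = b * a) ?_ (fun n h => ?_) b
  · simp only [INat.mul_zero, INat.zero_mul]
  · rw [mul_succ, ← add_one, INat.add_mul, INat.one_mul, h]

protected theorem mul_add (a b c : INat V) : a * (b + c) = a * b + a * c := by
  rw [INat.mul_comm, INat.add_mul, INat.mul_comm b, INat.mul_comm c]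

protected theorem mul_assoc (a b c : INat V) : a * b * c = a * (b * c) := by
  refine induction_succ (fun c : INat V => a * b * c = a * (b * c)) ?_ (fun n h => ?_) c
  · simp only [INat.mul_zero]
  · simp only [mul_succ, h, INat.mul_add]

noncomputable instance : CommSemiring (INat V) where
  add_assoc := INat.add_assoc
  zero_add := INat.zero_add
  add_zero := INat.add_zero
  add_comm := INat.add_comm
  nsmul := nsmulRec
  left_distrib := INat.mul_add
  right_distrib := INat.add_mul
  zero_mul := INat.zero_mul
  mul_zero := INat.mul_zero
  mul_assoc := INat.mul_assoc
  one_mul := INat.one_mul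
  mul_one a := by rw [INat.mul_comm, INat.one_mul]
  mul_comm := INat.mul_comm

theorem add_one_ne_zero (a : INat V) : a + 1 ≠ 0 := add_one a ▸ succ_ne_zero a

theorem eq_zero_or_eq_add_one (a : INat V) : a = 0 ∨ ∃ b, a = b + 1 :=
  induction (fun a : INat V => a = 0 ∨ ∃ b, a = b + 1) (.inl rfl) (fun n _ => .inr ⟨n, rfl⟩) a

protected theorem add_right_cancel {a b c : INat V} (h : a + c = b + c) : a = b := by
  revert h
  refine induction (fun c : INat V => a + c = b + c → a = b) ?_ (fun n ih h => ih ?_) c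
  · simp only [add_zero]
    exact fun h => h
  · rw [← add_assoc, ← add_assoc, add_one, add_one] at h
    exact succ_inj h

theorem eq_zero_of_add_eq_zero {a b : INat V} (h : a + b = 0) : a = 0 := by
  rcases eq_zero_or_eq_add_one a with h' | ⟨c, rfl⟩
  · exact h'
  · rw [add_right_comm] at h
    exact absurd h (add_one_ne_zero _)

theorem exists_add_or (a b : INat V) : (∃ c, b = a + c) ∨ ∃ c, a = b + c := by
  refine induction (fun b : INat V => (∃ c, b = a + c) ∨ ∃ c, a = b + c) ?_ (fun n ih => ?_) b
  · exact .inr ⟨a, (zero_add a).symm⟩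
  · rcases ih with ⟨c, rfl⟩ | ⟨c, rfl⟩
    · exact .inl ⟨c + 1, add_assoc _ _ _⟩
    · rcases eq_zero_or_eq_add_one c with rfl | ⟨d, rfl⟩
      · exact .inl ⟨1, by rw [add_zero]⟩
      · exact .inr ⟨d, by rw [add_assoc, add_comm 1]⟩

open Classical in
noncomputable instance : LinearOrder (INat V) where
  le a b := ∃ c, b = a + c
  le_refl a := ⟨0, (add_zero a).symm⟩
  le_trans := by
    rintro a _ _ ⟨c, rfl⟩ ⟨d, rfl⟩
    exact ⟨c + d, add_assoc _ _ _⟩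
  le_antisymm := by
    rintro a b ⟨c, rfl⟩ ⟨d, h⟩
    have : 0 + a = (c + d) + a := by rw [zero_add, add_comm, ← add_assoc]; exact h
    rw [eq_zero_of_add_eq_zero (INat.add_right_cancel this).symm, add_zero]
  le_total := exists_add_or
  toDecidableLE := Classical.decRel _

instance : ILE V (INat V) :=
  ⟨inferInstanceAs (IPred V fun p : INat V × INat V => ∃ c, p.2 = p.1 + c)⟩

theorem zero_le (a : INat V) : 0 ≤ a := ⟨a, (zero_add a).symm⟩

instance : IsOrderedCancelAddMonoid (INat V) where
  add_le_add_left := by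
    rintro a _ ⟨c, rfl⟩ b
    exact ⟨c, by rw [add_right_comm]⟩
  le_of_add_le_add_left := by
    rintro a b c ⟨d, h⟩
    refine ⟨d, INat.add_right_cancel (c := a) ?_⟩
    rw [add_comm, h, add_comm _ a, add_assoc]

theorem lt_add_one (a : INat V) : a < a + 1 := by
  refine lt_of_le_of_ne ⟨1, rfl⟩ fun h => add_one_ne_zero (0 : INat V) ?_
  exact INat.add_right_cancel (c := a) (by rw [zero_add, zero_add, add_comm, ← h])

theorem lt_iff_add_one_le {a b : INat V} : a < b ↔ a + 1 ≤ b := by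
  refine ⟨fun h => ?_, fun h => (lt_add_one a).trans_le h⟩
  obtain ⟨c, rfl⟩ := h.le
  rcases eq_zero_or_eq_add_one c with rfl | ⟨d, rfl⟩
  · simp at h
  · exact ⟨d, by rw [add_assoc, add_comm 1]⟩

theorem lt_add_one_iff {a b : INat V} : a < b + 1 ↔ a ≤ b := by
  rw [lt_iff_add_one_le, add_le_add_iff_right]

theorem not_lt_zero (a : INat V) : ¬ a < 0 := not_lt.2 (zero_le a)

instance : IsStrictOrderedRing (INat V) where
  zero_le_one := zero_le _
  exists_pair_ne := ⟨0, 1, by rw [← zero_add 1]; exact (add_one_ne_zero 0).symm⟩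
  mul_lt_mul_of_pos_left := by
    intro a ha b c hbc
    rw [lt_iff_add_one_le] at ha hbc ⊢
    obtain ⟨d, rfl⟩ := ha
    obtain ⟨e, rfl⟩ := hbc
    exact ⟨(1 + d) * e + d, by ring⟩
  mul_lt_mul_of_pos_right := by
    intro a ha b c hbc
    rw [lt_iff_add_one_le] at ha hbc ⊢
    obtain ⟨d, rfl⟩ := ha
    obtain ⟨e, rfl⟩ := hbc
    exact ⟨(1 + d) * e + d, by ring⟩

theorem strong_induction (P : INat V → Prop) [hP : IPred V P]
    (step : ∀ n, (∀ m, m < n → P m) → P n) (n : INat V) : P n := by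
  refine step n (induction (fun n : INat V => ∀ m, m < n → P m) ?_ (fun n ih m hm => ?_) n)
  · exact fun m hm => absurd hm (not_lt_zero m)
  · exact step m fun k hk => ih k (hk.trans_le (lt_add_one_iff.1 hm))

theorem exists_least (P : INat V → Prop) [hP : IPred V P] (h : ∃ n, P n) :
    ∃ n, P n ∧ ∀ m, P m → n ≤ m := by
  by_contra! hne
  obtain ⟨n, hn⟩ := h
  refine strong_induction (fun n : INat V => ¬ P n) (fun n ih hn => ?_) n hn
  obtain ⟨m, hm, hmn⟩ := hne n hn
  exact ih m hmn hm

end INat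

end Naturals

/-! ## Finite sets -/

section Finite

variable {V : Type u} [Membership V V] [IsModel V]
variable {α β γ : Type u} [Coded V α] [Coded V β] [Coded V γ]
  [IType V α] [IType V β] [IType V γ]

variable (V α) in
/-- The empty set. -/
def iempty : ISet V α := iset V fun _ => False

/-- The set `insert a S`. -/
def iinsert (a : α) (S : ISet V α) : ISet V α := iset V fun x => x = a ∨ x ∈ S.1

@[simp] theorem mem_iempty {a : α} : a ∈ (iempty V α).1 ↔ False := Iff.rfl

@[simp] theorem mem_iinsert {a b : α} {S : ISet V α} :
    b ∈ (iinsert a S).1 ↔ b = a ∨ b ∈ S.1 := Iff.rfl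

instance IMap.iinsert (f : β → α) (S : β → ISet V α) [IMap V f] [IMap V S] :
    IMap V fun x => iinsert (f x) (S x) := by
  unfold ZF.iinsert
  infer_instance

instance IMap.iinsertLeft (a : α) : IMap V fun S : ISet V α => ZF.iinsert a S :=
  IMap.iinsert (fun _ => a) fun S => S

variable (V) in
/-- The range of an internal function. -/
def irange (f : α → β) [IMap V f] : ISet V β := iset V fun b => ∃ a, f a = b

instance IMap.irange {γ : Type u} [Coded V γ] [IType V γ] (F : γ → IFun V α β) [IMap V F] :
    IMap V fun x => irange V (F x).1 := by
  unfold ZF.irange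
  infer_instance

/-- Finiteness in the sense of Kuratowski: `S` can be reached from `∅` by adding elements. -/
def KFin (S : ISet V α) : Prop :=
  ∀ Z : ISet V (ISet V α), iempty V α ∈ Z.1 →
    (∀ (T : ISet V α) (a : α), T ∈ Z.1 → iinsert a T ∈ Z.1) → S ∈ Z.1

instance IPred.kFin (S : β → ISet V α) [IMap V S] : IPred V fun x => KFin (S x) := by
  unfold KFin
  infer_instance

instance IPred.kFin' : IPred V (KFin : ISet V α → Prop) := IPred.kFin fun S => S

theorem kFin_iempty : KFin (iempty V α) := fun _ h _ => h

theorem KFin.iinsert {S : ISet V α} (h : KFin S) (a : α) : KFin (iinsert a S) :=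
  fun Z h₀ h₁ => h₁ _ _ (h Z h₀ h₁)

theorem KFin.induction (P : ISet V α → Prop) [IPred V P] (empty : P (iempty V α))
    (insert : ∀ (T : ISet V α) (a : α), KFin T → a ∉ T.1 → P T → P (ZF.iinsert a T))
    {S : ISet V α} (h : KFin S) : P S := by
  -- Finiteness of `T` is carried along so that the step may assume it. Adding an element already
  -- present changes nothing, so the step may also assume `a ∉ T.1`.
  refine (h (iset V fun S => KFin S ∧ P S) ⟨kFin_iempty, empty⟩ ?_).2
  rintro T a ⟨h₁, h₂⟩
  refine ⟨h₁.iinsert a, ?_⟩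
  by_cases ha : a ∈ T.1
  · have : ZF.iinsert a T = T := ISet.ext' fun x => by
      rw [mem_iinsert, or_iff_right_of_imp]
      rintro rfl
      exact ha
    rwa [this]
  · exact insert T a h₁ ha h₂

/-- By induction on `S`: a new element contributes at most one point to the image. Since `R` may be
partial, finiteness of subsets is a special case. -/
theorem KFin.image_rel {S : ISet V α} (h : KFin S) (R : α → β → Prop)
    [hR : IPred V fun p : α × β => R p.1 p.2] (hf : ∀ a b c, R a b → R a c → b = c)
    (T : ISet V β) (hT : ∀ b, b ∈ T.1 ↔ ∃ a, a ∈ S.1 ∧ R a b) : KFin T := by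
  have hR' : IPred V fun p : (ISet V α × β) × α => R p.2 p.1.2 :=
    IPred.comp' (fun p : α × β => R p.1 p.2) (fun p : (ISet V α × β) × α => (p.2, p.1.2)) hR
      inferInstance
  have hS : ∀ S : ISet V α, IPred V fun b => ∃ a, a ∈ S.1 ∧ R a b := fun S =>
    IPred.comp' (fun p : ISet V α × β => ∃ a, a ∈ p.1.1 ∧ R a p.2) (fun b => (S, b))
      inferInstance inferInstance
  have key : KFin (iset V fun b => ∃ a, a ∈ S.1 ∧ R a b) := by
    refine KFin.induction (fun S => KFin (iset V fun b => ∃ a, a ∈ S.1 ∧ R a b)) ?_ ?_ h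
    · convert! kFin_iempty (V := V) (α := β) using 1
      exact ISet.ext' fun b => by simp
    · intro S a _ _ ih
      by_cases h : ∃ b, R a b
      · obtain ⟨b, hb⟩ := h
        convert! ih.iinsert b using 1
        refine ISet.ext' fun c => ?_
        simp only [mem_iset, mem_iinsert, or_and_right, exists_or, exists_eq_left]
        exact or_congr ⟨fun h => hf a c b h hb, fun h => h ▸ hb⟩ Iff.rfl
      · convert! ih using 1
        refine ISet.ext' fun c => ?_
        simp only [mem_iset, mem_iinsert, or_and_right, exists_or, exists_eq_left]
        exact or_iff_right fun hc => h ⟨c, hc⟩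
  convert! key using 1
  exact ISet.ext' hT

theorem KFin.subset {S : ISet V α} (h : KFin S) {T : ISet V α} (hT : ∀ a, a ∈ T.1 → a ∈ S.1) :
    KFin T := by
  refine h.image_rel (fun a b => a = b ∧ b ∈ T.1) (fun a b c h₁ h₂ => h₁.1.symm.trans h₂.1) T
    fun b => ?_
  constructor
  · exact fun hb => ⟨b, hT b hb, rfl, hb⟩
  · rintro ⟨a, -, -, hb⟩
    exact hb

theorem KFin.image {S : ISet V α} (h : KFin S) (f : α → β) [IMap V f] {T : ISet V β}
    (hT : ∀ b, b ∈ T.1 → ∃ a, a ∈ S.1 ∧ f a = b) : KFin T := by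
  refine (h.image_rel (fun a b => f a = b) (fun a b c h₁ h₂ => h₁.symm.trans h₂)
    (iset V fun b => ∃ a, a ∈ S.1 ∧ f a = b) fun b => Iff.rfl).subset hT

theorem KFin.union {S T : ISet V α} (hS : KFin S) (hT : KFin T) {U : ISet V α}
    (hU : ∀ a, a ∈ U.1 → a ∈ S.1 ∨ a ∈ T.1) : KFin U := by
  have : KFin (iset V fun a => a ∈ S.1 ∨ a ∈ T.1) := by
    refine KFin.induction (fun S => KFin (iset V fun a => a ∈ S.1 ∨ a ∈ T.1)) ?_ ?_ hS
    · exact hT.subset fun a => by simp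
    · intro S a _ _ ih
      exact (ih.iinsert a).subset fun b => by simp [or_assoc]
  exact this.subset hU

theorem KFin.prod {S : ISet V α} {T : ISet V β} (hS : KFin S) (hT : KFin T)
    {U : ISet V (α × β)} (hU : ∀ p, p ∈ U.1 → p.1 ∈ S.1 ∧ p.2 ∈ T.1) : KFin U := by
  have : KFin (iset V fun p : α × β => p.1 ∈ S.1 ∧ p.2 ∈ T.1) := by
    refine KFin.induction (fun S => KFin (iset V fun p : α × β => p.1 ∈ S.1 ∧ p.2 ∈ T.1)) ?_ ?_ hS
    · exact kFin_iempty.subset fun a => by simp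
    · intro S a _ _ ih
      have h := hT.image (fun b => (a, b)) (T := iset V fun p : α × β => p.1 = a ∧ p.2 ∈ T.1)
        fun p hp => ⟨p.2, hp.2, Prod.ext hp.1.symm rfl⟩
      exact h.union ih fun p hp => by simpa [or_and_right] using hp
  exact this.subset hU

theorem INat.kFin_lt (n : INat V) : KFin (iset V fun m : INat V => m < n) := by
  refine INat.induction (fun n : INat V => KFin (iset V fun m : INat V => m < n)) ?_ ?_ n
  · exact kFin_iempty.subset fun a ha => absurd ha (INat.not_lt_zero a)
  · intro n ih
    exact (ih.iinsert n).subset fun m hm => (INat.lt_add_one_iff.1 hm).eq_or_lt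

theorem KFin.exists_le {S : ISet V (INat V)} (h : KFin S) : ∃ m, ∀ n, n ∈ S.1 → n ≤ m := by
  refine KFin.induction (fun S : ISet V (INat V) => ∃ m, ∀ n, n ∈ S.1 → n ≤ m) ?_ ?_ h
  · exact ⟨0, fun n hn => hn.elim⟩
  · rintro S a _ _ ⟨m, hm⟩
    refine ⟨max a m, ?_⟩
    rintro n (rfl | hn)
    · exact le_max_left _ _
    · exact (hm n hn).trans (le_max_right _ _)

namespace INat

instance iPred_val_mem : IPred V fun p : INat V × INat V => p.1.1 ∈ p.2.1 := by
  refine IPred.of_dfn (fun z => ∃ x y, IsPair z x y ∧ x ∈ y) fun p => ?_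
  simp only [isPair_iff, cd_prod, pr_inj, cd_eq]
  constructor
  · exact fun h => ⟨_, _, ⟨rfl, rfl⟩, h⟩
  · rintro ⟨_, _, ⟨rfl, rfl⟩, h⟩
    exact h

/-- This links von Neumann numerals, which occur in the definition of finiteness, to the algebraic
order on `INat V`. -/
theorem val_mem_iff (m n : INat V) : m.1 ∈ n.1 ↔ m < n := by
  have : IPred V fun n : INat V => ∀ m : INat V, m.1 ∈ n.1 ↔ m < n := by
    have := IPred.comp' _ (fun p : INat V × INat V => (p.2, p.1)) (iPred_val_mem (V := V))
      inferInstance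
    infer_instance
  refine INat.induction (fun n : INat V => ∀ m : INat V, m.1 ∈ n.1 ↔ m < n) ?_ ?_ n m
  · exact fun m => iff_of_false (not_mem_zero _) (not_lt_zero m)
  · intro n ih m
    rw [add_one, mem_succ, ih, ← add_one, lt_add_one_iff, le_iff_lt_or_eq]
    exact or_congr Iff.rfl ⟨fun h => Subtype.ext h, fun h => h ▸ rfl⟩

theorem mem_omega_of_mem {n : INat V} {z : V} (h : z ∈ n.1) : z ∈ omega V := by
  have : IPred V fun n : INat V => ∀ z, z ∈ n.1 → z ∈ omega V :=
    IPred.of_dfn (fun x => ∀ z, z ∈ x → z ∈ omega V) fun n => by rw [cd_eq]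
  refine INat.induction (fun n : INat V => ∀ z, z ∈ n.1 → z ∈ omega V) ?_ ?_ n z h
  · exact fun z hz => absurd hz (not_mem_zero z)
  · intro n ih z hz
    rw [add_one, mem_succ] at hz
    rcases hz with hz | rfl
    · exact ih z hz
    · exact n.2

end INat

theorem kFin_of_isFinite {S : ISet V α} (h : IsFinite V S.1) : KFin S := by
  obtain ⟨n, hn, f, hf, -, hS⟩ := h
  let n' : INat V := ⟨n, mem_omega.2 hn⟩
  have hf : IMap V f := ⟨hf⟩
  -- Elements of `El n` and of `INat V` are compared through the sets that underlie them.
  have h₁ : IPred V fun p : INat V × El n => p.2.1 = p.1.1 := by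
    refine IPred.of_dfn (fun z => ∃ x, IsPair z x x) fun p => ?_
    simp only [isPair_iff, cd_prod, pr_inj, INat.cd_eq, cd_el]
    constructor
    · exact fun h => ⟨_, rfl, h⟩
    · rintro ⟨_, rfl, h⟩
      exact h
  have h₂ : IPred V fun p : INat V × α => ∃ x : El n, x.1 = p.1.1 ∧ f x = p.2 := by
    have := IPred.comp' _ (fun p : (INat V × α) × El n => (p.1.1, p.2)) h₁ inferInstance
    infer_instance
  refine (INat.kFin_lt n').image_rel (fun m a => ∃ x : El n, x.1 = m.1 ∧ f x = a) ?_ S fun a => ?_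
  · rintro m a b ⟨x, hx, rfl⟩ ⟨y, hy, rfl⟩
    exact congrArg f (Subtype.ext (hx.trans hy.symm))
  · rw [← hS]
    constructor
    · rintro ⟨x, rfl⟩
      exact ⟨⟨x.1, INat.mem_omega_of_mem (n := n') x.2⟩, (INat.val_mem_iff _ n').1 x.2, x, rfl, rfl⟩
    · rintro ⟨m, -, x, -, rfl⟩
      exact ⟨x, rfl⟩

/-- Each inserted element gets the next free number. The enumeration is kept as a set `R` of the
model, the graph of a bijection, so that the induction hypothesis is internal. -/
theorem KFin.isFinite {S : ISet V α} (h : KFin S) : IsFinite V S.1 := by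
  have key : ∃ (n : INat V) (R : ISet V (INat V × α)), (∀ m, m < n ↔ ∃ a, (m, a) ∈ R.1) ∧
      (∀ a, a ∈ S.1 ↔ ∃ m, (m, a) ∈ R.1) ∧ (∀ m a b, (m, a) ∈ R.1 → (m, b) ∈ R.1 → a = b) ∧
      ∀ m k a, (m, a) ∈ R.1 → (k, a) ∈ R.1 → m = k := by
    refine KFin.induction (fun S => ∃ (n : INat V) (R : ISet V (INat V × α)),
      (∀ m, m < n ↔ ∃ a, (m, a) ∈ R.1) ∧ (∀ a, a ∈ S.1 ↔ ∃ m, (m, a) ∈ R.1) ∧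
      (∀ m a b, (m, a) ∈ R.1 → (m, b) ∈ R.1 → a = b) ∧
      ∀ m k a, (m, a) ∈ R.1 → (k, a) ∈ R.1 → m = k) ?_ ?_ h
    · exact ⟨0, iempty V _, fun m => by simp [INat.not_lt_zero], fun a => by simp,
        fun m a b h => h.elim, fun m k a h => h.elim⟩
    · rintro S a - ha ⟨n, R, h₁, h₂, h₃, h₄⟩
      have hn : ∀ b, (n, b) ∉ R.1 := fun b hb => lt_irrefl n ((h₁ n).2 ⟨b, hb⟩)
      have ha' : ∀ m, (m, a) ∉ R.1 := fun m hm => ha ((h₂ a).2 ⟨m, hm⟩)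
      refine ⟨n + 1, ZF.iinsert (n, a) R, fun m => ?_, fun b => ?_, ?_, ?_⟩
      · simp [INat.lt_add_one_iff, le_iff_eq_or_lt, h₁, exists_or]
      · simp [h₂, exists_or]
      · rintro m b c (h | h) (h' | h')
        · simp_all
        · simp_all
        · simp_all
        · exact h₃ _ _ _ h h'
      · rintro m b c (h | h) (h' | h')
        · simp_all
        · simp_all
        · simp_all
        · exact h₄ _ _ _ h h'
  obtain ⟨n, R, h₁, h₂, h₃, h₄⟩ := key
  have hx : ∀ x : El n.1, ∃ m : INat V, m.1 = x.1 ∧ m < n := fun x =>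
    ⟨⟨x.1, INat.mem_omega_of_mem x.2⟩, rfl, (INat.val_mem_iff _ n).1 x.2⟩
  have hx' : ∀ x : El n.1, ∃ a, ∃ m : INat V, m.1 = x.1 ∧ (m, a) ∈ R.1 := fun x => by
    obtain ⟨m, hm, hmn⟩ := hx x
    obtain ⟨a, ha⟩ := (h₁ m).1 hmn
    exact ⟨a, m, hm, ha⟩
  choose f hf using hx'
  refine ⟨n.1, mem_omega.1 n.2, f, ?_, ?_, ?_⟩
  · have h₁ : IPred V fun p : El n.1 × INat V => p.2.1 = p.1.1 := by
      refine IPred.of_dfn (fun z => ∃ x, IsPair z x x) fun p => ?_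
      simp only [isPair_iff, cd_prod, pr_inj, INat.cd_eq, cd_el]
      constructor
      · exact fun h => ⟨_, rfl, h⟩
      · rintro ⟨_, rfl, h⟩
        exact h
    have := IPred.comp' _ (fun p : (El n.1 × α) × INat V => (p.1.1, p.2)) h₁ inferInstance
    refine (IMap.of_graph (fun (x : El n.1) a => ∃ m : INat V, m.1 = x.1 ∧ (m, a) ∈ R.1)
      (by infer_instance) fun x a => ⟨fun h => h ▸ hf x, ?_⟩ : IMap V f).out
    rintro ⟨m, hm, hma⟩
    obtain ⟨k, hk, hka⟩ := hf x
    rw [Subtype.ext (hm.trans hk.symm)] at hma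
    exact h₃ _ _ _ hma hka
  · intro x y hxy
    obtain ⟨m, hm, hma⟩ := hf x
    obtain ⟨k, hk, hka⟩ := hf y
    rw [hxy] at hma
    have := h₄ _ _ _ hma hka
    exact Subtype.ext (hm.symm.trans ((congrArg Subtype.val this).trans hk))
  · ext a
    rw [h₂]
    constructor
    · rintro ⟨x, rfl⟩
      obtain ⟨m, -, h⟩ := hf x
      exact ⟨m, h⟩
    · rintro ⟨m, hm⟩
      refine ⟨⟨m.1, (INat.val_mem_iff _ _).2 ((h₁ m).2 ⟨a, hm⟩)⟩, ?_⟩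
      obtain ⟨k, hk, hka⟩ := hf ⟨m.1, (INat.val_mem_iff _ _).2 ((h₁ m).2 ⟨a, hm⟩)⟩
      rw [← Subtype.ext (a1 := k) (a2 := m) hk] at hm
      exact h₃ _ _ _ hka hm

theorem isFinite_iff_kFin {S : ISet V α} : IsFinite V S.1 ↔ KFin S :=
  ⟨kFin_of_isFinite, KFin.isFinite⟩

end Finite

/-! ## Power Dedekind-finite sets -/

section PowerDedekindFinite

variable {V : Type u} [Membership V V] [IsModel V]
variable {α β : Type u} [Coded V α] [Coded V β] [IType V α] [IType V β]

/-- Hilbert's hotel: the map that shifts along the sequence `A` and fixes everything else is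
injective and misses `A 0`. -/
theorem not_injective_of_dedekindFinite (h : DedekindFinite V β) (A : IFun V (INat V) β) :
    ¬ Function.Injective A.1 := by
  intro hA
  classical
  have key : ∀ b, ∃ c, ∀ d, d = c ↔ (∃ n, b = A.1 n ∧ d = A.1 (n + 1)) ∨
      ((¬ ∃ n, b = A.1 n) ∧ d = b) := by
    intro b
    by_cases hb : ∃ n, b = A.1 n
    · obtain ⟨n, rfl⟩ := hb
      refine ⟨A.1 (n + 1), fun d => ⟨fun h => .inl ⟨n, rfl, h⟩, ?_⟩⟩
      rintro (⟨m, hm, rfl⟩ | h)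
      · rw [hA hm]
      · exact absurd ⟨n, rfl⟩ h.1
    · refine ⟨b, fun d => ⟨fun h => .inr ⟨hb, h⟩, ?_⟩⟩
      rintro (⟨m, hm, rfl⟩ | h)
      · exact absurd ⟨m, hm⟩ hb
      · exact h.2
  choose f hf using key
  have hfi : IMap V f := IMap.of_graph (fun b d => (∃ n, b = A.1 n ∧ d = A.1 (n + 1)) ∨
      ((¬ ∃ n, b = A.1 n) ∧ d = b)) (by infer_instance) hf
  have h₁ : ∀ n, f (A.1 n) = A.1 (n + 1) := fun n => ((hf _ _).2 (.inl ⟨n, rfl, rfl⟩)).symm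
  have h₂ : ∀ b, (¬ ∃ n, b = A.1 n) → f b = b := fun b hb => ((hf _ _).2 (.inr ⟨hb, rfl⟩)).symm
  obtain ⟨b, hb⟩ := h f hfi.out (fun b c hbc => by
    by_cases hb : ∃ n, b = A.1 n <;> by_cases hc : ∃ n, c = A.1 n
    · obtain ⟨n, rfl⟩ := hb
      obtain ⟨m, rfl⟩ := hc
      rw [h₁, h₁] at hbc
      rw [add_right_cancel (hA hbc)]
    · obtain ⟨n, rfl⟩ := hb
      rw [h₁, h₂ c hc] at hbc
      exact absurd ⟨_, hbc.symm⟩ hc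
    · obtain ⟨n, rfl⟩ := hc
      rw [h₁, h₂ b hb] at hbc
      exact absurd ⟨_, hbc⟩ hb
    · rwa [h₂ b hb, h₂ c hc] at hbc) (A.1 0)
  by_cases h' : ∃ n, b = A.1 n
  · obtain ⟨n, rfl⟩ := h'
    rw [h₁] at hb
    exact INat.add_one_ne_zero n (hA hb)
  · rw [h₂ b h'] at hb
    exact h' ⟨0, hb⟩

/-- The next value is the least element of `D` beyond the current one, so the enumeration is a
recursion without choices. -/
theorem exists_strictMono {D : INat V → Prop} [IPred V D] (h : ∀ m, ∃ n, D n ∧ m < n) :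
    ∃ e : IFun V (INat V) (INat V), (∀ n, D (e.1 n)) ∧ ∀ m n, m < n → e.1 m < e.1 n := by
  have key : ∀ m, ∃ n, ∀ k, k = n ↔ (D k ∧ m < k) ∧ ∀ l, D l ∧ m < l → k ≤ l := fun m => by
    obtain ⟨n, hn, hn'⟩ := INat.exists_least (fun n => D n ∧ m < n) (h m)
    exact ⟨n, fun k => ⟨fun hk => hk ▸ ⟨hn, hn'⟩, fun hk => le_antisymm (hk.2 _ hn) (hn' _ hk.1)⟩⟩
  choose s hs using key
  have : IMap V s := IMap.of_graph (fun m k => (D k ∧ m < k) ∧ ∀ l, D l ∧ m < l → k ≤ l)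
    (by infer_instance) hs
  have hs' : ∀ m, D (s m) ∧ m < s m := fun m => ((hs m _).1 rfl).1
  -- Starting at `s 0` instead of `0` puts the first value into `D`.
  refine ⟨INat.recFun (s 0) s, fun n => ?_, fun m n => ?_⟩
  · rcases INat.eq_zero_or_eq_add_one n with rfl | ⟨k, rfl⟩
    · rw [INat.recFun_zero]
      exact (hs' 0).1
    · rw [INat.add_one, INat.recFun_succ]
      exact (hs' _).1
  · refine INat.induction (fun n : INat V => m < n →
      (INat.recFun (s 0) s).1 m < (INat.recFun (s 0) s).1 n) ?_ ?_ n
    · exact fun h => absurd h (INat.not_lt_zero m)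
    · intro n ih hmn
      have h₁ := (hs' ((INat.recFun (s 0) s).1 n)).2
      rw [INat.add_one, INat.recFun_succ]
      rcases (INat.lt_add_one_iff.1 hmn).eq_or_lt with rfl | h
      · exact h₁
      · exact (ih h).trans h₁

/-- A sequence of subsets of a power Dedekind-finite set generates a finite algebra of sets:
it does not separate more points than one of its initial segments. -/
theorem exists_initial_segment_separating (h : DedekindFinite V (ISet V α))
    (A : IFun V (INat V) (ISet V α)) :
    ∃ m, ∀ x y, (∀ n, n < m → (x ∈ (A.1 n).1 ↔ y ∈ (A.1 n).1)) →
      ∀ n, x ∈ (A.1 n).1 ↔ y ∈ (A.1 n).1 := by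
  -- `D` collects the stages that separate two points for the first time. Asking for `x` inside and
  -- `y` outside loses nothing, since the agreement before stage `m` is symmetric in the two points.
  let D : INat V → Prop := fun m => ∃ x y, (∀ n, n < m → (x ∈ (A.1 n).1 ↔ y ∈ (A.1 n).1)) ∧
    x ∈ (A.1 m).1 ∧ y ∉ (A.1 m).1
  have hD : IPred V D := inferInstanceAs (IPred V fun m : INat V => ∃ x y,
    (∀ n, n < m → (x ∈ (A.1 n).1 ↔ y ∈ (A.1 n).1)) ∧ x ∈ (A.1 m).1 ∧ y ∉ (A.1 m).1)
  by_cases hb : ∀ m, ∃ n, D n ∧ m < n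
  · exfalso
    obtain ⟨e, he, he'⟩ := exists_strictMono hb
    refine not_injective_of_dedekindFinite h (ifun V fun n => A.1 (e.1 n)) fun m n hmn => ?_
    -- The two points first separated at stage `e n` agree on the earlier set `A (e m)`, so the two
    -- sets differ.
    have key : ∀ m n, m < n → A.1 (e.1 m) ≠ A.1 (e.1 n) := by
      intro m n hmn heq
      obtain ⟨x, y, h₁, h₂, h₃⟩ := he n
      have := h₁ _ (he' m n hmn)
      rw [heq] at this
      exact h₃ (this.1 h₂)
    rcases lt_trichotomy m n with h' | h' | h'
    · exact absurd hmn (key m n h')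
    · exact h'
    · exact absurd hmn.symm (key n m h')
  · push Not at hb
    obtain ⟨b, hb⟩ := hb
    refine ⟨b + 1, fun x y hxy n => ?_⟩
    refine INat.strong_induction (fun n : INat V => x ∈ (A.1 n).1 ↔ y ∈ (A.1 n).1)
      (fun n ih => ?_) n
    rcases lt_or_ge n (b + 1) with hn | hn
    · exact hxy n hn
    · have hnD : ¬ D n := fun h' => not_lt.2 (hb n h') (INat.lt_iff_add_one_le.2 hn)
      constructor
      · intro hx
        by_contra hy
        exact hnD ⟨x, y, ih, hx, hy⟩
      · intro hy
        by_contra hx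
        exact hnD ⟨y, x, fun m hm => (ih m hm).symm, hy, hx⟩

/-- A function on a power Dedekind-finite set whose values are determined by a sequence of
subsets has finite range. -/
theorem kFin_irange_of_sequence (h : DedekindFinite V (ISet V α))
    (A : IFun V (INat V) (ISet V α)) (g : α → β) [IMap V g]
    (hg : ∀ x y, (∀ n, x ∈ (A.1 n).1 ↔ y ∈ (A.1 n).1) → g x = g y) :
    KFin (irange V g : ISet V β) := by
  obtain ⟨m, hm⟩ := exists_initial_segment_separating h A
  -- The traces of points on the first `m` sets are finitely many: a trace at `m + 1` is a trace at
  -- `m`, with or without the number `m` added.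
  have key : ∀ m : INat V, KFin (irange V fun x =>
      (iset V fun n : INat V => n < m ∧ x ∈ (A.1 n).1 : ISet V (INat V))) := by
    refine INat.induction (fun m : INat V => KFin (iset V fun s : ISet V (INat V) => ∃ x,
      (iset V fun n : INat V => n < m ∧ x ∈ (A.1 n).1 : ISet V (INat V)) = s)) ?_ ?_
    · refine (kFin_iempty.iinsert (iempty V (INat V))).subset fun s => ?_
      rintro ⟨x, rfl⟩
      exact .inl (ISet.ext' fun n => by simp [INat.not_lt_zero])
    · intro m ih
      refine KFin.union ih (T := irange V fun p : {s // s ∈ (iset V fun s : ISet V (INat V) => ∃ x,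
        (iset V fun n : INat V => n < m ∧ x ∈ (A.1 n).1 : ISet V (INat V)) = s).1} =>
          iinsert m p.1) ?_ ?_
      · refine ih.image (fun s => iinsert m s) fun s => ?_
        rintro ⟨p, rfl⟩
        exact ⟨_, p.2, rfl⟩
      · rintro s ⟨x, rfl⟩
        by_cases hx : x ∈ (A.1 m).1
        · refine .inr ⟨⟨_, x, rfl⟩, ISet.ext' fun n => ?_⟩
          simp only [mem_iinsert, mem_iset, INat.lt_add_one_iff, le_iff_eq_or_lt]
          constructor
          · rintro (rfl | h)
            · exact ⟨.inl rfl, hx⟩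
            · exact ⟨.inr h.1, h.2⟩
          · rintro ⟨rfl | h, h'⟩
            · exact .inl rfl
            · exact .inr ⟨h, h'⟩
        · refine .inl ⟨x, ISet.ext' fun n => ?_⟩
          simp only [mem_iset, INat.lt_add_one_iff, le_iff_eq_or_lt]
          constructor
          · exact fun h => ⟨.inr h.1, h.2⟩
          · rintro ⟨rfl | h, h'⟩
            · exact absurd h' hx
            · exact ⟨h, h'⟩
  -- By the choice of `m`, points with equal traces on the first `m` sets have equal values, so `g`
  -- factors through the trace.
  refine (key m).image_rel (fun s b => ∃ x,
    (iset V fun n : INat V => n < m ∧ x ∈ (A.1 n).1 : ISet V (INat V)) = s ∧ g x = b) ?_ _ fun b => ?_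
  · rintro s _ _ ⟨x, rfl, rfl⟩ ⟨y, hy, rfl⟩
    refine hg x y (hm x y fun n hn => ?_)
    have : n ∈ (iset V fun n : INat V => n < m ∧ y ∈ (A.1 n).1 : ISet V (INat V)).1 ↔
      n ∈ (iset V fun n : INat V => n < m ∧ x ∈ (A.1 n).1 : ISet V (INat V)).1 := by rw [hy]
    simpa [hn] using this.symm
  · constructor
    · rintro ⟨x, rfl⟩
      exact ⟨_, ⟨x, rfl⟩, x, rfl, rfl⟩
    · rintro ⟨s, -, x, -, rfl⟩
      exact ⟨x, rfl⟩

theorem kFin_irange_nat (h : DedekindFinite V (ISet V α)) (g : α → INat V) [IMap V g] :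
    KFin (irange V g : ISet V (INat V)) :=
  kFin_irange_of_sequence h (ifun V fun n => iset V fun x => g x = n) g fun x y hxy =>
    ((hxy (g x)).1 rfl).symm

theorem exists_bound_nat (h : DedekindFinite V (ISet V α)) (g : α → INat V) [IMap V g] :
    ∃ m, ∀ x, g x ≤ m := by
  obtain ⟨m, hm⟩ := (kFin_irange_nat h g).exists_le
  exact ⟨m, fun x => hm _ ⟨x, rfl⟩⟩

/-- On a power Dedekind-finite set, the first hitting time of an internal relation is bounded. -/
theorem exists_bound_hitting (h : DedekindFinite V (ISet V α)) (P : α → INat V → Prop)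
    [hP : IPred V fun p : α × INat V => P p.1 p.2] :
    ∃ N, ∀ x, (∃ n, P x n) → ∃ n, n ≤ N ∧ P x n := by
  have hP₁ := IPred.comp' (fun p : α × INat V => P p.1 p.2)
    (fun p : (α × INat V) × INat V => (p.1.1, p.2)) hP inferInstance
  have hP₂ : ∀ x, IPred V (P x) := fun x =>
    IPred.comp' (fun p : α × INat V => P p.1 p.2) (fun n => (x, n)) hP inferInstance
  -- The first hitting time, with the default value `0` at points that are never hit.
  have key : ∀ x, ∃ n, ∀ m, m = n ↔ (P x m ∧ ∀ k, P x k → m ≤ k) ∨ (m = 0 ∧ ∀ k, ¬ P x k) := by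
    intro x
    by_cases hx : ∃ n, P x n
    · obtain ⟨n, hn, hn'⟩ := INat.exists_least (P x) hx
      refine ⟨n, fun m => ⟨?_, ?_⟩⟩
      · rintro rfl
        exact .inl ⟨hn, hn'⟩
      · rintro (hm | hm)
        · exact le_antisymm (hm.2 n hn) (hn' m hm.1)
        · exact absurd hn (hm.2 n)
    · push Not at hx
      exact ⟨0, fun m => ⟨fun hm => .inr ⟨hm, hx⟩, fun hm => hm.elim (fun h => absurd h.1 (hx m))
        fun h => h.1⟩⟩
  choose g hg using key
  have : IMap V g := IMap.of_graph
    (fun x m => (P x m ∧ ∀ k, P x k → m ≤ k) ∨ (m = 0 ∧ ∀ k, ¬ P x k)) (by infer_instance) hg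
  obtain ⟨N, hN⟩ := exists_bound_nat h g
  refine ⟨N, fun x ⟨n, hn⟩ => ⟨g x, hN x, ?_⟩⟩
  rcases (hg x (g x)).1 rfl with h' | h'
  · exact h'.1
  · exact absurd hn (h'.2 n)

end PowerDedekindFinite

/-! ## Real and complex numbers of the model -/

/-! ### Functions of finite range -/

section Range

variable {V : Type u} [Membership V V] [IsModel V]
variable {α β γ δ : Type u} [Coded V α] [Coded V β] [Coded V γ] [Coded V δ]
  [IType V α] [IType V β] [IType V γ] [IType V δ]

theorem KFin.irange_map₂ {f : α → β} {g : α → γ} [IMap V f] [IMap V g]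
    (hf : KFin (irange V f)) (hg : KFin (irange V g)) (k : β → γ → δ)
    [hk : IMap V fun p : β × γ => k p.1 p.2] (h : α → δ) [IMap V h]
    (hh : ∀ a, h a = k (f a) (g a)) : KFin (irange V h) := by
  refine (hf.prod hg (U := iset V fun p => p.1 ∈ (irange V f).1 ∧ p.2 ∈ (irange V g).1)
    fun p hp => hp).image (fun p => k p.1 p.2) ?_
  rintro _ ⟨a, rfl⟩
  exact ⟨(f a, g a), ⟨⟨a, rfl⟩, a, rfl⟩, (hh a).symm⟩

end Range

/-- With s = i + j, the number s² + i lies between s² and (s + 1)², so it determines s and then i.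
This arranges a double sequence of subsets into a single one. -/
theorem INat.pairing_injective {V : Type u} [Membership V V] [IsModel V] {i j k l : INat V}
    (h : (i + j) ^ 2 + i = (k + l) ^ 2 + k) : i = k ∧ j = l := by
  have key : ∀ i j k l : INat V, i + j < k + l → (i + j) ^ 2 + i < (k + l) ^ 2 + k := by
    intro i j k l h
    obtain ⟨d, hd⟩ := lt_iff_add_one_le.1 h
    rw [hd, lt_iff_add_one_le]
    exact ⟨d ^ 2 + 2 * d * (i + j + 1) + i + j + j + k, by ring⟩
  rcases lt_trichotomy (i + j) (k + l) with h' | h' | h'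
  · exact absurd h (key i j k l h').ne
  · rw [h'] at h
    obtain rfl := add_left_cancel h
    exact ⟨rfl, add_left_cancel h'⟩
  · exact absurd h.symm (key k l i j h').ne

namespace RealField

variable {V : Type u} [Membership V V] (R : RealField V)

instance : IAdd V R.Re := ⟨⟨R.internal_add⟩⟩

instance : IMul V R.Re := ⟨⟨R.internal_mul⟩⟩

instance : ILE V R.Re := ⟨⟨R.internal_le⟩⟩

variable [IsModel V]

instance : IAdd V R.Cx :=
  ⟨inferInstanceAs (IMap V fun p : R.Cx × R.Cx =>
    (⟨p.1.re + p.2.re, p.1.im + p.2.im⟩ : R.Cx))⟩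

instance : IMul V R.Cx :=
  ⟨inferInstanceAs (IMap V fun p : R.Cx × R.Cx =>
    (⟨p.1.re * p.2.re + (-1) * p.1.im * p.2.im,
      p.1.re * p.2.im + p.1.im * p.2.re + 0 * p.1.im * p.2.im⟩ : R.Cx))⟩

/-- In an ordered field -1 is not a square; this makes `R.Cx` a field. -/
instance : Fact (∀ r : R.Re, r ^ 2 ≠ -1 + 0 * r) :=
  ⟨fun r h => by nlinarith [sq_nonneg r]⟩

/-- The embedding of the natural numbers. -/
noncomputable def nat : IFun V (INat V) R.Re :=
  have : IMap V fun x : R.Re => x + 1 := inferInstance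
  INat.recFun (0 : R.Re) fun x : R.Re => x + 1

@[simp] theorem nat_zero : R.nat.1 0 = 0 := INat.recFun_zero _ _

@[simp] theorem nat_add_one (n : INat V) : R.nat.1 (n + 1) = R.nat.1 n + 1 := by
  rw [INat.add_one]
  exact INat.recFun_succ _ _ n

theorem nat_nonneg (n : INat V) : 0 ≤ R.nat.1 n := by
  refine INat.induction (fun n : INat V => 0 ≤ R.nat.1 n) ?_ (fun n ih => ?_) n
  · rw [nat_zero]
  · rw [nat_add_one]
    linarith

theorem nat_mono {m n : INat V} (h : m ≤ n) : R.nat.1 m ≤ R.nat.1 n := by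
  obtain ⟨c, rfl⟩ := h
  refine INat.induction (fun c : INat V => R.nat.1 m ≤ R.nat.1 (m + c)) ?_ (fun n ih => ?_) c
  · rw [add_zero]
  · rw [← add_assoc, nat_add_one]
    linarith

/-- The Archimedean property: if s were the supremum of the natural numbers, s - 1 would still be an
upper bound. -/
theorem exists_nat_gt (r : R.Re) : ∃ n, r < R.nat.1 n := by
  by_contra! h
  obtain ⟨s, hs⟩ := R.exists_isLUB (irange V R.nat.1) ⟨0, 0, nat_zero R⟩
    ⟨r, by rintro _ ⟨n, rfl⟩; exact h n⟩
  have : s ≤ s - 1 := hs.2 (by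
    rintro _ ⟨n, rfl⟩
    have := hs.1 ⟨n + 1, rfl⟩
    rw [nat_add_one] at this
    linarith)
  linarith

variable {α : Type u} [Coded V α] [IType V α]

/-- A nonnegative real is determined by the pairs (i, j) with f x · i < j, that is, by the fractions
above it. The pairing lists the corresponding subsets of `α` in one sequence. -/
theorem kFin_irange_of_nonneg (h : DedekindFinite V (ISet V α)) (f : α → R.Re) [IMap V f]
    (hf : ∀ x, 0 ≤ f x) : KFin (irange V f) := by
  refine kFin_irange_of_sequence h (ifun V fun n => iset V fun x => ∃ i j : INat V,
    n = (i + j) ^ 2 + i ∧ f x * R.nat.1 i < R.nat.1 j) f fun x y hxy => ?_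
  have hxy : ∀ i j, f x * R.nat.1 i < R.nat.1 j ↔ f y * R.nat.1 i < R.nat.1 j := by
    have key : ∀ (z : α) (i j : INat V), f z * R.nat.1 i < R.nat.1 j ↔
        ∃ i' j', (i + j) ^ 2 + i = (i' + j') ^ 2 + i' ∧ f z * R.nat.1 i' < R.nat.1 j' := by
      intro z i j
      constructor
      · exact fun h => ⟨i, j, rfl, h⟩
      · rintro ⟨i', j', h₁, h₂⟩
        obtain ⟨rfl, rfl⟩ := INat.pairing_injective h₁
        exact h₂
    intro i j
    rw [key x, key y]
    exact hxy _
  -- Choose i with (f y - f x) i > 1, and j least with f x · i < j. Then j ≤ f x · i + 1 < f y · i,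
  -- so the pair (i, j) tells x and y apart.
  have key : ∀ x y, (∀ i j, f x * R.nat.1 i < R.nat.1 j ↔ f y * R.nat.1 i < R.nat.1 j) →
      ¬ f x < f y := by
    intro x y hxy hlt
    have hpos : 0 < f y - f x := sub_pos.2 hlt
    obtain ⟨i, hi⟩ := R.exists_nat_gt (f y - f x)⁻¹
    have hi' : 1 < (f y - f x) * R.nat.1 i := by
      rwa [inv_eq_one_div, div_lt_iff₀' hpos] at hi
    obtain ⟨j, hj, hj'⟩ := INat.exists_least (fun j => f x * R.nat.1 i < R.nat.1 j)
      (R.exists_nat_gt _)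
    -- The least j is not 0 because f x ≥ 0, so it has a predecessor to which minimality applies.
    rcases INat.eq_zero_or_eq_add_one j with rfl | ⟨k, rfl⟩
    · rw [nat_zero] at hj
      exact absurd hj (not_lt.2 (mul_nonneg (hf x) (R.nat_nonneg i)))
    · have h₁ : R.nat.1 k ≤ f x * R.nat.1 i := by
        by_contra! hk
        exact not_lt.2 (hj' k hk) (INat.lt_add_one k)
      have h₂ := (hxy _ _).1 hj
      rw [nat_add_one] at h₂
      linarith
  rcases lt_trichotomy (f x) (f y) with h' | h' | h'
  · exact absurd h' (key x y hxy)
  · exact h'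
  · exact absurd h' (key y x fun i j => (hxy i j).symm)

/-- A real function on a power Dedekind-finite set has finite range. -/
theorem kFin_irange_re (h : DedekindFinite V (ISet V α)) (f : α → R.Re) [IMap V f] :
    KFin (irange V f) := by
  have : IMap V fun p : R.Re × R.Re => (p.1 - p.2) * 2⁻¹ := inferInstance
  -- The function is half the difference of |f| + f and |f| - f, both nonnegative.
  refine (R.kFin_irange_of_nonneg h (fun x => |f x| + f x) fun x => ?_).irange_map₂
    (R.kFin_irange_of_nonneg h (fun x => |f x| - f x) fun x => ?_)
    (fun a b : R.Re => (a - b) * 2⁻¹) f fun x => ?_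
  · linarith [neg_abs_le (f x)]
  · linarith [le_abs_self (f x)]
  · ring

/-- A complex function on a power Dedekind-finite set has finite range. -/
theorem kFin_irange_cx (h : DedekindFinite V (ISet V α)) (f : α → R.Cx) [IMap V f] :
    KFin (irange V f) :=
  (R.kFin_irange_re h fun x => (f x).re).irange_map₂ (R.kFin_irange_re h fun x => (f x).im)
    (fun a b => (⟨a, b⟩ : R.Cx)) f fun _ => rfl

end RealField

/-! ## Finite sums -/

section FiniteSums

variable {V : Type u} [Membership V V] [IsModel V] {R : RealField V} {X : V}

theorem ISet.eq_iinsert_iff {A B : ISet V (El X)} {x : El X} :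
    B.1 = insert x A.1 ↔ ∀ y, y ∈ B.1 ↔ y = x ∨ y ∈ A.1 := Set.ext_iff

theorem ISet.eq_empty_iff {A : ISet V (El X)} : A.1 = ∅ ↔ ∀ y, ¬ y ∈ A.1 :=
  Set.eq_empty_iff_forall_notMem

/-- `σ` satisfies the recursion for the sums of `g` over the subsets of `F`. -/
def IsSummation (g : El X → R.Re) (F : ISet V (El X)) (σ : ISet V (El X) → R.Re) : Prop :=
  (∀ A : ISet V (El X), (∀ y, ¬ y ∈ A.1) → σ A = 0) ∧
    ∀ (A B : ISet V (El X)) (x : El X), ¬ x ∈ A.1 → (∀ y, y ∈ B.1 ↔ y = x ∨ y ∈ A.1) →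
      (∀ y, y ∈ B.1 → y ∈ F.1) → σ B = σ A + g x

theorem isFinSum_iff {g : El X → R.Re} {F : ISet V (El X)} {s : R.Re} :
    IsFinSum R g F s ↔ ∃ σ : IFun V (ISet V (El X)) R.Re, IsSummation g F σ.1 ∧ σ.1 F = s := by
  constructor
  · rintro ⟨σ, h, h₀, h₁, h₂⟩
    exact ⟨⟨σ, h⟩, ⟨fun A hA => h₀ A (ISet.eq_empty_iff.2 hA), fun A B x hx hB hF =>
      h₁ A B x hx (ISet.eq_iinsert_iff.2 hB) hF⟩, h₂⟩
  · rintro ⟨σ, ⟨h₀, h₁⟩, h₂⟩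
    exact ⟨σ.1, σ.2, fun A hA => h₀ A (ISet.eq_empty_iff.1 hA), fun A B x hx hB hF =>
      h₁ A B x hx (ISet.eq_iinsert_iff.1 hB) hF, h₂⟩

instance IPred.isFinSum : IPred V fun p : (IFun V (El X) R.Re × ISet V (El X)) × R.Re =>
    IsFinSum R p.1.1.1 p.1.2 p.2 := by
  simp only [isFinSum_iff, IsSummation]
  infer_instance

theorem exists_isFinSum (g : IFun V (El X) R.Re) {F : ISet V (El X)} (hF : KFin F) :
    ∃ s, IsFinSum R g.1 F s := by
  classical
  suffices h : ∃ σ : IFun V (ISet V (El X)) R.Re, IsSummation g.1 F σ.1 from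
    let ⟨σ, h⟩ := h
    ⟨_, isFinSum_iff.2 ⟨σ, h, rfl⟩⟩
  have : IPred V fun F : ISet V (El X) =>
      ∃ σ : IFun V (ISet V (El X)) R.Re, IsSummation g.1 F σ.1 := by
    unfold IsSummation
    infer_instance
  refine KFin.induction (fun F => ∃ σ : IFun V (ISet V (El X)) R.Re, IsSummation g.1 F σ.1)
    ⟨ifun V fun _ => 0, fun _ _ => rfl, fun A B x hx hB hF => ?_⟩ ?_ hF
  · exact (hF x ((hB x).2 (.inl rfl))).elim
  · rintro S y - hy ⟨σ, h₀, h₁⟩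
    -- To sum over a set that may contain the new point `y`, sum over the rest with the old σ and
    -- add `g y` if `y` is present.
    refine ⟨ifun V fun A => σ.1 (iset V fun x => x ∈ A.1 ∧ ¬ x = y) +
      (if y ∈ A.1 then g.1 y else 0), fun A hA => ?_, fun A B x hx hB hF => ?_⟩
    · simp only [ifun_apply]
      rw [h₀ (iset V fun x => x ∈ A.1 ∧ ¬ x = y) fun z hz => hA z hz.1, if_neg (hA y), add_zero]
    · simp only [ifun_apply]
      by_cases hxy : x = y
      · subst hxy
        rw [if_pos ((hB x).2 (.inl rfl)), if_neg hx, add_zero]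
        congr 2
        refine congrArg σ.1 (ISet.ext' fun z => ?_)
        simp only [mem_iset, hB]
        constructor
        · rintro ⟨rfl | h, h'⟩
          · exact absurd rfl h'
          · exact ⟨h, h'⟩
        · exact fun h => ⟨.inr h.1, h.2⟩
      · have hy : y ∈ B.1 ↔ y ∈ A.1 := by
          rw [hB]
          exact or_iff_right fun h => hxy h.symm
        rw [h₁ (iset V fun z => z ∈ A.1 ∧ ¬ z = y) (iset V fun z => z ∈ B.1 ∧ ¬ z = y) x (fun h => hx h.1) (fun z => ?_)
          (fun z hz => (hF z hz.1).resolve_left hz.2)]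
        · simp only [hy]
          ring
        · simp only [mem_iset, hB]
          constructor
          · rintro ⟨rfl | h, h'⟩
            · exact .inl rfl
            · exact .inr ⟨h, h'⟩
          · rintro (rfl | h)
            · exact ⟨.inl rfl, hxy⟩
            · exact ⟨.inr h.1, h.2⟩

/-- A comparison principle for finite sums. -/
theorem IsFinSum.le_of {g : IFun V (El X) R.Re} {F : ISet V (El X)} (hF : KFin F) {s : R.Re}
    (hs : IsFinSum R g.1 F s) (ψ : ISet V (El X) → R.Re) [IMap V ψ]
    (h₀ : ∀ A : ISet V (El X), (∀ y, ¬ y ∈ A.1) → 0 ≤ ψ A)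
    (h₁ : ∀ (A B : ISet V (El X)) (x : El X), ¬ x ∈ A.1 → (∀ y, y ∈ B.1 ↔ y = x ∨ y ∈ A.1) →
      (∀ y, y ∈ B.1 → y ∈ F.1) → ψ A + g.1 x ≤ ψ B) : s ≤ ψ F := by
  obtain ⟨σ, hσ, rfl⟩ := isFinSum_iff.1 hs
  refine KFin.induction (fun S : ISet V (El X) => (∀ y, y ∈ S.1 → y ∈ F.1) → σ.1 S ≤ ψ S)
    ?_ ?_ hF fun y hy => hy
  · intro _
    rw [hσ.1 (iempty V _) fun y hy => hy]
    exact h₀ (iempty V _) fun y hy => hy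
  · intro S x hS hx ih hSF
    rw [hσ.2 S (iinsert x S) x hx (fun y => Iff.rfl) hSF]
    exact (add_le_add_left (ih fun y hy => hSF y (.inr hy)) _).trans
      (h₁ S (iinsert x S) x hx (fun y => Iff.rfl) hSF)

theorem IsFinSum.le_add {g g₁ g₂ : IFun V (El X) R.Re} {F : ISet V (El X)} (hF : KFin F)
    {s s₁ s₂ k l : R.Re} (h : IsFinSum R g.1 F s) (h₁ : IsFinSum R g₁.1 F s₁)
    (h₂ : IsFinSum R g₂.1 F s₂) (hg : ∀ x, g.1 x ≤ k * g₁.1 x + l * g₂.1 x) :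
    s ≤ k * s₁ + l * s₂ := by
  obtain ⟨σ₁, hσ₁, rfl⟩ := isFinSum_iff.1 h₁
  obtain ⟨σ₂, hσ₂, rfl⟩ := isFinSum_iff.1 h₂
  have : IMap V fun A => k * σ₁.1 A + l * σ₂.1 A := inferInstance
  refine h.le_of hF (fun A => k * σ₁.1 A + l * σ₂.1 A) (fun A hA => ?_)
    fun A B x hx hB hBF => ?_
  · rw [hσ₁.1 A hA, hσ₂.1 A hA]
    simp
  · rw [hσ₁.2 A B x hx hB hBF, hσ₂.2 A B x hx hB hBF]
    linarith [hg x]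

/-- Otherwise this set would contain, for every n, a finite subset with sum at least n ε, against
the Archimedean property. The induction asserts only that such subsets exist, so no sequence of
points is chosen. -/
theorem kFin_of_bounded_sums {g : IFun V (El X) R.Re} {b : R.Re}
    (hb : ∀ F, KFin F → ∀ s, IsFinSum R g.1 F s → s ≤ b) {ε : R.Re} (hε : 0 < ε) :
    KFin (iset V fun x => ε ≤ g.1 x) := by
  by_contra hU
  have : IPred V fun n : INat V => ∃ F : ISet V (El X), KFin F ∧ (∀ x, x ∈ F.1 → ε ≤ g.1 x) ∧
      ∀ s, IsFinSum R g.1 F s → R.nat.1 n * ε ≤ s := by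
    simp only [isFinSum_iff, IsSummation]
    infer_instance
  have key : ∀ n, ∃ F : ISet V (El X), KFin F ∧ (∀ x, x ∈ F.1 → ε ≤ g.1 x) ∧
      ∀ s, IsFinSum R g.1 F s → R.nat.1 n * ε ≤ s := by
    refine INat.induction _ ⟨iempty V _, kFin_iempty, fun x hx => hx.elim, fun s hs => ?_⟩ ?_
    · obtain ⟨σ, hσ, rfl⟩ := isFinSum_iff.1 hs
      rw [hσ.1 (iempty V _) fun y hy => hy]
      simp
    · rintro n ⟨F, hF, hF', hn⟩
      obtain ⟨x, hx, hx'⟩ : ∃ x, ε ≤ g.1 x ∧ ¬ x ∈ F.1 := by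
        by_contra! h
        exact hU (hF.subset h)
      refine ⟨iinsert x F, hF.iinsert x, ?_, fun s hs => ?_⟩
      · rintro y (rfl | hy)
        · exact hx
        · exact hF' y hy
      · obtain ⟨σ, hσ, rfl⟩ := isFinSum_iff.1 hs
        -- A summation function for the larger set is one for `F` as well.
        have := hn (σ.1 F) (isFinSum_iff.2 ⟨σ, ⟨hσ.1, fun A B z hz hB hBF =>
          hσ.2 A B z hz hB fun y hy => .inr (hBF y hy)⟩, rfl⟩)
        rw [hσ.2 F (iinsert x F) x hx' (fun y => Iff.rfl) (fun y hy => hy), R.nat_add_one]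
        linarith
  obtain ⟨n, hn⟩ := R.exists_nat_gt (b / ε)
  obtain ⟨F, hF, -, h⟩ := key n
  obtain ⟨s, hs⟩ := exists_isFinSum g hF
  rw [div_lt_iff₀ hε] at hn
  linarith [h s hs, hb F hF s hs]

/-- A nonnegative function with bounded finite sums on a power Dedekind-finite set has finite
support. -/
theorem kFin_support_of_bounded_sums (hX : PowerDedekindFinite X) {g : IFun V (El X) R.Re}
    {b : R.Re} (hb : ∀ F, KFin F → ∀ s, IsFinSum R g.1 F s → s ≤ b) :
    KFin (iset V fun x => 0 < g.1 x) := by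
  -- Where g is positive, some n satisfies 1 ≤ n · g x. A common bound N for the least such n keeps
  -- g away from 0 on its support.
  obtain ⟨N, hN⟩ := exists_bound_hitting hX fun x n => 1 ≤ R.nat.1 n * g.1 x
  -- The bound `N` may be 0, so the reciprocal is taken of N + 1.
  have hpos : 0 < R.nat.1 N + 1 := by linarith [R.nat_nonneg N]
  refine (kFin_of_bounded_sums hb (inv_pos.2 hpos)).subset fun x (hx : 0 < g.1 x) => ?_
  obtain ⟨n, hn⟩ := R.exists_nat_gt (g.1 x)⁻¹
  rw [inv_lt_iff_one_lt_mul₀ hx] at hn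
  obtain ⟨k, hk, hk'⟩ := hN x ⟨n, hn.le⟩
  change (R.nat.1 N + 1)⁻¹ ≤ g.1 x
  rw [inv_le_iff_one_le_mul₀ hpos, mul_comm]
  exact hk'.trans (mul_le_mul_of_nonneg_right (by linarith [R.nat_mono hk]) hx.le)

end FiniteSums

/-! ## Monic polynomials in an internal endomorphism -/

/-- Scalar multiplication belongs to the model. -/
class ISMul (V : Type u) [Membership V V] (K W : Type u) [Coded V K] [Coded V W] [SMul K W] :
    Prop where
  out : IMap V fun p : K × W => p.1 • p.2

section Horner

variable {V : Type u} [Membership V V] [IsModel V]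
variable {K W γ : Type u} [Coded V K] [IType V K] [Coded V W] [IType V W] [Coded V γ] [IType V γ]

section

variable [SMul K W] [h : ISMul V K W]

instance IMap.smul (f : γ → K) (g : γ → W) [hf : IMap V f] [hg : IMap V g] :
    IMap V fun x => f x • g x :=
  IMap.comp₂ (fun (a : K) (b : W) => a • b) f g h.out hf hg

instance IMap.smulLeft (a : K) : IMap V fun x : W => a • x :=
  IMap.smul (fun _ => a) fun x => x

end

variable [Field K] [AddCommGroup W] [Module K W] [IAdd V K] [IMul V K] [IAdd V W]

/-- The sequence `a 0, b 0, b 1, …`. -/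
noncomputable def INat.cons (c : K) (b : IFun V (INat V) K) : IFun V (INat V) K :=
  open Classical in
  have h : ∀ n : INat V, ∃ y, ∀ x, x = y ↔ n = 0 ∧ x = c ∨ ∃ m, n = m + 1 ∧ x = b.1 m := by
    intro n
    rcases INat.eq_zero_or_eq_add_one n with rfl | ⟨m, rfl⟩
    · exact ⟨c, fun x => ⟨fun h => .inl ⟨rfl, h⟩, by
        rintro (h | ⟨m, h, -⟩)
        · exact h.2
        · exact absurd h.symm (INat.add_one_ne_zero m)⟩⟩
    · refine ⟨b.1 m, fun x => ⟨fun h => .inr ⟨m, rfl, h⟩, ?_⟩⟩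
      rintro (⟨h, -⟩ | ⟨k, h, h'⟩)
      · exact absurd h (INat.add_one_ne_zero m)
      · rw [add_right_cancel h, h']
  ⟨fun n => (h n).choose, (IMap.of_graph
    (fun n x => n = 0 ∧ x = c ∨ ∃ m, n = m + 1 ∧ x = b.1 m) (by infer_instance)
    fun n x => (h n).choose_spec x).out⟩

theorem INat.cons_iff (c : K) (b : IFun V (INat V) K) (n : INat V) (x : K) :
    x = (INat.cons c b).1 n ↔ n = 0 ∧ x = c ∨ ∃ m, n = m + 1 ∧ x = b.1 m := by
  rw [INat.cons]
  exact Exists.choose_spec (p := fun y => ∀ x, x = y ↔ n = 0 ∧ x = c ∨ ∃ m, n = m + 1 ∧ x = b.1 m)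
    _ x

@[simp] theorem INat.cons_zero (c : K) (b : IFun V (INat V) K) : (INat.cons c b).1 0 = c :=
  ((INat.cons_iff c b 0 c).2 (.inl ⟨rfl, rfl⟩)).symm

@[simp] theorem INat.cons_add_one (c : K) (b : IFun V (INat V) K) (n : INat V) :
    (INat.cons c b).1 (n + 1) = b.1 n :=
  ((INat.cons_iff c b (n + 1) _).2 (.inr ⟨n, rfl, rfl⟩)).symm

/-- The sequence `a 1, a 2, …`. -/
noncomputable def INat.tail (a : IFun V (INat V) K) : IFun V (INat V) K := ifun V fun n => a.1 (n + (1 : INat V))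

@[simp] theorem INat.tail_apply (a : IFun V (INat V) K) (n : INat V) :
    (INat.tail a).1 n = a.1 (n + 1) := rfl

@[simp] theorem INat.tail_cons (c : K) (b : IFun V (INat V) K) : INat.tail (INat.cons c b) = b :=
  IFun.ext' fun n => by simp

theorem INat.cons_tail (a : IFun V (INat V) K) : INat.cons (a.1 0) (INat.tail a) = a := by
  refine IFun.ext' fun n => ?_
  rcases INat.eq_zero_or_eq_add_one n with rfl | ⟨m, rfl⟩ <;> simp

instance INat.iMap_tail (f : γ → IFun V (INat V) K) [IMap V f] :
    IMap V fun x => INat.tail (f x) := by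
  unfold INat.tail
  infer_instance

instance INat.iMap_cons : IMap V fun p : K × IFun V (INat V) K => INat.cons p.1 p.2 :=
  IMap.of_graph (fun (p : K × IFun V (INat V) K) (a : IFun V (INat V) K) =>
    a.1 0 = p.1 ∧ ∀ n : INat V, a.1 (n + 1) = p.2.1 n) (by infer_instance) fun p a => by
  constructor
  · rintro rfl
    simp
  · rintro ⟨h₁, h₂⟩
    rw [← INat.cons_tail a, h₁]
    congr 1
    exact IFun.ext' h₂

variable [ISMul V K W] (T : W →ₗ[K] W) [hT : IMap V (T : W → W)]

/-- From `F`, the function `a ↦ a 0 + T (F (a 1, a 2, …))`. -/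
noncomputable def hornerStep (F : IFun V (IFun V (INat V) K) (IFun V W W))
    (a : IFun V (INat V) K) : IFun V W W :=
  ifun V fun v => a.1 0 • v + T ((F.1 (INat.tail a)).1 v)

instance : IMap V fun p : IFun V (IFun V (INat V) K) (IFun V W W) × IFun V (INat V) K =>
    hornerStep T p.1 p.2 := by
  unfold hornerStep
  infer_instance

instance (F : IFun V (IFun V (INat V) K) (IFun V W W)) : IMap V (hornerStep T F) := by
  unfold hornerStep
  infer_instance

/-- The operator `a 0 + a 1 T + ⋯ + a (n - 1) T ^ (n - 1) + T ^ n`, as an internal function of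
all arguments. -/
noncomputable def hornerFun : IFun V (INat V) (IFun V (IFun V (INat V) K) (IFun V W W)) :=
  INat.recFun (ifun V fun _ => ifun V fun v => v) fun F => ifun V (hornerStep T F)

/-- The operator `a 0 + a 1 T + ⋯ + a (n - 1) T ^ (n - 1) + T ^ n`. -/
noncomputable def horner (n : INat V) (a : IFun V (INat V) K) (v : W) : W :=
  (((hornerFun T).1 n).1 a).1 v

instance IMap.horner (f : γ → INat V) (g : γ → IFun V (INat V) K) (h : γ → W) [IMap V f] [IMap V g]
    [IMap V h] : IMap V fun x => horner T (f x) (g x) (h x) := by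
  unfold ZF.horner
  infer_instance

@[simp] theorem horner_zero (a : IFun V (INat V) K) (v : W) : horner T 0 a v = v := by
  unfold horner hornerFun
  rw [INat.recFun_zero]
  rfl

theorem horner_add_one (n : INat V) (a : IFun V (INat V) K) (v : W) :
    horner T (n + 1) a v = a.1 0 • v + T (horner T n (INat.tail a) v) := by
  unfold horner hornerFun
  rw [INat.add_one, INat.recFun_succ]
  rfl

end Horner

/-! ### Arithmetic of monic polynomials in T: sums, products, division, zeros -/

section HornerAlgebra

variable {V : Type u} [Membership V V] [IsModel V]
variable {K W : Type u} [Coded V K] [IType V K] [Coded V W] [IType V W]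
variable [Field K] [AddCommGroup W] [Module K W] [IAdd V K] [IMul V K] [IAdd V W] [ISMul V K W]
variable (T : W →ₗ[K] W) [hT : IMap V (T : W → W)]

theorem horner_add (n : INat V) (a : IFun V (INat V) K) (v w : W) :
    horner T n a (v + w) = horner T n a v + horner T n a w := by
  refine INat.induction (fun n : INat V => ∀ (a : IFun V (INat V) K) (v w : W),
    horner T n a (v + w) = horner T n a v + horner T n a w) ?_ (fun n ih => ?_) n a v w
  · simp
  · intro a v w
    simp only [horner_add_one, ih, map_add, smul_add]
    abel

theorem horner_smul (n : INat V) (a : IFun V (INat V) K) (c : K) (v : W) :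
    horner T n a (c • v) = c • horner T n a v := by
  refine INat.induction (fun n : INat V => ∀ (a : IFun V (INat V) K) (v : W),
    horner T n a (c • v) = c • horner T n a v) ?_ (fun n ih => ?_) n a v
  · simp
  · intro a v
    simp only [horner_add_one, ih, map_smul, smul_add, smul_comm c]

/-- `horner T n a` as a linear map. -/
noncomputable def hornerLin (n : INat V) (a : IFun V (INat V) K) : W →ₗ[K] W where
  toFun := horner T n a
  map_add' := horner_add T n a
  map_smul' := horner_smul T n a

theorem horner_zero_right (n : INat V) (a : IFun V (INat V) K) : horner T n a 0 = 0 :=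
  map_zero (hornerLin T n a)

theorem horner_sub (n : INat V) (a : IFun V (INat V) K) (v w : W) :
    horner T n a (v - w) = horner T n a v - horner T n a w :=
  map_sub (hornerLin T n a) v w

theorem horner_comm (n : INat V) (a : IFun V (INat V) K) (v : W) :
    horner T n a (T v) = T (horner T n a v) := by
  refine INat.induction (fun n : INat V => ∀ (a : IFun V (INat V) K) (v : W),
    horner T n a (T v) = T (horner T n a v)) ?_ (fun n ih => ?_) n a v
  · simp
  · intro a v
    simp only [horner_add_one, ih, map_add, map_smul]

theorem horner_horner_comm (m n : INat V) (a b : IFun V (INat V) K) (v : W) :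
    horner T m a (horner T n b v) = horner T n b (horner T m a v) := by
  refine INat.induction (fun m : INat V => ∀ (a : IFun V (INat V) K) (v : W),
    horner T m a (horner T n b v) = horner T n b (horner T m a v)) ?_ (fun m ih => ?_) m a v
  · simp
  · intro a v
    simp only [horner_add_one, ih, horner_add, horner_smul, horner_comm]

theorem horner_congr (n : INat V) (a b : IFun V (INat V) K) (h : ∀ i, i < n → a.1 i = b.1 i)
    (v : W) : horner T n a v = horner T n b v := by
  refine INat.induction (fun n : INat V => ∀ (a b : IFun V (INat V) K),
    (∀ i, i < n → a.1 i = b.1 i) → horner T n a v = horner T n b v) ?_ (fun n ih => ?_) n a b h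
  · simp
  · intro a b h
    rw [horner_add_one, horner_add_one, ih (INat.tail a) (INat.tail b), h 0]
    · exact (INat.zero_le n).trans_lt (INat.lt_add_one n)
    · exact fun i hi => h (i + 1) (add_lt_add_left hi 1)

theorem horner_cons (n : INat V) (c : K) (a : IFun V (INat V) K) (v : W) :
    horner T (n + 1) (INat.cons c a) v = c • v + T (horner T n a v) := by
  rw [horner_add_one, INat.cons_zero, INat.tail_cons]

/-- Division with remainder by `T - c`. -/
theorem exists_horner_eq_sub (c : K) (n : INat V) (a : IFun V (INat V) K) :
    ∃ (k : K) (b : IFun V (INat V) K), ∀ v : W,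
      horner T (n + 1) a v = k • v + (T (horner T n b v) - c • horner T n b v) := by
  refine INat.induction (fun n : INat V => ∀ a : IFun V (INat V) K,
    ∃ (k : K) (b : IFun V (INat V) K), ∀ v : W,
      horner T (n + 1) a v = k • v + (T (horner T n b v) - c • horner T n b v))
    ?_ (fun n ih => ?_) n a
  · intro a
    refine ⟨a.1 0 + c, a, fun v => ?_⟩
    rw [horner_add_one, horner_zero, horner_zero, add_smul]
    abel
  · intro a
    obtain ⟨k, b, h⟩ := ih (INat.tail a)
    -- If p = a₀ + z p' and p' = k + (z - c) q', then p = (a₀ + c k) + (z - c)(k + z q').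
    refine ⟨a.1 0 + c * k, INat.cons k b, fun v => ?_⟩
    rw [horner_add_one T (n + 1) a, h, horner_cons]
    simp only [map_add, map_sub, map_smul, add_smul, smul_add, mul_smul]
    abel

/-- A summand of smaller degree does not touch the leading coefficient 1. -/
theorem exists_horner_add (s : K) (b : IFun V (INat V) K) {m n : INat V} (hmn : m < n)
    (a : IFun V (INat V) K) :
    ∃ c : IFun V (INat V) K, ∀ v : W, horner T n a v + s • horner T m b v = horner T n c v := by
  refine INat.induction (fun m : INat V => ∀ n, m < n → ∀ a b : IFun V (INat V) K,
    ∃ c : IFun V (INat V) K, ∀ v : W, horner T n a v + s • horner T m b v = horner T n c v)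
    ?_ (fun m ih => ?_) m n hmn a b
  · intro n hn a b
    rcases INat.eq_zero_or_eq_add_one n with rfl | ⟨k, rfl⟩
    · exact absurd hn (lt_irrefl _)
    refine ⟨INat.cons (a.1 0 + s) (INat.tail a), fun v => ?_⟩
    rw [horner_cons, horner_add_one, horner_zero, add_smul]
    abel
  · intro n hn a b
    rcases INat.eq_zero_or_eq_add_one n with rfl | ⟨k, rfl⟩
    · exact absurd hn (INat.not_lt_zero _)
    obtain ⟨c, hc⟩ := ih k (lt_of_add_lt_add_right hn) (INat.tail a) (INat.tail b)
    refine ⟨INat.cons (a.1 0 + s * b.1 0) c, fun v => ?_⟩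
    rw [horner_cons, horner_add_one, horner_add_one, ← hc, map_add, map_smul, add_smul, mul_smul,
      smul_add]
    abel

theorem exists_horner_comp (m n : INat V) (a b : IFun V (INat V) K) :
    ∃ c : IFun V (INat V) K, ∀ v : W,
      horner T m a (horner T n b v) = horner T (n + m) c v := by
  refine INat.induction (fun m : INat V => ∀ a : IFun V (INat V) K,
    ∃ c : IFun V (INat V) K, ∀ v : W, horner T m a (horner T n b v) = horner T (n + m) c v)
    ?_ (fun m ih => ?_) m a
  · intro a
    exact ⟨b, fun v => by simp⟩
  · intro a
    obtain ⟨c, hc⟩ := ih (INat.tail a)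
    -- If p = a₀ + z p', then p q = z (p' q) + a₀ q. The first term is monic, and its degree exceeds
    -- that of q.
    have hlt : n < n + m + 1 := INat.lt_add_one_iff.2 ⟨m, rfl⟩
    obtain ⟨d, hd⟩ := exists_horner_add T (a.1 0) b hlt (INat.cons 0 c)
    refine ⟨d, fun v => ?_⟩
    rw [← add_assoc, ← hd, horner_add_one, horner_cons, zero_smul, zero_add, hc, add_comm]

/-- Two monic polynomials of the same degree are equal, or their difference is a multiple of a
monic polynomial of smaller degree. -/
theorem horner_sub_horner (n : INat V) (a b : IFun V (INat V) K) :
    (∀ i, i < n → a.1 i = b.1 i) ∨ ∃ m, m < n ∧ ∃ (s : K) (c : IFun V (INat V) K), s ≠ 0 ∧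
      ∀ v : W, horner T n a v - horner T n b v = s • horner T m c v := by
  refine INat.induction (fun n : INat V => ∀ a b : IFun V (INat V) K,
    (∀ i, i < n → a.1 i = b.1 i) ∨ ∃ m, m < n ∧ ∃ (s : K) (c : IFun V (INat V) K), s ≠ 0 ∧
      ∀ v : W, horner T n a v - horner T n b v = s • horner T m c v) ?_ (fun n ih => ?_) n a b
  · exact fun a b => .inl fun i hi => absurd hi (INat.not_lt_zero i)
  · intro a b
    rcases ih (INat.tail a) (INat.tail b) with h | ⟨m, hm, s, c, hs, h⟩
    · by_cases h₀ : a.1 0 = b.1 0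
      · refine .inl fun i hi => ?_
        rcases INat.eq_zero_or_eq_add_one i with rfl | ⟨k, rfl⟩
        · exact h₀
        · exact h k (lt_of_add_lt_add_right hi)
      · refine .inr ⟨0, (INat.zero_le n).trans_lt (INat.lt_add_one n), a.1 0 - b.1 0, a,
          sub_ne_zero.2 h₀, fun v => ?_⟩
        rw [horner_add_one, horner_add_one, horner_congr T n _ _ h, horner_zero, sub_smul]
        abel
    -- If the tails differ by s c(T), then a₀ - b₀ + T s c(T) equals s times the monic polynomial
    -- s⁻¹(a₀ - b₀) + T c(T).
    · refine .inr ⟨m + 1, add_lt_add_left hm 1, s, INat.cons (s⁻¹ * (a.1 0 - b.1 0)) c, hs,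
        fun v => ?_⟩
      rw [horner_cons, smul_add, ← map_smul, ← h, smul_smul, mul_inv_cancel_left₀ hs,
        horner_add_one, horner_add_one, sub_smul, map_sub]
      abel

/-- A functional that vanishes on all `T ^ k v` vanishes on all `p(T) v`. -/
theorem map_horner_eq_zero (φ : W →ₗ[K] K) [IMap V (φ : W → K)] (v : W)
    (h : ∀ k, φ (horner T k (ifun V fun _ => 0) v) = 0) (n : INat V) (a : IFun V (INat V) K) :
    φ (horner T n a v) = 0 := by
  refine INat.induction (fun n : INat V => ∀ (a : IFun V (INat V) K) (v : W),
    (∀ k, φ (horner T k (ifun V fun _ => 0) v) = 0) → φ (horner T n a v) = 0)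
    ?_ (fun n ih => ?_) n a v h
  · intro a v h
    simpa using h 0
  · intro a v h
    have h₀ : φ v = 0 := by simpa using h 0
    -- Since polynomials in T commute with T, only a smaller polynomial applied to T v is left, and
    -- the hypothesis on v passes to T v.
    rw [horner_add_one, map_add, map_smul, h₀, smul_zero, zero_add, ← horner_comm]
    refine ih _ _ fun k => ?_
    have := h (k + 1)
    rw [horner_add_one, ifun_apply, zero_smul, zero_add, ← horner_comm] at this
    exact this

/-- The eigenvalues of `T` are among the zeros of an annihilating polynomial. -/
theorem kFin_eigenvalues (n : INat V) (a : IFun V (INat V) K) :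
    KFin (iset V fun c : K => ∃ v : W, ¬ v = 0 ∧ T v = c • v ∧ horner T n a v = 0) := by
  refine INat.induction (fun n : INat V => ∀ a : IFun V (INat V) K,
    KFin (iset V fun c : K => ∃ v : W, ¬ v = 0 ∧ T v = c • v ∧ horner T n a v = 0))
    ?_ (fun n ih => ?_) n a
  · refine fun a => kFin_iempty.subset ?_
    rintro c ⟨v, hv, -, h⟩
    rw [horner_zero] at h
    exact hv h
  · intro a
    by_cases hc : ∃ (c : K) (v : W), ¬ v = 0 ∧ T v = c • v ∧ horner T (n + 1) a v = 0
    · obtain ⟨c, v, hv, hcv, hav⟩ := hc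
      obtain ⟨k, b, h⟩ := exists_horner_eq_sub T c n a
      -- At an eigenvector v for c that p(T) annihilates, the identity p = k + (z - c) q leaves k v
      -- = 0. At an eigenvector w for d ≠ c it then gives (d - c) q(T) w = 0, so w is annihilated by
      -- q(T), which has smaller degree.
      have hk : k = 0 := by
        have := h v
        rw [hav, ← horner_comm, hcv, horner_smul, sub_self, add_zero] at this
        exact (smul_eq_zero.1 this.symm).resolve_right hv
      refine ((ih b).iinsert c).subset ?_
      rintro d ⟨w, hw, hdw, haw⟩
      rw [mem_iinsert]
      refine or_iff_not_imp_left.2 fun hne => ⟨w, hw, hdw, ?_⟩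
      have := h w
      rw [haw, ← horner_comm, hdw, horner_smul, hk, zero_smul, zero_add, ← sub_smul] at this
      exact (smul_eq_zero.1 this.symm).resolve_left (sub_ne_zero.2 hne)
    · exact kFin_iempty.subset fun c h => hc ⟨c, h⟩

end HornerAlgebra

/-! ### Existence of an annihilating polynomial -/

section Annihilator

variable {V : Type u} [Membership V V] [IsModel V]
variable {K W Y γ : Type u} [Coded V K] [IType V K] [Coded V W] [IType V W] [Coded V Y]
  [IType V Y] [Coded V γ] [IType V γ]
variable [Field K] [AddCommGroup W] [Module K W]

/-- The coordinate functionals, with respect to the internal family of vectors `e`, on the space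
of finitely supported vectors. -/
structure IsFiniteCoord (V : Type u) [Membership V V] [IsModel V] {K W Y : Type u} [Coded V K]
    [IType V K] [Coded V W] [IType V W] [Coded V Y] [IType V Y] [Field K] [AddCommGroup W]
    [Module K W] (φ : Y → W →ₗ[K] K) (e : Y → W) : Prop where
  iMap : IMap V fun p : Y × W => φ p.1 p.2
  iMap_basis : IMap V e
  kFin_support : ∀ (v : W) (S : ISet V Y), (∀ y, y ∈ S.1 → φ y v ≠ 0) → KFin S
  ext_zero : ∀ v, (∀ y, φ y v = 0) → v = 0
  apply_self : ∀ x, φ x (e x) = 1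
  apply_ne : ∀ x y, x ≠ y → φ y (e x) = 0

variable {φ : Y → W →ₗ[K] K} {e : Y → W}

theorem IsFiniteCoord.iMap_app (hφ : IsFiniteCoord V φ e) (f : γ → Y) (g : γ → W) [hf : IMap V f] [hg : IMap V g] :
    IMap V fun x => φ (f x) (g x) :=
  IMap.comp₂ (fun y v => φ y v) f g hφ.iMap hf hg

theorem IsFiniteCoord.iMap_apply (hφ : IsFiniteCoord V φ e) (y : Y) : IMap V (φ y : W → K) :=
  hφ.iMap_app (fun _ => y) fun v => v

variable [IAdd V K] [IMul V K] [IAdd V W] [ISMul V K W] (T : W →ₗ[K] W) [hT : IMap V (T : W → W)]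

/-- A monic polynomial in `T` of large degree sends `v` to a vector that vanishes on a given
finite set. -/
theorem IsFiniteCoord.exists_horner_vanishing (hφ : IsFiniteCoord V φ e) (v : W) {S : ISet V Y} (hS : KFin S) (m : INat V) :
    ∃ n, m ≤ n ∧ ∃ a : IFun V (INat V) K, ∀ y, y ∈ S.1 → φ y (horner T n a v) = 0 := by
  have := fun (γ : Type u) [Coded V γ] [IType V γ] (f : γ → Y) (g : γ → W) [IMap V f] [IMap V g] =>
    hφ.iMap_app f g
  refine KFin.induction (fun S : ISet V Y => ∀ m, ∃ n, m ≤ n ∧ ∃ a : IFun V (INat V) K,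
    ∀ y, y ∈ S.1 → φ y (horner T n a v) = 0) ?_ ?_ hS m
  · exact fun m => ⟨m, le_rfl, ifun V fun _ => 0, fun y hy => hy.elim⟩
  · intro S x _ _ ih m
    obtain ⟨n₁, hn₁, a₁, h₁⟩ := ih m
    by_cases hx : φ x (horner T n₁ a₁ v) = 0
    · refine ⟨n₁, hn₁, a₁, ?_⟩
      rintro y (rfl | hy)
      · exact hx
      · exact h₁ y hy
    -- The free lower bound on the degree makes the second polynomial strictly larger than the
    -- first. Subtracting a multiple of the first kills the coordinate x and keeps the second monic.
    obtain ⟨n₂, hn₂, a₂, h₂⟩ := ih (n₁ + 1)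
    obtain ⟨c, hc⟩ := exists_horner_add T
      (-(φ x (horner T n₂ a₂ v) / φ x (horner T n₁ a₁ v))) a₁ (INat.lt_iff_add_one_le.2 hn₂) a₂
    refine ⟨n₂, hn₁.trans ((INat.lt_add_one n₁).le.trans hn₂), c, ?_⟩
    rintro y (rfl | hy)
    · rw [← hc, map_add, map_smul, smul_eq_mul, neg_mul, div_mul_cancel₀ _ hx, add_neg_cancel]
    · rw [← hc, map_add, map_smul, h₁ y hy, h₂ y hy, smul_zero, add_zero]

/-- All vectors `p(T) v` are supported in one finite set. -/
theorem IsFiniteCoord.exists_kFin_support (hφ : IsFiniteCoord V φ e) (hY : DedekindFinite V (ISet V Y)) (v : W) :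
    ∃ S : ISet V Y, KFin S ∧ ∀ (n : INat V) (a : IFun V (INat V) K) (y : Y), y ∉ S.1 →
      φ y (horner T n a v) = 0 := by
  have := fun (γ : Type u) [Coded V γ] [IType V γ] (f : γ → Y) (g : γ → W) [IMap V f] [IMap V g] =>
    hφ.iMap_app f g
  have := hφ.iMap_apply
  -- With zero coefficients `horner T k` is the power T^k. A coordinate that is nonzero at some T^k
  -- v is nonzero at one with k ≤ N, so the finite supports of these few powers cover everything.
  obtain ⟨N, hN⟩ := exists_bound_hitting hY fun y k =>
    ¬ φ y (horner T k (ifun V fun _ => 0) v) = 0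
  have key : ∀ n, KFin (iset V fun y => ∃ k, k < n ∧
      ¬ φ y (horner T k (ifun V fun _ => 0) v) = 0) := by
    refine INat.induction _ ?_ fun n ih => ?_
    · exact kFin_iempty.subset fun y ⟨k, hk, _⟩ => absurd hk (INat.not_lt_zero k)
    · refine ih.union (hφ.kFin_support (horner T n (ifun V fun _ => 0) v)
        (iset V fun y => ¬ φ y (horner T n (ifun V fun _ => 0) v) = 0) fun y hy => hy) ?_
      rintro y ⟨k, hk, hk'⟩
      rcases (INat.lt_add_one_iff.1 hk).lt_or_eq with h | rfl
      · exact .inl ⟨k, h, hk'⟩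
      · exact .inr hk'
  refine ⟨_, key (N + 1), fun n a y hy => map_horner_eq_zero T (φ y) v (fun k => ?_) n a⟩
  by_contra hk
  obtain ⟨l, hl, hl'⟩ := hN y ⟨k, hk⟩
  exact hy ⟨l, INat.lt_add_one_iff.2 hl, hl'⟩

/-- All p(T) v live on one finite set, and some monic p makes p(T) v vanish on that set. This takes
the place of a dimension count. -/
theorem IsFiniteCoord.exists_horner_eq_zero (hφ : IsFiniteCoord V φ e) (hY : DedekindFinite V (ISet V Y)) (v : W) :
    ∃ (n : INat V) (a : IFun V (INat V) K), horner T n a v = 0 := by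
  obtain ⟨S, hS, h⟩ := hφ.exists_kFin_support T hY v
  obtain ⟨n, -, a, ha⟩ := hφ.exists_horner_vanishing T v hS 0
  refine ⟨n, a, hφ.ext_zero _ fun y => ?_⟩
  by_cases hy : y ∈ S.1
  · exact ha y hy
  · exact h n a y hy

/-- Sequences that vanish from n on are n-tuples; splitting off the first entry reduces the claim to
scalar functions. -/
theorem kFin_irange_seq (hK : ∀ (f : Y → K) [IMap V f], KFin (irange V f)) (n : INat V)
    (g : IFun V Y (IFun V (INat V) K)) (hg : ∀ x i, n ≤ i → (g.1 x).1 i = 0) :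
    KFin (irange V g.1) := by
  refine INat.induction (fun n : INat V => ∀ g : IFun V Y (IFun V (INat V) K),
    (∀ x i, n ≤ i → (g.1 x).1 i = 0) → KFin (irange V g.1)) ?_ (fun n ih => ?_) n g hg
  · intro g hg
    refine (kFin_iempty.iinsert (ifun V fun _ => 0)).subset ?_
    rintro _ ⟨x, rfl⟩
    exact .inl (IFun.ext' fun i => hg x i (INat.zero_le i))
  · intro g hg
    refine (hK fun x => (g.1 x).1 0).irange_map₂ (ih (ifun V fun x => INat.tail (g.1 x)) ?_)
      INat.cons g.1 fun x => (INat.cons_tail _).symm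
    exact fun x i hi => hg x (i + 1) (add_le_add_left hi 1)

/-- The product of the polynomials works, because polynomials in T commute. -/
theorem exists_common_multiple {S : ISet V (INat V × IFun V (INat V) K)} (hS : KFin S) :
    ∃ (n : INat V) (a : IFun V (INat V) K), ∀ p, p ∈ S.1 →
      ∀ v, horner T p.1 p.2 v = 0 → horner T n a v = 0 := by
  refine KFin.induction (fun S : ISet V (INat V × IFun V (INat V) K) =>
    ∃ (n : INat V) (a : IFun V (INat V) K), ∀ p, p ∈ S.1 →
      ∀ v, horner T p.1 p.2 v = 0 → horner T n a v = 0) ?_ ?_ hS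
  · exact ⟨0, ifun V fun _ => 0, fun p hp => hp.elim⟩
  · rintro S q - - ⟨n, a, h⟩
    obtain ⟨c, hc⟩ := exists_horner_comp T n q.1 a q.2
    refine ⟨q.1 + n, c, ?_⟩
    rintro p (rfl | hp) v hv
    · rw [← hc, hv, horner_zero_right]
    · rw [← hc, horner_horner_comm, h p hp v hv, horner_zero_right]

/-- An internal operator on the finitely supported vectors over a power Dedekind-finite set is
annihilated by a monic polynomial. -/
theorem IsFiniteCoord.exists_annihilator (hφ : IsFiniteCoord V φ e) (hY : DedekindFinite V (ISet V Y))
    (hK : ∀ (f : Y → K) [IMap V f], KFin (irange V f)) :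
    ∃ (n : INat V) (a : IFun V (INat V) K), ∀ v, horner T n a v = 0 := by
  classical
  have := hφ.iMap_basis
  have := fun (γ : Type u) [Coded V γ] [IType V γ] (f : γ → Y) (g : γ → W) [IMap V f] [IMap V g] =>
    hφ.iMap_app f g
  -- The minimal polynomial of `e x`, with coefficients set to 0 from its degree on. This
  -- normalisation makes it unique as a sequence, hence a function of x without any choice.
  have key : ∀ x, ∃ p : INat V × IFun V (INat V) K, ∀ q, q = p ↔
      horner T q.1 q.2 (e x) = 0 ∧ (∀ i, q.1 ≤ i → q.2.1 i = 0) ∧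
        ∀ m (b : IFun V (INat V) K), horner T m b (e x) = 0 → q.1 ≤ m := by
    intro x
    obtain ⟨n, ⟨a, ha⟩, hn⟩ := INat.exists_least
      (fun n => ∃ a : IFun V (INat V) K, horner T n a (e x) = 0)
      (hφ.exists_horner_eq_zero T hY (e x))
    refine ⟨(n, ifun V fun i => if i < n then a.1 i else 0), fun q => ⟨?_, ?_⟩⟩
    · rintro rfl
      refine ⟨?_, fun i hi => if_neg (not_lt.2 hi), fun m b hb => hn m ⟨b, hb⟩⟩
      rw [← ha]
      exact horner_congr T n _ _ (fun i hi => if_pos hi) _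
    · rintro ⟨h₁, h₂, h₃⟩
      obtain rfl : q.1 = n := le_antisymm (h₃ n a ha) (hn _ ⟨_, h₁⟩)
      refine Prod.ext rfl (IFun.ext' fun i => ?_)
      rw [ifun_apply]
      split_ifs with hi
      -- If two annihilating monic polynomials of least degree differed, their difference would give
      -- one of smaller degree.
      · rcases horner_sub_horner T q.1 q.2 a with h | ⟨m, hm, s, c, hs, h⟩
        · exact h i hi
        · have := h (e x)
          rw [h₁, ha, sub_self] at this
          exact absurd (hn m ⟨c, (smul_eq_zero.1 this.symm).resolve_left hs⟩) (not_le.2 hm)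
      · exact h₂ i (not_lt.1 hi)
  choose f hf using key
  have : IMap V f := IMap.of_graph (fun x (q : INat V × IFun V (INat V) K) =>
      horner T q.1 q.2 (e x) = 0 ∧ (∀ i, q.1 ≤ i → q.2.1 i = 0) ∧
        ∀ m (b : IFun V (INat V) K), horner T m b (e x) = 0 → q.1 ≤ m) (by infer_instance) hf
  -- A common bound for the degrees turns the coefficient sequences into N-tuples, so only finitely
  -- many minimal polynomials occur.
  obtain ⟨N, hN⟩ := exists_bound_nat hY fun x => (f x).1
  have hrange : KFin (irange V f) := (kFin_irange_nat hY fun x => (f x).1).irange_map₂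
    (kFin_irange_seq hK N (ifun V fun x => (f x).2) fun x i hi =>
      ((hf x _).1 rfl).2.1 i ((hN x).trans hi)) (fun n a => (n, a)) f fun x => rfl
  obtain ⟨n, a, h⟩ := exists_common_multiple T hrange
  have hbasis : ∀ x, horner T n a (e x) = 0 := fun x => h (f x) ⟨x, rfl⟩ _ ((hf x _).1 rfl).1
  -- Induction on a finite set containing the support: subtracting `φ x v • e x` removes the point
  -- x.
  have hfin : ∀ S : ISet V Y, KFin S → ∀ v, (∀ y, ¬ φ y v = 0 → y ∈ S.1) →
      horner T n a v = 0 := by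
    intro S hS
    refine KFin.induction (fun S : ISet V Y => ∀ v, (∀ y, ¬ φ y v = 0 → y ∈ S.1) →
      horner T n a v = 0) ?_ ?_ hS
    · intro v hv
      rw [hφ.ext_zero v fun y => by_contra fun h => hv y h, horner_zero_right]
    · intro S x _ _ ih v hv
      have h₀ : horner T n a (v - φ x v • e x) = 0 := by
        refine ih _ fun y hy => ?_
        rw [map_sub, map_smul, smul_eq_mul] at hy
        by_cases hxy : x = y
        · subst hxy
          rw [hφ.apply_self, mul_one, sub_self] at hy
          exact absurd rfl hy
        · rw [hφ.apply_ne x y hxy, mul_zero, sub_zero] at hy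
          exact (hv y hy).resolve_left fun h => hxy h.symm
      rwa [horner_sub, horner_smul, hbasis, smul_zero, sub_zero] at h₀
  exact ⟨n, a, fun v => hfin (iset V fun y => ¬ φ y v = 0)
    (hφ.kFin_support v _ fun y hy => hy) v fun y hy => hy⟩

end Annihilator

/-! ## The Hilbert space -/

section HilbertSpace

variable {V : Type u} [Membership V V] [IsModel V] {R : RealField V} {X : V}
variable {γ : Type u} [Coded V γ] [IType V γ]

/-- The function `x ↦ |η x| ^ 2`. -/
def absSq (η : IFun V (El X) R.Cx) : IFun V (El X) R.Re :=
  ifun V fun x => (η.1 x).re ^ 2 + (η.1 x).im ^ 2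

instance iMap_absSq (f : γ → IFun V (El X) R.Cx) [IMap V f] : IMap V fun x => absSq (f x) := by
  unfold absSq
  infer_instance

theorem absSq_nonneg (η : IFun V (El X) R.Cx) (x : El X) : 0 ≤ (absSq η).1 x :=
  add_nonneg (sq_nonneg _) (sq_nonneg _)

theorem absSq_pos {η : IFun V (El X) R.Cx} {x : El X} (h : η.1 x ≠ 0) : 0 < (absSq η).1 x := by
  refine (absSq_nonneg η x).lt_of_ne' fun h' => h ?_
  have h' : (η.1 x).re ^ 2 + (η.1 x).im ^ 2 = 0 := h'
  refine QuadraticAlgebra.ext ?_ ?_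
  · exact pow_eq_zero_iff two_ne_zero |>.1 (by nlinarith [sq_nonneg (η.1 x).re, sq_nonneg (η.1 x).im])
  · exact pow_eq_zero_iff two_ne_zero |>.1 (by nlinarith [sq_nonneg (η.1 x).re, sq_nonneg (η.1 x).im])

theorem mem_finiteSums {η : IFun V (El X) R.Cx} {s : R.Re} :
    s ∈ finiteSums R η.1 ↔ ∃ F : ISet V (El X), KFin F ∧ IsFinSum R (absSq η).1 F s := by
  simp only [finiteSums, isFinite_iff_kFin]
  rfl

theorem bddAbove_finiteSums_iff {η : IFun V (El X) R.Cx} :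
    BddAbove (finiteSums R η.1) ↔
      ∃ b, ∀ F : ISet V (El X), KFin F → ∀ s, IsFinSum R (absSq η).1 F s → s ≤ b := by
  simp only [BddAbove, Set.Nonempty, mem_upperBounds, mem_finiteSums]
  exact exists_congr fun b => ⟨fun h F hF s hs => h s ⟨F, hF, hs⟩,
    fun h s ⟨F, hF, hs⟩ => h F hF s hs⟩

instance iPred_isFinSum (g : γ → IFun V (El X) R.Re) (F : γ → ISet V (El X)) (s : γ → R.Re)
    [IMap V g] [IMap V F] [IMap V s] : IPred V fun x => IsFinSum R (g x).1 (F x) (s x) :=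
  IPred.comp' _ (fun x => ((g x, F x), s x)) IPred.isFinSum inferInstance

instance iPred_bddAbove :
    IPred V fun η : IFun V (El X) R.Cx => BddAbove (finiteSums R η.1) := by
  simp only [bddAbove_finiteSums_iff]
  infer_instance

theorem finiteSums_le_add {η ζ θ : IFun V (El X) R.Cx} {a b k l s : R.Re} (hk : 0 ≤ k)
    (hl : 0 ≤ l) (hη : a ∈ upperBounds (finiteSums R η.1))
    (hζ : b ∈ upperBounds (finiteSums R ζ.1))
    (h : ∀ x, (absSq θ).1 x ≤ k * (absSq η).1 x + l * (absSq ζ).1 x)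
    (hs : s ∈ finiteSums R θ.1) : s ≤ k * a + l * b := by
  obtain ⟨F, hF, hs⟩ := mem_finiteSums.1 hs
  obtain ⟨s₁, h₁⟩ := exists_isFinSum (absSq η) hF
  obtain ⟨s₂, h₂⟩ := exists_isFinSum (absSq ζ) hF
  refine (hs.le_add hF h₁ h₂ h).trans (add_le_add (mul_le_mul_of_nonneg_left ?_ hk)
    (mul_le_mul_of_nonneg_left ?_ hl))
  · exact hη (mem_finiteSums.2 ⟨F, hF, h₁⟩)
  · exact hζ (mem_finiteSums.2 ⟨F, hF, h₂⟩)

/-- By the parallelogram identity. The factor 2 makes the Cauchy–Schwarz inequality and square roots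
unnecessary, and only boundedness matters later. -/
theorem absSq_add_le {η ζ θ : IFun V (El X) R.Cx} {x : El X} (h : θ.1 x = η.1 x + ζ.1 x) :
    (absSq θ).1 x ≤ 2 * (absSq η).1 x + 2 * (absSq ζ).1 x := by
  change (θ.1 x).re ^ 2 + (θ.1 x).im ^ 2 ≤ 2 * ((η.1 x).re ^ 2 + (η.1 x).im ^ 2) +
    2 * ((ζ.1 x).re ^ 2 + (ζ.1 x).im ^ 2)
  rw [h, QuadraticAlgebra.re_add, QuadraticAlgebra.im_add]
  nlinarith [sq_nonneg ((η.1 x).re - (ζ.1 x).re), sq_nonneg ((η.1 x).im - (ζ.1 x).im)]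

theorem absSq_smul {c : R.Cx} {η θ : IFun V (El X) R.Cx} {x : El X} (h : θ.1 x = c * η.1 x) :
    (absSq θ).1 x = (c.re ^ 2 + c.im ^ 2) * (absSq η).1 x := by
  change (θ.1 x).re ^ 2 + (θ.1 x).im ^ 2 = _ * ((η.1 x).re ^ 2 + (η.1 x).im ^ 2)
  rw [h, QuadraticAlgebra.re_mul, QuadraticAlgebra.im_mul]
  ring

namespace L2

theorem ext' {η ζ : L2 R X} (h : ∀ x, coord η x = coord ζ x) : η = ζ :=
  Subtype.ext (IFun.ext' h)

theorem bddAbove_add (η ζ : L2 R X) :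
    BddAbove (finiteSums R (ifun V fun x => coord η x + coord ζ x : IFun V (El X) R.Cx).1) := by
  obtain ⟨a, ha⟩ := η.2
  obtain ⟨b, hb⟩ := ζ.2
  exact ⟨2 * a + 2 * b, fun s hs => finiteSums_le_add zero_le_two zero_le_two ha hb
    (fun x => absSq_add_le rfl) hs⟩

theorem bddAbove_smul (c : R.Cx) (η : L2 R X) :
    BddAbove (finiteSums R (ifun V fun x => c * coord η x : IFun V (El X) R.Cx).1) := by
  obtain ⟨a, ha⟩ := η.2
  refine ⟨(c.re ^ 2 + c.im ^ 2) * a + 0 * a, fun s hs => finiteSums_le_add (by positivity) le_rfl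
    ha ha (fun x => ?_) hs⟩
  rw [absSq_smul (θ := ifun V fun x => c * coord η x) rfl, zero_mul, add_zero]

theorem bddAbove_zero :
    BddAbove (finiteSums R (ifun V fun _ => 0 : IFun V (El X) R.Cx).1) := by
  refine ⟨0, fun s hs => ?_⟩
  obtain ⟨F, hF, hs⟩ := mem_finiteSums.1 hs
  refine hs.le_of hF (fun _ => 0) (fun _ _ => le_rfl) fun A B x _ _ _ => ?_
  simp [absSq]

noncomputable instance : Add (L2 R X) := ⟨fun η ζ => ⟨_, bddAbove_add η ζ⟩⟩

noncomputable instance : Zero (L2 R X) := ⟨⟨_, bddAbove_zero⟩⟩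

noncomputable instance : SMul R.Cx (L2 R X) := ⟨fun c η => ⟨_, bddAbove_smul c η⟩⟩

noncomputable instance : Neg (L2 R X) := ⟨fun η => (-1 : R.Cx) • η⟩

@[simp] theorem coord_add (η ζ : L2 R X) (x : El X) :
    coord (η + ζ) x = coord η x + coord ζ x := rfl

@[simp] theorem coord_zero (x : El X) : coord (0 : L2 R X) x = 0 := rfl

@[simp] theorem coord_smul (c : R.Cx) (η : L2 R X) (x : El X) :
    coord (c • η) x = c * coord η x := rfl

@[simp] theorem coord_neg (η : L2 R X) (x : El X) : coord (-η) x = -coord η x :=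
  (coord_smul (-1) η x).trans (neg_one_mul _)

noncomputable instance : AddCommGroup (L2 R X) where
  add_assoc η ζ θ := ext' fun x => add_assoc _ _ _
  zero_add η := ext' fun x => zero_add _
  add_zero η := ext' fun x => add_zero _
  nsmul := nsmulRec
  zsmul := zsmulRec
  neg_add_cancel η := ext' fun x => by
    rw [coord_add, coord_neg, neg_add_cancel, coord_zero]
  add_comm η ζ := ext' fun x => add_comm _ _

noncomputable instance : Module R.Cx (L2 R X) where
  one_smul η := ext' fun x => one_mul _
  mul_smul c d η := ext' fun x => mul_assoc _ _ _
  smul_zero c := ext' fun x => mul_zero _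
  smul_add c η ζ := ext' fun x => mul_add _ _ _
  add_smul c d η := ext' fun x => add_mul _ _ _
  zero_smul η := ext' fun x => zero_mul _

@[simp] theorem coord_sub (η ζ : L2 R X) (x : El X) :
    coord (η - ζ) x = coord η x - coord ζ x := by
  rw [sub_eq_add_neg, coord_add, coord_neg, sub_eq_add_neg]

instance : IAdd V (L2 R X) :=
  ⟨IMap.of_graph (fun (p : L2 R X × L2 R X) θ => ∀ x, coord θ x = coord p.1 x + coord p.2 x)
    (by infer_instance) fun p θ => ⟨fun h => h ▸ fun x => rfl, fun h => ext' h⟩⟩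

instance : ISMul V R.Cx (L2 R X) :=
  ⟨IMap.of_graph (fun (p : R.Cx × L2 R X) θ => ∀ x, coord θ x = p.1 * coord p.2 x)
    (by infer_instance) fun p θ => ⟨fun h => h ▸ fun x => rfl, fun h => ext' h⟩⟩

/-- The coordinate functional. -/
noncomputable def coordLin (x : El X) : L2 R X →ₗ[R.Cx] R.Cx where
  toFun η := coord η x
  map_add' η ζ := rfl
  map_smul' c η := rfl

@[simp] theorem coordLin_apply (x : El X) (η : L2 R X) : coordLin x η = coord η x := rfl

open Classical in
theorem bddAbove_single (x : El X) :
    BddAbove (finiteSums R (ifun V fun y => if y = x then 1 else 0 : IFun V (El X) R.Cx).1) := by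
  refine ⟨1, fun s hs => ?_⟩
  obtain ⟨F, hF, hs⟩ := mem_finiteSums.1 hs
  -- The partial sum over A is compared with the indicator of x ∈ A.
  refine (hs.le_of hF (fun A => if x ∈ A.1 then 1 else 0) (fun A _ => ?_)
    fun A B y hy hB _ => ?_).trans ?_
  · split_ifs
    · exact zero_le_one
    · exact le_rfl
  · simp only [absSq, ifun_apply, hB]
    by_cases hxy : y = x
    · subst hxy
      simp [hy, QuadraticAlgebra.re_one, QuadraticAlgebra.im_one]
    · have hyx : ¬ x = y := fun h => hxy h.symm
      simp [hxy, hyx]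
  · split_ifs
    · exact le_rfl
    · exact zero_le_one

open Classical in
/-- The standard basis vector. -/
noncomputable def single (x : El X) : L2 R X := ⟨_, bddAbove_single x⟩

open Classical in
theorem coord_single (x y : El X) : coord (single x : L2 R X) y = if y = x then 1 else 0 := rfl

/-- Over a power Dedekind-finite set, square-summable vectors have finite support, so ℓ²(X) is a
purely algebraic space with basis `single`. -/
theorem isFiniteCoord (hX : PowerDedekindFinite X) :
    IsFiniteCoord V (coordLin : El X → L2 R X →ₗ[R.Cx] R.Cx) single where
  iMap := inferInstanceAs (IMap V fun p : El X × L2 R X => coord p.2 p.1)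
  iMap_basis := IMap.of_graph (fun x η => ∀ y, (y = x → coord η y = 1) ∧ (¬ y = x → coord η y = 0))
    (by infer_instance) fun x η => by
      constructor
      · rintro rfl y
        simp +contextual [coord_single]
      · refine fun h => ext' fun y => ?_
        rw [coord_single]
        split_ifs with hy
        · exact (h y).1 hy
        · exact (h y).2 hy
  kFin_support η S hS := by
    obtain ⟨b, hb⟩ := bddAbove_finiteSums_iff.1 η.2
    exact (kFin_support_of_bounded_sums hX hb).subset fun x hx => absSq_pos (hS x hx)
  ext_zero η h := ext' h
  apply_self x := by simp [coord_single]
  apply_ne x y h := by simp [coord_single, h.symm]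

theorem exists_isNormSq (η : L2 R X) : ∃ r, IsNormSq η r := by
  have h : IPred V fun s => s ∈ finiteSums R η.1.1 := by
    simp only [mem_finiteSums]
    infer_instance
  obtain ⟨s, hs⟩ := exists_isFinSum (absSq η.1) (kFin_iempty (V := V))
  exact R.exists_isLUB (iset V fun s => s ∈ finiteSums R η.1.1)
    ⟨s, mem_finiteSums.2 ⟨_, kFin_iempty, hs⟩⟩ η.2

theorem IsNormSq.nonneg {η : L2 R X} {r : R.Re} (h : IsNormSq η r) : 0 ≤ r := by
  refine h.1 (mem_finiteSums.2 ⟨_, kFin_iempty, isFinSum_iff.2 ⟨ifun V fun _ => 0, ⟨fun _ _ => rfl,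
    fun A B x _ hB hF => ?_⟩, rfl⟩⟩)
  exact (hF x ((hB x).2 (.inl rfl))).elim

theorem IsNormSq.add_le {η ζ : L2 R X} {a b r : R.Re} (hη : IsNormSq η a) (hζ : IsNormSq ζ b)
    (h : IsNormSq (η + ζ) r) : r ≤ 2 * a + 2 * b :=
  h.2 fun s hs => finiteSums_le_add zero_le_two zero_le_two hη.1 hζ.1 (fun x => absSq_add_le rfl) hs

theorem IsNormSq.smul_le {c : R.Cx} {η : L2 R X} {a r : R.Re} (hη : IsNormSq η a)
    (h : IsNormSq (c • η) r) : r ≤ (c.re ^ 2 + c.im ^ 2) * a := by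
  refine h.2 fun s hs => (finiteSums_le_add (k := c.re ^ 2 + c.im ^ 2) (l := 0) (by positivity)
    le_rfl hη.1 hη.1 (fun x => ?_) hs).trans (by rw [zero_mul, add_zero])
  rw [absSq_smul (η := η.1) (c := c) rfl, zero_mul, add_zero]

instance (f : γ → L2 R X) (r : γ → R.Re) [IMap V f] [IMap V r] :
    IPred V fun x => IsNormSq (f x) (r x) := by
  have : ∀ (η : L2 R X) (r : R.Re), IsNormSq η r ↔
      (∀ s, (∃ F : ISet V (El X), KFin F ∧ IsFinSum R (absSq η.1).1 F s) → s ≤ r) ∧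
        ∀ t, (∀ s, (∃ F : ISet V (El X), KFin F ∧ IsFinSum R (absSq η.1).1 F s) → s ≤ t) →
          r ≤ t := by
    intro η r
    simp only [← mem_finiteSums]
    rfl
  simp only [this]
  infer_instance

end L2

end HilbertSpace

/-! ## Bounded operators -/

section Operators

variable {V : Type u} [Membership V V] [IsModel V] {R : RealField V} {X : V}

/-- `‖A η‖² ≤ K ‖η‖²`. -/
def NormSqLE (A : L2 R X → L2 R X) (K : R.Re) : Prop :=
  0 ≤ K ∧ ∀ (η : L2 R X) (a b : R.Re), IsNormSq η a → IsNormSq (A η) b → b ≤ K * a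

theorem normSqLE_id : NormSqLE (fun η : L2 R X => η) 1 :=
  ⟨zero_le_one, fun η a b ha hb => by rw [one_mul, ha.unique hb]⟩

theorem NormSqLE.add {A B : L2 R X → L2 R X} {K L : R.Re} (hA : NormSqLE A K)
    (hB : NormSqLE B L) : NormSqLE (fun η => A η + B η) (2 * K + 2 * L) := by
  refine ⟨by linarith [hA.1, hB.1], fun η a b ha hb => ?_⟩
  obtain ⟨c, hc⟩ := L2.exists_isNormSq (A η)
  obtain ⟨d, hd⟩ := L2.exists_isNormSq (B η)
  linarith [L2.IsNormSq.add_le hc hd hb, hA.2 η a c ha hc, hB.2 η a d ha hd]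

theorem NormSqLE.smul {A : L2 R X → L2 R X} {K : R.Re} (hA : NormSqLE A K) (c : R.Cx) :
    NormSqLE (fun η => c • A η) ((c.re ^ 2 + c.im ^ 2) * K) := by
  have hc : 0 ≤ c.re ^ 2 + c.im ^ 2 := by positivity
  refine ⟨mul_nonneg hc hA.1, fun η a b ha hb => ?_⟩
  obtain ⟨d, hd⟩ := L2.exists_isNormSq (A η)
  rw [mul_assoc]
  exact (L2.IsNormSq.smul_le hd hb).trans (mul_le_mul_of_nonneg_left (hA.2 η a d ha hd) hc)

theorem NormSqLE.comp {A B : L2 R X → L2 R X} {K L : R.Re} (hA : NormSqLE A K)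
    (hB : NormSqLE B L) : NormSqLE (fun η => A (B η)) (K * L) := by
  refine ⟨mul_nonneg hA.1 hB.1, fun η a b ha hb => ?_⟩
  obtain ⟨d, hd⟩ := L2.exists_isNormSq (B η)
  rw [mul_assoc]
  exact (hA.2 _ d b hd hb).trans (mul_le_mul_of_nonneg_left (hB.2 η a d ha hd) hA.1)

namespace IsBoundedOperator

variable {T : L2 R X → L2 R X}

theorem of_linear (A : L2 R X →ₗ[R.Cx] L2 R X) (h : IMap V (A : L2 R X → L2 R X)) {K : R.Re}
    (hK : NormSqLE A K) : IsBoundedOperator (A : L2 R X → L2 R X) where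
  internal := h.out
  map_add η ζ θ hθ x := by
    obtain rfl : θ = η + ζ := L2.ext' hθ
    exact congrArg (coord · x) (_root_.map_add A η ζ)
  map_smul c η θ hθ x := by
    obtain rfl : θ = c • η := L2.ext' hθ
    exact congrArg (coord · x) (_root_.map_smul A c η)
  bounded := by
    -- The definition asks for a squared constant; K ≤ (K + 1)² spares a square root.
    refine ⟨K + 1, fun η a b ha hb => (hK.2 η a b ha hb).trans
      (mul_le_mul_of_nonneg_right ?_ (L2.IsNormSq.nonneg ha))⟩
    nlinarith [hK.1]

variable (hT : IsBoundedOperator T)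

/-- A bounded operator as a linear map. -/
noncomputable def toLin (hT : IsBoundedOperator T) : L2 R X →ₗ[R.Cx] L2 R X where
  toFun := T
  map_add' η ζ := L2.ext' (hT.map_add η ζ _ fun _ => rfl)
  map_smul' c η := L2.ext' (hT.map_smul c η _ fun _ => rfl)

@[simp] theorem toLin_apply (hT : IsBoundedOperator T) (η : L2 R X) : hT.toLin η = T η := rfl

instance iMap_toLin (hT : IsBoundedOperator T) : IMap V (hT.toLin : L2 R X → L2 R X) :=
  ⟨hT.internal⟩

theorem exists_normSqLE (hT : IsBoundedOperator T) : ∃ K, NormSqLE T K := by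
  obtain ⟨M, hM⟩ := hT.bounded
  exact ⟨M ^ 2, sq_nonneg M, hM⟩

theorem exists_normSqLE_horner (hT : IsBoundedOperator T) (n : INat V)
    (a : IFun V (INat V) R.Cx) : ∃ K, NormSqLE (horner hT.toLin n a) K := by
  obtain ⟨L, hL⟩ := hT.exists_normSqLE
  have : IPred V fun n : INat V => ∀ a : IFun V (INat V) R.Cx,
      ∃ K, NormSqLE (horner hT.toLin n a) K := by
    unfold NormSqLE
    infer_instance
  refine INat.induction (fun n : INat V => ∀ a : IFun V (INat V) R.Cx,
    ∃ K, NormSqLE (horner hT.toLin n a) K) ?_ (fun n ih => ?_) n a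
  · intro a
    refine ⟨1, ?_⟩
    rw [show horner hT.toLin 0 a = fun η => η from funext fun η => horner_zero _ _ _]
    exact normSqLE_id
  · intro a
    obtain ⟨K, hK⟩ := ih (INat.tail a)
    refine ⟨2 * (((a.1 0).re ^ 2 + (a.1 0).im ^ 2) * 1) + 2 * (L * K), ?_⟩
    rw [show horner hT.toLin (n + 1) a = fun η => a.1 0 • η + T (horner hT.toLin n (INat.tail a) η)
      from funext fun η => horner_add_one _ _ _ _]
    exact (normSqLE_id.smul _).add (hL.comp hK)

/-- A bounded operator on a power Dedekind-finite set is annihilated by a monic polynomial. -/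
theorem exists_annihilator (hT : IsBoundedOperator T) (hX : PowerDedekindFinite X) :
    ∃ (n : INat V) (a : IFun V (INat V) R.Cx), ∀ η, horner hT.toLin n a η = 0 :=
  (L2.isFiniteCoord hX).exists_annihilator hT.toLin hX fun f hf => R.kFin_irange_cx hX f

theorem isEigenvalue_iff (hT : IsBoundedOperator T) {c : R.Cx} :
    IsEigenvalue T c ↔ ∃ η : L2 R X, ¬ η = 0 ∧ T η = c • η := by
  refine exists_congr fun η => and_congr ?_ ⟨fun h => L2.ext' h, fun h x => by rw [h]; rfl⟩
  rw [← not_forall_not]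
  refine not_congr ⟨fun h => L2.ext' fun x => not_not.1 (h x), ?_⟩
  rintro rfl x
  exact not_not.2 rfl

theorem not_isInvertibleSub_of_isEigenvalue (hT : IsBoundedOperator T) {c : R.Cx}
    (hc : IsEigenvalue T c) : ¬ IsInvertibleSub T c := by
  rintro ⟨S, hS, h, -⟩
  obtain ⟨η, hη, hη'⟩ := hT.isEigenvalue_iff.1 hc
  have h₁ : S 0 = η := h η 0 fun x => by
    rw [hη', L2.coord_smul, sub_self, L2.coord_zero]
  have h₂ : hS.toLin 0 = 0 := map_zero _
  exact hη (h₁.symm.trans h₂)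

/-- A point of the spectrum is an eigenvalue. -/
theorem isInvertibleSub_or_isEigenvalue (hT : IsBoundedOperator T) (hX : PowerDedekindFinite X)
    (c : R.Cx) : IsInvertibleSub T c ∨ IsEigenvalue T c := by
  -- An annihilating polynomial of least degree, that is, a minimal polynomial of T.
  obtain ⟨n, ⟨a, ha⟩, hn⟩ := INat.exists_least (fun n => ∃ a : IFun V (INat V) R.Cx,
    ∀ η, horner hT.toLin n a η = 0) (hT.exists_annihilator hX)
  rcases INat.eq_zero_or_eq_add_one n with rfl | ⟨m, rfl⟩
  -- Degree 0 means that the identity is zero, so the space is trivial and the identity is an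
  -- inverse.
  · have h₀ : ∀ η : L2 R X, η = 0 := fun η => by simpa using ha η
    refine .inl ⟨fun η => η, of_linear LinearMap.id IMap.id normSqLE_id, fun η ζ _ => ?_,
      fun η x => ?_⟩
    · rw [h₀ η, h₀ ζ]
    · rw [h₀ η, h₀ (T 0), L2.coord_zero, mul_zero, sub_zero]
  obtain ⟨k, b, h⟩ := exists_horner_eq_sub hT.toLin c m a
  simp only [ha, toLin_apply] at h
  by_cases hk : k = 0
  · right
    -- The quotient q has smaller degree than the minimal polynomial, so q(T) is not zero. Its
    -- nonzero values are killed by T - c.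
    obtain ⟨η, hη⟩ : ∃ η, ¬ horner hT.toLin m b η = 0 := by
      by_contra! hb
      exact absurd (hn m ⟨b, hb⟩) (not_le.2 (INat.lt_add_one m))
    refine hT.isEigenvalue_iff.2 ⟨_, hη, ?_⟩
    have := h η
    rw [hk, zero_smul, zero_add] at this
    exact sub_eq_zero.1 this.symm
  · left
    obtain ⟨K, hK⟩ := hT.exists_normSqLE_horner m b
    -- From 0 = k + (T - c) q(T), the bounded operator -k⁻¹ q(T) inverts T - c.
    have hinv : ∀ η, (-k⁻¹) • (T (horner hT.toLin m b η) - c • horner hT.toLin m b η) = η := by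
      intro η
      rw [eq_neg_of_add_eq_zero_right (h η).symm, smul_neg, neg_smul, neg_neg, smul_smul,
        inv_mul_cancel₀ hk, one_smul]
    refine ⟨fun η => (-k⁻¹) • horner hT.toLin m b η, ?_, fun η ζ hζ => ?_, fun η x => ?_⟩
    · exact of_linear ((-k⁻¹) • hornerLin hT.toLin m b)
        (inferInstanceAs (IMap V fun η => (-k⁻¹) • horner hT.toLin m b η)) (hK.smul _)
    · obtain rfl : ζ = T η - c • η := L2.ext' fun x => by rw [hζ, L2.coord_sub, L2.coord_smul]
      have := horner_comm hT.toLin m b η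
      rw [toLin_apply, toLin_apply] at this
      refine Eq.trans ?_ (hinv η)
      change (-k⁻¹) • horner hT.toLin m b (T η - c • η) = _
      rw [horner_sub, horner_smul, this]
    · have : T ((-k⁻¹) • horner hT.toLin m b η) = (-k⁻¹) • T (horner hT.toLin m b η) :=
        _root_.map_smul hT.toLin _ _
      rw [this, ← L2.coord_smul, ← L2.coord_sub, smul_comm c, ← smul_sub, hinv]

theorem spectrum_finite (hT : IsBoundedOperator T) (hX : PowerDedekindFinite X) :
    IsFinite V (opSpectrum T) ∧ ∀ c ∈ opSpectrum T, IsEigenvalue T c := by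
  have hspec : ∀ c, c ∈ opSpectrum T ↔ IsEigenvalue T c := fun c =>
    ⟨fun h => (hT.isInvertibleSub_or_isEigenvalue hX c).resolve_left h,
      hT.not_isInvertibleSub_of_isEigenvalue⟩
  refine ⟨?_, fun c => (hspec c).1⟩
  obtain ⟨n, a, h⟩ := hT.exists_annihilator hX
  -- Since p(T) annihilates all vectors, the condition that it annihilates the eigenvector can be
  -- added freely; this is the form to which `kFin_eigenvalues` applies.
  have heq : opSpectrum T = (iset V fun c : R.Cx => ∃ η : L2 R X, ¬ η = 0 ∧
      hT.toLin η = c • η ∧ horner hT.toLin n a η = 0).1 := by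
    ext c
    rw [hspec, hT.isEigenvalue_iff]
    exact exists_congr fun η => ⟨fun hη => ⟨hη.1, hη.2, h η⟩, fun hη => ⟨hη.1, hη.2.1⟩⟩
  rw [heq, isFinite_iff_kFin]
  exact kFin_eigenvalues hT.toLin n a

end IsBoundedOperator

end Operators

/-! ## Orders given by a cone of nonnegative elements -/

/-- A set of elements that can serve as the set of nonnegative elements of a linear order. -/
structure IsTotalCone {A : Type u} [CommRing A] (P : A → Prop) : Prop where
  add : ∀ {a b}, P a → P b → P (a + b)
  mul : ∀ {a b}, P a → P b → P (a * b)
  total : ∀ a, P a ∨ P (-a)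
  eq_zero : ∀ {a}, P a → P (-a) → a = 0

namespace IsTotalCone

variable {A : Type u} [CommRing A] {P : A → Prop}

theorem zero (h : IsTotalCone P) : P 0 := by
  rcases h.total 0 with h' | h'
  · exact h'
  · rwa [neg_zero] at h'

theorem one (h : IsTotalCone P) : P 1 := by
  rcases h.total 1 with h' | h'
  · exact h'
  · simpa using h.mul h' h'

/-- The linear order with `a ≤ b ↔ P (b - a)`. -/
noncomputable abbrev linearOrder (h : IsTotalCone P) : LinearOrder A where
  le a b := P (b - a)
  le_refl a := by
    rw [sub_self]
    exact h.zero
  le_trans a b c hab hbc := by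
    have := h.add hbc hab
    rwa [sub_add_sub_cancel] at this
  le_antisymm a b hab hba := by
    have hba : P (a - b) := hba
    rw [← neg_sub] at hba
    exact (sub_eq_zero.1 (h.eq_zero hab hba)).symm
  le_total a b := by
    have := h.total (b - a)
    rwa [neg_sub] at this
  toDecidableLE := Classical.decRel _

theorem isStrictOrderedRing [Nontrivial A] [NoZeroDivisors A] (h : IsTotalCone P) :
    letI := h.linearOrder
    IsStrictOrderedRing A := by
  let := h.linearOrder
  have hadd : ∀ a b : A, a ≤ b → ∀ c, a + c ≤ b + c := fun a b hab c => by
    change P (b + c - (a + c))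
    rwa [add_sub_add_right_eq_sub]
  have : IsOrderedAddMonoid A := { add_le_add_left := hadd }
  have : ZeroLEOneClass A := ⟨by
    change P (1 - 0)
    rw [sub_zero]
    exact h.one⟩
  have : IsOrderedRing A := .of_mul_nonneg fun a b (ha : P (a - 0)) (hb : P (b - 0)) => by
    change P (a * b - 0)
    rw [sub_zero] at *
    exact h.mul ha hb
  exact IsOrderedRing.toIsStrictOrderedRing A

theorem nonneg_iff (h : IsTotalCone P) {a : A} :
    letI := h.linearOrder
    0 ≤ a ↔ P a := by
  change P (a - 0) ↔ _
  rw [sub_zero]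

end IsTotalCone

/-! ### Operations and orders on quotients -/

section Surjections

variable {V : Type u} [Membership V V] [IsModel V]
variable {α β γ δ : Type u} [Coded V α] [IType V α] [Coded V β] [IType V β] [Coded V γ] [IType V γ]
  [Coded V δ] [IType V δ]

/-- Binary operations on a quotient are internal if they are internal on representatives. -/
theorem IMap.of_comp_surj₂ {π : α → β} (hπ : Function.Surjective π) [hi : IMap V π]
    {f : β → β → γ} (h : IMap V fun p : α × α => f (π p.1) (π p.2)) :
    IMap V fun p : β × β => f p.1 p.2 := by
  have : IMap V (Prod.map π π) := by
    have h₁ : IMap V fun p : α × α => π p.1 := IMap.comp' π _ hi inferInstance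
    have h₂ : IMap V fun p : α × α => π p.2 := IMap.comp' π _ hi inferInstance
    exact inferInstanceAs (IMap V fun p : α × α => (π p.1, π p.2))
  exact IMap.of_comp_surj (hπ.prodMap hπ) h

/-- The relation a ≤ b is `P` applied to b - a, so it is internal as soon as the cone is. -/
theorem ILE.of_cone [CommRing β] [IAdd V β] {P : β → Prop} (hP : IsTotalCone P)
    [hi : IPred V P] : @ILE V _ β _ hP.linearOrder.toLE := by
  let := hP.linearOrder
  exact ⟨IPred.comp' P (fun p : β × β => p.2 - p.1) hi inferInstance⟩

end Surjections

/-! ## Integers -/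

section Integers

variable (V : Type u) [Membership V V] [IsModel V]

instance : NoZeroDivisors (INat V) where
  eq_zero_or_eq_zero_of_mul_eq_zero {m n} h := by
    rcases INat.eq_zero_or_eq_add_one m with rfl | ⟨k, rfl⟩
    · exact .inl rfl
    rcases INat.eq_zero_or_eq_add_one n with rfl | ⟨l, rfl⟩
    · exact .inr rfl
    refine absurd h ?_
    rw [show (k + 1) * (l + 1) = k * l + k + l + 1 by ring]
    exact INat.add_one_ne_zero _

/-- The pair of natural numbers `(a, b)` stands for `a - b`: it is `a + b ω` with `ω ^ 2 = 1`,
and `ω` becomes `-1`. -/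
noncomputable def intCon : RingCon (QuadraticAlgebra (INat V) 1 0) where
  r z w := z.re + w.im = w.re + z.im
  iseqv := by
    refine ⟨fun z => rfl, fun {z w} h => h.symm, fun {x y z} h₁ h₂ => ?_⟩
    have : x.re + z.im + (y.re + y.im) = z.re + x.im + (y.re + y.im) := by
      calc _ = (x.re + y.im) + (y.re + z.im) := by ring
        _ = (y.re + x.im) + (z.re + y.im) := by rw [h₁, h₂]
        _ = _ := by ring
    exact add_right_cancel this
  add' {w x y z} h₁ h₂ := by
    simp only [QuadraticAlgebra.re_add, QuadraticAlgebra.im_add]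
    calc _ = (w.re + x.im) + (y.re + z.im) := by ring
      _ = (x.re + w.im) + (z.re + y.im) := by rw [h₁, h₂]
      _ = _ := by ring
  mul' {w x y z} h₁ h₂ := by
    simp only [QuadraticAlgebra.re_mul, QuadraticAlgebra.im_mul]
    -- There is no subtraction on the natural numbers, so the same term is added to both sides and
    -- then cancelled.
    have : w.re * y.re + 1 * w.im * y.im + (x.re * z.im + x.im * z.re + 0 * x.im * z.im) +
        (x.re * y.re + x.im * y.im + x.re * y.im + x.im * y.re) =
        x.re * z.re + 1 * x.im * z.im + (w.re * y.im + w.im * y.re + 0 * w.im * y.im) +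
        (x.re * y.re + x.im * y.im + x.re * y.im + x.im * y.re) := by
      calc _ = (w.re + x.im) * y.re + (x.re + w.im) * y.im + x.re * (y.re + z.im) +
            x.im * (z.re + y.im) := by ring
        _ = (x.re + w.im) * y.re + (w.re + x.im) * y.im + x.re * (z.re + y.im) +
            x.im * (y.re + z.im) := by rw [h₁, h₂]
        _ = _ := by ring
    exact add_right_cancel this

/-- The integers of the model. -/
def IInt : Type u := (intCon V).Quotient

namespace IInt

noncomputable instance : CommSemiring (IInt V) :=
  inferInstanceAs (CommSemiring (intCon V).Quotient)

variable {V}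

/-- The class of a pair of natural numbers. -/
noncomputable def mk (z : QuadraticAlgebra (INat V) 1 0) : IInt V := RingCon.toQuotient (c := intCon V) z

theorem mk_surjective : Function.Surjective (mk (V := V)) := Quotient.mk_surjective

theorem mk_eq_mk {z w : QuadraticAlgebra (INat V) 1 0} :
    mk z = mk w ↔ z.re + w.im = w.re + z.im := RingCon.eq (intCon V)

theorem mk_add (z w : QuadraticAlgebra (INat V) 1 0) : mk (z + w) = mk z + mk w := rfl

theorem mk_mul (z w : QuadraticAlgebra (INat V) 1 0) : mk (z * w) = mk z * mk w := rfl

noncomputable instance : Coded V (IInt V) := codedOfSurj mk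

theorem iPred_mk_eq : IPred V fun p : QuadraticAlgebra (INat V) 1 0 × QuadraticAlgebra (INat V) 1 0 =>
    mk p.1 = mk p.2 := by
  simp only [mk_eq_mk]
  infer_instance

instance : IType V (IInt V) := iType_of_surj mk mk_surjective iPred_mk_eq

instance : IMap V (mk (V := V)) := iMap_of_surj mk mk_surjective iPred_mk_eq

noncomputable instance : CommRing (IInt V) where
  neg x := mk ⟨0, 1⟩ * x
  zsmul := @zsmulRec _ _ _ ⟨fun x => mk ⟨0, 1⟩ * x⟩ nsmulRec
  neg_add_cancel x := by
    obtain ⟨z, rfl⟩ := mk_surjective x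
    change mk (⟨0, 1⟩ * z + z) = mk 0
    rw [mk_eq_mk]
    simp [add_comm]

instance : IAdd V (IInt V) := ⟨by
  refine IMap.of_comp_surj₂ (f := fun x y : IInt V => x + y) mk_surjective ?_
  exact inferInstanceAs (IMap V fun p : QuadraticAlgebra (INat V) 1 0 ×
    QuadraticAlgebra (INat V) 1 0 => mk ⟨p.1.re + p.2.re, p.1.im + p.2.im⟩)⟩

instance : IMul V (IInt V) := ⟨by
  refine IMap.of_comp_surj₂ (f := fun x y : IInt V => x * y) mk_surjective ?_
  exact inferInstanceAs (IMap V fun p : QuadraticAlgebra (INat V) 1 0 ×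
    QuadraticAlgebra (INat V) 1 0 => mk ⟨p.1.re * p.2.re + 1 * p.1.im * p.2.im,
      p.1.re * p.2.im + p.1.im * p.2.re + 0 * p.1.im * p.2.im⟩)⟩

/-- The natural numbers as integers. -/
noncomputable def ofNat : INat V →+* IInt V where
  toFun n := mk ⟨n, 0⟩
  map_zero' := rfl
  map_one' := rfl
  map_add' m n := by
    rw [← mk_add, mk_eq_mk]
    simp
  map_mul' m n := by
    rw [← mk_mul, mk_eq_mk]
    simp

instance : IMap V (ofNat (V := V)) := inferInstanceAs (IMap V fun n : INat V => mk ⟨n, 0⟩)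

theorem ofNat_injective : Function.Injective (ofNat (V := V)) := fun m n h => by
  have := mk_eq_mk.1 h
  simpa using this

theorem eq_or_eq_neg (x : IInt V) : ∃ n, x = ofNat n ∨ x = -ofNat n := by
  obtain ⟨z, rfl⟩ := mk_surjective x
  have hz : mk z = ofNat z.re - ofNat z.im := by
    rw [eq_sub_iff_add_eq]
    change mk (z + ⟨z.im, 0⟩) = mk ⟨z.re, 0⟩
    rw [mk_eq_mk]
    simp
  rcases le_total z.im z.re with h | h
  · obtain ⟨d, hd⟩ := h
    refine ⟨d, .inl ?_⟩
    rw [hz, hd, map_add, add_sub_cancel_left]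
  · obtain ⟨d, hd⟩ := h
    refine ⟨d, .inr ?_⟩
    rw [hz, hd, map_add, sub_add_cancel_left]

instance : Nontrivial (IInt V) :=
  ⟨ofNat 0, ofNat 1, fun h => zero_ne_one (ofNat_injective h)⟩

theorem ofNat_eq_zero {n : INat V} : ofNat n = 0 ↔ n = 0 :=
  map_eq_zero_iff _ ofNat_injective

instance : NoZeroDivisors (IInt V) where
  eq_zero_or_eq_zero_of_mul_eq_zero {x y} h := by
    obtain ⟨m, hm⟩ := eq_or_eq_neg x
    obtain ⟨n, hn⟩ := eq_or_eq_neg y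
    have h' : ofNat (m * n) = 0 := by
      rw [map_mul]
      rcases hm with rfl | rfl <;> rcases hn with rfl | rfl <;> simpa using h
    rcases mul_eq_zero.1 (ofNat_eq_zero.1 h') with rfl | rfl
    · exact .inl (by simpa using hm)
    · exact .inr (by simpa using hn)

instance : IsDomain (IInt V) := NoZeroDivisors.to_isDomain _

end IInt

/-! ## Rational numbers -/

/-- The rational numbers of the model. -/
def IRat : Type u := FractionRing (IInt V)

namespace IRat

noncomputable instance : Field (IRat V) := inferInstanceAs (Field (FractionRing (IInt V)))

noncomputable instance : Algebra (IInt V) (IRat V) :=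
  inferInstanceAs (Algebra (IInt V) (FractionRing (IInt V)))

instance : IsFractionRing (IInt V) (IRat V) :=
  inferInstanceAs (IsFractionRing (IInt V) (FractionRing (IInt V)))

variable {V}

/-- The fraction `a / b`. -/
noncomputable def mk (p : IInt V × {b : IInt V // ¬ b = 0}) : IRat V :=
  algebraMap (IInt V) (IRat V) p.1 / algebraMap (IInt V) (IRat V) p.2.1

theorem algebraMap_ne_zero {b : IInt V} (h : ¬ b = 0) : algebraMap (IInt V) (IRat V) b ≠ 0 :=
  (map_ne_zero_iff _ (IsFractionRing.injective (IInt V) (IRat V))).2 h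

theorem mk_surjective : Function.Surjective (mk (V := V)) := fun x => by
  obtain ⟨a, b, hb, rfl⟩ := IsFractionRing.div_surjective (A := IInt V) x
  exact ⟨(a, ⟨b, nonZeroDivisors.ne_zero hb⟩), rfl⟩

theorem mk_eq_mk {p q : IInt V × {b : IInt V // ¬ b = 0}} :
    mk p = mk q ↔ p.1 * q.2.1 = q.1 * p.2.1 := by
  rw [mk, mk, div_eq_div_iff (algebraMap_ne_zero p.2.2) (algebraMap_ne_zero q.2.2), ← map_mul,
    ← map_mul, (IsFractionRing.injective (IInt V) (IRat V)).eq_iff]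

noncomputable instance : Coded V (IRat V) := codedOfSurj mk

theorem iPred_mk_eq : IPred V fun p : (IInt V × {b : IInt V // ¬ b = 0}) ×
    (IInt V × {b : IInt V // ¬ b = 0}) => mk p.1 = mk p.2 := by
  simp only [mk_eq_mk]
  infer_instance

instance : IType V (IRat V) := iType_of_surj mk mk_surjective iPred_mk_eq

instance : IMap V (mk (V := V)) := iMap_of_surj mk mk_surjective iPred_mk_eq

instance : IAdd V (IRat V) := ⟨by
  refine IMap.of_comp_surj₂ (f := fun x y : IRat V => x + y) mk_surjective ?_
  have : (fun p : (IInt V × {b : IInt V // ¬ b = 0}) × (IInt V × {b : IInt V // ¬ b = 0}) =>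
      mk p.1 + mk p.2) = fun p => mk (p.1.1 * p.2.2.1 + p.1.2.1 * p.2.1,
        ⟨p.1.2.1 * p.2.2.1, mul_ne_zero p.1.2.2 p.2.2.2⟩) := by
    funext p
    simp only [mk, map_add, map_mul]
    exact div_add_div _ _ (algebraMap_ne_zero p.1.2.2) (algebraMap_ne_zero p.2.2.2)
  rw [this]
  infer_instance⟩

instance : IMul V (IRat V) := ⟨by
  refine IMap.of_comp_surj₂ (f := fun x y : IRat V => x * y) mk_surjective ?_
  have : (fun p : (IInt V × {b : IInt V // ¬ b = 0}) × (IInt V × {b : IInt V // ¬ b = 0}) =>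
      mk p.1 * mk p.2) = fun p => mk (p.1.1 * p.2.1,
        ⟨p.1.2.1 * p.2.2.1, mul_ne_zero p.1.2.2 p.2.2.2⟩) := by
    funext p
    simp only [mk, map_mul]
    exact div_mul_div_comm _ _ _ _
  rw [this]
  infer_instance⟩

/-- The natural numbers as rational numbers. -/
noncomputable def ofNat : INat V →+* IRat V :=
  (algebraMap (IInt V) (IRat V)).comp IInt.ofNat

theorem ofNat_injective : Function.Injective (ofNat (V := V)) :=
  (IsFractionRing.injective (IInt V) (IRat V)).comp IInt.ofNat_injective

theorem ofNat_ne_zero {n : INat V} (h : n ≠ 0) : ofNat n ≠ 0 :=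
  (map_ne_zero_iff _ ofNat_injective).2 h

instance : IMap V (ofNat (V := V)) := by
  have : (ofNat : INat V → IRat V) = fun n => mk (IInt.ofNat n, ⟨1, one_ne_zero⟩) := by
    funext n
    simp [ofNat, mk]
  rw [this]
  infer_instance

/-- The nonnegative rational numbers. -/
def IsNonneg (x : IRat V) : Prop := ∃ m n : INat V, x = ofNat m / ofNat n

instance : IPred V (IsNonneg (V := V)) := by
  unfold IsNonneg
  simp only [div_eq_mul_inv]
  infer_instance

/-- Division by 0 gives 0 = 0 / 1, so a zero denominator can be avoided. -/
theorem isNonneg_iff {x : IRat V} : IsNonneg x ↔ ∃ m n : INat V, n ≠ 0 ∧ x = ofNat m / ofNat n := by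
  refine ⟨?_, fun ⟨m, n, _, h⟩ => ⟨m, n, h⟩⟩
  rintro ⟨m, n, rfl⟩
  by_cases hn : n = 0
  · exact ⟨0, 1, one_ne_zero, by simp [hn]⟩
  · exact ⟨m, n, hn, rfl⟩

theorem eq_or_eq_neg (x : IRat V) :
    ∃ m n : INat V, n ≠ 0 ∧ (x = ofNat m / ofNat n ∨ x = -(ofNat m / ofNat n)) := by
  obtain ⟨⟨a, b, hb⟩, rfl⟩ := mk_surjective x
  obtain ⟨m, rfl | rfl⟩ := IInt.eq_or_eq_neg a <;> obtain ⟨n, rfl | rfl⟩ := IInt.eq_or_eq_neg b <;>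
  refine ⟨m, n, fun h => hb (by simp [h]), ?_⟩ <;> simp only [mk, map_neg, neg_div, div_neg, neg_neg]
  · exact .inl rfl
  · exact .inr rfl
  · exact .inr rfl
  · exact .inl rfl

theorem isTotalCone : IsTotalCone (IsNonneg (V := V)) where
  add := by
    intro a b ha hb
    obtain ⟨m, n, hn, rfl⟩ := isNonneg_iff.1 ha
    obtain ⟨k, l, hl, rfl⟩ := isNonneg_iff.1 hb
    refine ⟨m * l + n * k, n * l, ?_⟩
    rw [map_add, map_mul, map_mul, map_mul]
    exact div_add_div _ _ (ofNat_ne_zero hn) (ofNat_ne_zero hl)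
  mul := by
    rintro _ _ ⟨m, n, rfl⟩ ⟨k, l, rfl⟩
    exact ⟨m * k, n * l, by rw [map_mul, map_mul, div_mul_div_comm]⟩
  total x := by
    obtain ⟨m, n, -, rfl | rfl⟩ := eq_or_eq_neg x
    · exact .inl ⟨m, n, rfl⟩
    · exact .inr ⟨m, n, neg_neg _⟩
  eq_zero := by
    intro a ha hb
    obtain ⟨m, n, hn, rfl⟩ := isNonneg_iff.1 ha
    obtain ⟨k, l, hl, h⟩ := isNonneg_iff.1 hb
    rw [neg_eq_iff_add_eq_zero, div_add_div _ _ (ofNat_ne_zero hn) (ofNat_ne_zero hl),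
      div_eq_zero_iff, ← map_mul, ← map_mul, ← map_mul, ← map_add,
      map_eq_zero_iff _ ofNat_injective, map_eq_zero_iff _ ofNat_injective] at h
    have h := h.resolve_right (mul_ne_zero hn hl)
    have hml : m * l = 0 := le_antisymm (h ▸ ⟨_, rfl⟩) (INat.zero_le _)
    rw [(mul_eq_zero.1 hml).resolve_right hl, map_zero, zero_div]

noncomputable instance : LinearOrder (IRat V) := isTotalCone.linearOrder

instance : IsStrictOrderedRing (IRat V) := isTotalCone.isStrictOrderedRing

instance : ILE V (IRat V) := ILE.of_cone isTotalCone

theorem ofNat_nonneg (n : INat V) : 0 ≤ ofNat n :=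
  isTotalCone.nonneg_iff.2 ⟨n, 1, by simp⟩

theorem ofNat_mono {m n : INat V} (h : m ≤ n) : ofNat m ≤ ofNat n := by
  obtain ⟨d, rfl⟩ := h
  rw [map_add]
  exact le_add_of_nonneg_right (ofNat_nonneg d)

theorem exists_ofNat_ge (x : IRat V) : ∃ n, x ≤ ofNat n := by
  obtain ⟨m, n, hn, rfl | rfl⟩ := eq_or_eq_neg x
  · refine ⟨m, div_le_self (ofNat_nonneg m) ?_⟩
    rcases INat.eq_zero_or_eq_add_one n with rfl | ⟨k, rfl⟩
    · exact absurd rfl hn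
    · rw [map_add, map_one]
      exact le_add_of_nonneg_left (ofNat_nonneg k)
  · exact ⟨0, by
      rw [map_zero, neg_nonpos]
      exact div_nonneg (ofNat_nonneg m) (ofNat_nonneg n)⟩

end IRat

end Integers

/-! ## Cauchy sequences -/

section Cauchy

variable {V : Type u} [Membership V V] [IsModel V]

/-- `f` is a Cauchy sequence. -/
def IsCauchy (f : INat V → IRat V) : Prop :=
  ∀ ε, 0 < ε → ∃ N, ∀ m n, N ≤ m → N ≤ n → |f m - f n| ≤ ε

/-- `f` tends to zero. -/
def IsNull (f : INat V → IRat V) : Prop :=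
  ∀ ε, 0 < ε → ∃ N, ∀ n, N ≤ n → |f n| ≤ ε

namespace IsCauchy

variable {f g : INat V → IRat V}

theorem const (q : IRat V) : IsCauchy fun _ : INat V => q := fun ε hε =>
  ⟨0, fun m n _ _ => by rw [sub_self, abs_zero]; exact hε.le⟩

theorem add (hf : IsCauchy f) (hg : IsCauchy g) : IsCauchy fun n => f n + g n := by
  intro ε hε
  obtain ⟨N, hN⟩ := hf (ε / 2) (half_pos hε)
  obtain ⟨M, hM⟩ := hg (ε / 2) (half_pos hε)
  refine ⟨max N M, fun m n hm hn => ?_⟩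
  calc |f m + g m - (f n + g n)| = |(f m - f n) + (g m - g n)| := by ring_nf
    _ ≤ |f m - f n| + |g m - g n| := abs_add_le _ _
    _ ≤ ε / 2 + ε / 2 := add_le_add (hN m n (le_of_max_le_left hm) (le_of_max_le_left hn))
        (hM m n (le_of_max_le_right hm) (le_of_max_le_right hn))
    _ = ε := add_halves ε

theorem neg (hf : IsCauchy f) : IsCauchy fun n => -f n := by
  intro ε hε
  obtain ⟨N, hN⟩ := hf ε hε
  refine ⟨N, fun m n hm hn => ?_⟩
  rw [neg_sub_neg]
  exact hN n m hn hm

theorem abs (hf : IsCauchy f) : IsCauchy fun n => |f n| := fun ε hε =>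
  let ⟨N, hN⟩ := hf ε hε
  ⟨N, fun m n hm hn => (abs_abs_sub_abs_le _ _).trans (hN m n hm hn)⟩

/-- The bound is claimed only from some index on, which spares a maximum over an initial segment. -/
theorem exists_bound (hf : IsCauchy f) : ∃ B, 0 < B ∧ ∃ N, ∀ n, N ≤ n → |f n| ≤ B := by
  obtain ⟨N, hN⟩ := hf 1 zero_lt_one
  refine ⟨|f N| + 1, by positivity, N, fun n hn => ?_⟩
  have := abs_add_le (f n - f N) (f N)
  rw [sub_add_cancel] at this
  linarith [hN n N hn le_rfl]

theorem mul (hf : IsCauchy f) (hg : IsCauchy g) : IsCauchy fun n => f n * g n := by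
  intro ε hε
  obtain ⟨B, hB, N₁, h₁⟩ := hf.exists_bound
  obtain ⟨C, hC, N₂, h₂⟩ := hg.exists_bound
  obtain ⟨N₃, h₃⟩ := hf (ε / 2 / C) (by positivity)
  obtain ⟨N₄, h₄⟩ := hg (ε / 2 / B) (by positivity)
  refine ⟨max (max N₁ N₂) (max N₃ N₄), fun m n hm hn => ?_⟩
  simp only [max_le_iff] at hm hn
  calc |f m * g m - f n * g n| = |f m * (g m - g n) + (f m - f n) * g n| := by ring_nf
    _ ≤ |f m| * |g m - g n| + |f m - f n| * |g n| := by
        rw [← abs_mul, ← abs_mul]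
        exact abs_add_le _ _
    _ ≤ B * (ε / 2 / B) + ε / 2 / C * C := add_le_add
        (mul_le_mul (h₁ m hm.1.1) (h₄ m n hm.2.2 hn.2.2) (abs_nonneg _) hB.le)
        (mul_le_mul (h₃ m n hm.2.1 hn.2.1) (h₂ n hn.1.2) (abs_nonneg _) (by positivity))
    _ = ε := by
        rw [mul_div_cancel₀ _ hB.ne', div_mul_cancel₀ _ hC.ne', add_halves]

/-- Some late term exceeds ε in absolute value, and the tail stays within ε / 2 of it. Hence the
tail keeps one sign and stays ε / 2 away from 0. -/
theorem exists_le_abs (hf : IsCauchy f) (h : ¬ IsNull f) :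
    ∃ δ, 0 < δ ∧ ∃ N, (∀ n, N ≤ n → δ ≤ f n) ∨ ∀ n, N ≤ n → f n ≤ -δ := by
  unfold IsNull at h
  push Not at h
  obtain ⟨ε, hε, h⟩ := h
  obtain ⟨N, hN⟩ := hf (ε / 2) (half_pos hε)
  obtain ⟨n, hn, hn'⟩ := h N
  refine ⟨ε / 2, half_pos hε, N, ?_⟩
  rcases lt_abs.1 hn' with h' | h'
  · exact .inl fun m hm => by linarith [(abs_le.1 (hN m n hm hn)).1]
  · exact .inr fun m hm => by linarith [(abs_le.1 (hN m n hm hn)).2]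

theorem inv (hf : IsCauchy f) (h : ¬ IsNull f) : IsCauchy fun n => (f n)⁻¹ := by
  obtain ⟨δ, hδ, N, hN⟩ := hf.exists_le_abs h
  have hN : ∀ n, N ≤ n → δ ≤ |f n| := by
    rcases hN with hN | hN
    · exact fun n hn => (hN n hn).trans (le_abs_self _)
    · exact fun n hn => (le_neg.1 (hN n hn)).trans (neg_le_abs _)
  intro ε hε
  obtain ⟨M, hM⟩ := hf (ε * (δ * δ)) (by positivity)
  refine ⟨max N M, fun m n hm hn => ?_⟩
  rw [max_le_iff] at hm hn
  have hm₀ : 0 < |f m| := hδ.trans_le (hN m hm.1)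
  have hn₀ : 0 < |f n| := hδ.trans_le (hN n hn.1)
  rw [inv_sub_inv (abs_pos.1 hm₀) (abs_pos.1 hn₀), abs_div, abs_mul,
    div_le_iff₀ (mul_pos hm₀ hn₀)]
  exact (hM n m hn.2 hm.2).trans (mul_le_mul_of_nonneg_left
    (mul_le_mul (hN m hm.1) (hN n hn.1) hδ.le hm₀.le) hε.le)

end IsCauchy

namespace IsNull

variable {f g : INat V → IRat V}

theorem add (hf : IsNull f) (hg : IsNull g) : IsNull fun n => f n + g n := by
  intro ε hε
  obtain ⟨N, hN⟩ := hf (ε / 2) (half_pos hε)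
  obtain ⟨M, hM⟩ := hg (ε / 2) (half_pos hε)
  refine ⟨max N M, fun n hn => ?_⟩
  linarith [abs_add_le (f n) (g n), hN n (le_of_max_le_left hn), hM n (le_of_max_le_right hn)]

theorem mul_left (hf : IsCauchy f) (hg : IsNull g) : IsNull fun n => f n * g n := by
  intro ε hε
  obtain ⟨B, hB, N, hN⟩ := hf.exists_bound
  obtain ⟨M, hM⟩ := hg (ε / B) (by positivity)
  refine ⟨max N M, fun n hn => ?_⟩
  rw [max_le_iff] at hn
  calc |f n * g n| = |f n| * |g n| := abs_mul _ _
    _ ≤ B * (ε / B) := mul_le_mul (hN n hn.1) (hM n hn.2) (abs_nonneg _) hB.le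
    _ = ε := mul_div_cancel₀ _ hB.ne'

theorem of_eventually_zero {N : INat V} (h : ∀ n, N ≤ n → f n = 0) : IsNull f := fun ε hε =>
  ⟨N, fun n hn => by rw [h n hn, abs_zero]; exact hε.le⟩

theorem of_abs_le (hg : IsNull g) (h : ∀ n, |f n| ≤ |g n|) : IsNull f := fun ε hε =>
  let ⟨N, hN⟩ := hg ε hε
  ⟨N, fun n hn => (h n).trans (hN n hn)⟩

end IsNull

variable (V)

/-- The ring of Cauchy sequences of the model. -/
noncomputable def cauchySubring : Subring (INat V → IRat V) where
  carrier := {f | Internal V f ∧ IsCauchy f}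
  mul_mem' {f g} hf hg := by
    have : IMap V f := ⟨hf.1⟩
    have : IMap V g := ⟨hg.1⟩
    exact ⟨(inferInstance : IMap V fun n => f n * g n).out, hf.2.mul hg.2⟩
  one_mem' := ⟨(IMap.const (1 : IRat V) : IMap V fun _ : INat V => (1 : IRat V)).out,
    IsCauchy.const 1⟩
  add_mem' {f g} hf hg := by
    have : IMap V f := ⟨hf.1⟩
    have : IMap V g := ⟨hg.1⟩
    exact ⟨(inferInstance : IMap V fun n => f n + g n).out, hf.2.add hg.2⟩
  zero_mem' := ⟨(IMap.const (0 : IRat V) : IMap V fun _ : INat V => (0 : IRat V)).out,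
    IsCauchy.const 0⟩
  neg_mem' {f} hf := by
    have : IMap V f := ⟨hf.1⟩
    exact ⟨(inferInstance : IMap V fun n => -f n).out, hf.2.neg⟩

/-- The ideal of null sequences. -/
noncomputable def nullIdeal : Ideal (cauchySubring V) where
  carrier := {f | IsNull f.1}
  add_mem' hf hg := hf.add hg
  zero_mem' := IsNull.of_eventually_zero (N := 0) fun n _ => rfl
  smul_mem' f g hg := hg.mul_left f.2.2

/-- The Cauchy real numbers of the model. -/
def IReal : Type u := cauchySubring V ⧸ nullIdeal V

namespace IReal

noncomputable instance : CommRing (IReal V) :=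
  inferInstanceAs (CommRing (cauchySubring V ⧸ nullIdeal V))

instance : IPred V fun f : IFun V (INat V) (IRat V) => IsCauchy f.1 := by
  unfold IsCauchy
  infer_instance

/-- The Cauchy sequences of the model. -/
abbrev CauchySeq : Type u := {f : IFun V (INat V) (IRat V) // IsCauchy f.1}

variable {V}

/-- The limit of a Cauchy sequence. -/
noncomputable def lim (f : CauchySeq V) : IReal V :=
  Ideal.Quotient.mk (nullIdeal V) ⟨f.1.1, f.1.2, f.2⟩

theorem lim_surjective : Function.Surjective (lim (V := V)) := fun x => by
  obtain ⟨f, rfl⟩ := Ideal.Quotient.mk_surjective x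
  exact ⟨⟨⟨f.1, f.2.1⟩, f.2.2⟩, rfl⟩

theorem lim_eq_lim {f g : CauchySeq V} :
    lim f = lim g ↔ IsNull fun n => f.1.1 n - g.1.1 n :=
  Ideal.Quotient.mk_eq_mk_iff_sub_mem _ _

noncomputable instance : Coded V (IReal V) := codedOfSurj lim

theorem iPred_lim_eq : IPred V fun p : CauchySeq V × CauchySeq V => lim p.1 = lim p.2 := by
  simp only [lim_eq_lim, IsNull]
  infer_instance

instance : IType V (IReal V) := iType_of_surj lim lim_surjective iPred_lim_eq

instance : IMap V (lim (V := V)) := iMap_of_surj lim lim_surjective iPred_lim_eq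

theorem lim_add (f g : CauchySeq V) :
    lim f + lim g = lim ⟨ifun V fun n => f.1.1 n + g.1.1 n, f.2.add g.2⟩ := rfl

theorem lim_mul (f g : CauchySeq V) :
    lim f * lim g = lim ⟨ifun V fun n => f.1.1 n * g.1.1 n, f.2.mul g.2⟩ := rfl

theorem lim_neg (f : CauchySeq V) : -lim f = lim ⟨ifun V fun n => -f.1.1 n, f.2.neg⟩ := rfl

instance : IAdd V (IReal V) := ⟨by
  refine IMap.of_comp_surj₂ (f := fun x y : IReal V => x + y) lim_surjective ?_
  simp only [lim_add]
  have : IMap V fun p : CauchySeq V × CauchySeq V => (⟨ifun V fun n => p.1.1.1 n + p.2.1.1 n,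
      p.1.2.add p.2.2⟩ : CauchySeq V) :=
    IMap.subtypeMk (fun p : CauchySeq V × CauchySeq V => ifun V fun n => p.1.1.1 n + p.2.1.1 n) _
  exact IMap.comp' lim _ inferInstance this⟩

instance : IMul V (IReal V) := ⟨by
  refine IMap.of_comp_surj₂ (f := fun x y : IReal V => x * y) lim_surjective ?_
  simp only [lim_mul]
  have : IMap V fun p : CauchySeq V × CauchySeq V => (⟨ifun V fun n => p.1.1.1 n * p.2.1.1 n,
      p.1.2.mul p.2.2⟩ : CauchySeq V) :=
    IMap.subtypeMk (fun p : CauchySeq V × CauchySeq V => ifun V fun n => p.1.1.1 n * p.2.1.1 n) _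
  exact IMap.comp' lim _ inferInstance this⟩

/-- The embedding of the rational numbers. -/
noncomputable def ofRat : IRat V →+* IReal V where
  toFun q := lim ⟨ifun V fun _ => q, IsCauchy.const q⟩
  map_zero' := rfl
  map_one' := rfl
  map_add' _ _ := rfl
  map_mul' _ _ := rfl

instance : IMap V (ofRat (V := V)) := by
  refine IMap.of_graph (fun q x => ∃ f : CauchySeq V, lim f = x ∧ ∀ n, f.1.1 n = q)
    (by infer_instance) fun q x => ⟨?_, ?_⟩
  · rintro rfl
    exact ⟨_, rfl, fun _ => rfl⟩
  · rintro ⟨f, rfl, h⟩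
    exact congrArg lim (Subtype.ext (IFun.ext' h))

theorem lim_eq_zero {f : CauchySeq V} : lim f = 0 ↔ IsNull f.1.1 := by
  change lim f = lim ⟨ifun V fun _ => 0, IsCauchy.const 0⟩ ↔ _
  rw [lim_eq_lim]
  simp

instance : Nontrivial (IReal V) := by
  refine ⟨1, 0, fun h => ?_⟩
  have h : lim ⟨ifun V fun _ => 1, IsCauchy.const 1⟩ = (0 : IReal V) := h
  rw [lim_eq_zero] at h
  obtain ⟨N, hN⟩ := h (1 / 2) (by norm_num)
  have := hN N le_rfl
  rw [ifun_apply, abs_one] at this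
  norm_num at this

theorem isUnit_or_eq_zero (x : IReal V) : IsUnit x ∨ x = 0 := by
  obtain ⟨f, rfl⟩ := lim_surjective x
  rw [lim_eq_zero, or_iff_not_imp_right]
  intro h
  -- The inverse is taken termwise with 0⁻¹ = 0; the product is 1 from the index on at which the
  -- terms stay away from 0.
  refine IsUnit.of_mul_eq_one (lim ⟨ifun V fun n => (f.1.1 n)⁻¹, f.2.inv h⟩) ?_
  rw [lim_mul]
  change lim _ = lim ⟨ifun V fun _ => 1, IsCauchy.const 1⟩
  rw [lim_eq_lim]
  obtain ⟨δ, hδ, N, hN⟩ := f.2.exists_le_abs h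
  refine IsNull.of_eventually_zero (N := N) fun n hn => sub_eq_zero.2 (mul_inv_cancel₀ ?_)
  rcases hN with hN | hN
  · exact (hδ.trans_le (hN n hn)).ne'
  · exact ((hN n hn).trans_lt (neg_neg_of_pos hδ)).ne

noncomputable instance : Field (IReal V) := Field.ofIsUnitOrEqZero isUnit_or_eq_zero

/-- The limits of sequences of nonnegative rational numbers. -/
def IsNonneg (x : IReal V) : Prop := ∃ f : CauchySeq V, lim f = x ∧ ∀ n, 0 ≤ f.1.1 n

instance : IPred V (IsNonneg (V := V)) := by
  unfold IsNonneg
  infer_instance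

/-- Replacing f by |f| changes no term from N on, so the limit is the same. -/
theorem isNonneg_lim {f : CauchySeq V} {N : INat V} (h : ∀ n, N ≤ n → 0 ≤ f.1.1 n) :
    IsNonneg (lim f) := by
  refine ⟨⟨ifun V fun n => |f.1.1 n|, f.2.abs⟩, lim_eq_lim.2 ?_, fun n => abs_nonneg _⟩
  exact IsNull.of_eventually_zero (N := N) fun n hn => sub_eq_zero.2 (abs_of_nonneg (h n hn))

theorem isTotalCone : IsTotalCone (IsNonneg (V := V)) where
  add := by
    rintro _ _ ⟨f, rfl, hf⟩ ⟨g, rfl, hg⟩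
    exact ⟨_, (lim_add f g).symm, fun n => add_nonneg (hf n) (hg n)⟩
  mul := by
    rintro _ _ ⟨f, rfl, hf⟩ ⟨g, rfl, hg⟩
    exact ⟨_, (lim_mul f g).symm, fun n => mul_nonneg (hf n) (hg n)⟩
  total x := by
    obtain ⟨f, rfl⟩ := lim_surjective x
    by_cases h : IsNull f.1.1
    · rw [lim_eq_zero.2 h]
      exact .inl (isNonneg_lim (f := ⟨ifun V fun _ => 0, IsCauchy.const 0⟩) (N := 0)
        fun _ _ => le_rfl)
    · obtain ⟨δ, hδ, N, hN | hN⟩ := f.2.exists_le_abs h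
      · exact .inl (isNonneg_lim fun n hn => hδ.le.trans (hN n hn))
      · rw [lim_neg]
        exact .inr (isNonneg_lim (N := N) fun n hn => hδ.le.trans (le_neg.1 (hN n hn)))
  eq_zero := by
    rintro _ ⟨f, rfl, hf⟩ ⟨g, h, hg⟩
    rw [lim_neg, lim_eq_lim] at h
    rw [lim_eq_zero]
    -- With f, g ≥ 0 and f + g null, f is squeezed by 0 ≤ f ≤ f + g.
    refine h.of_abs_le fun n => ?_
    rw [ifun_apply, sub_neg_eq_add, abs_of_nonneg (hf n), abs_of_nonneg (add_nonneg (hg n) (hf n))]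
    exact le_add_of_nonneg_left (hg n)

noncomputable instance : LinearOrder (IReal V) := isTotalCone.linearOrder

instance : IsStrictOrderedRing (IReal V) := isTotalCone.isStrictOrderedRing

instance : ILE V (IReal V) := ILE.of_cone isTotalCone

theorem lim_le_lim {f g : CauchySeq V} {N : INat V} (h : ∀ n, N ≤ n → f.1.1 n ≤ g.1.1 n) :
    lim f ≤ lim g := by
  rw [← sub_nonneg, isTotalCone.nonneg_iff, sub_eq_add_neg, lim_neg, lim_add]
  exact isNonneg_lim (N := N) fun n hn => by
    rw [ifun_apply, ifun_apply, ← sub_eq_add_neg, sub_nonneg]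
    exact h n hn

theorem ofRat_mono {p q : IRat V} (h : p ≤ q) : ofRat p ≤ ofRat q :=
  lim_le_lim (N := 0) fun _ _ => h

theorem lt_of_ofRat_lt {p q : IRat V} (h : ofRat p < ofRat q) : p < q := by
  by_contra! h'
  exact absurd h (not_lt.2 (ofRat_mono h'))

theorem exists_nat_ge (x : IReal V) : ∃ n, x ≤ ofRat (IRat.ofNat n) := by
  obtain ⟨f, rfl⟩ := lim_surjective x
  obtain ⟨B, -, N, h⟩ := f.2.exists_bound
  obtain ⟨n, hn⟩ := IRat.exists_ofNat_ge B
  exact ⟨n, lim_le_lim (N := N) fun m hm => (le_abs_self _).trans ((h m hm).trans hn)⟩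

end IReal

end Cauchy

/-! ### Completeness of the Cauchy real numbers -/

section Completeness

variable {V : Type u} [Membership V V] [IsModel V]

namespace IRat

theorem ofNat_add_one_pos (n : INat V) : 0 < ofNat n + 1 := by
  linarith [ofNat_nonneg n]

/-- The sequence `1 / (n + 1)`. -/
noncomputable def invSucc (n : INat V) : IRat V := (ofNat n + 1)⁻¹

theorem invSucc_pos (n : INat V) : 0 < invSucc n := inv_pos.2 (ofNat_add_one_pos n)

theorem invSucc_anti {m n : INat V} (h : m ≤ n) : invSucc n ≤ invSucc m :=
  inv_anti₀ (ofNat_add_one_pos m) (add_le_add_left (ofNat_mono h) 1)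

theorem exists_invSucc_le {ε : IRat V} (h : 0 < ε) : ∃ n, invSucc n ≤ ε := by
  obtain ⟨n, hn⟩ := exists_ofNat_ge ε⁻¹
  exact ⟨n, inv_le_of_inv_le₀ h (hn.trans (by linarith))⟩

instance : IMap V (invSucc (V := V)) := by
  unfold invSucc
  infer_instance

end IRat

namespace IReal

open IRat

/-- By the Archimedean property. The factor 2 accounts for the two errors 1 / (n + 1) in the
comparison of the supremum with another upper bound. -/
theorem le_of_forall_invSucc {x y : IReal V} (h : ∀ n, x ≤ y + ofRat (2 * invSucc n)) : x ≤ y := by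
  by_contra! hxy
  have hpos : 0 < x - y := sub_pos.2 hxy
  obtain ⟨n, hn⟩ := exists_nat_ge (2 * (x - y)⁻¹)
  have h₁ : ofRat (2 * invSucc n) * ofRat (IRat.ofNat n + 1) = 2 := by
    rw [← map_mul, invSucc, inv_mul_cancel_right₀ (ofNat_add_one_pos n).ne', map_ofNat]
  have h₂ : 0 ≤ ofRat (IRat.ofNat n) := by
    rw [← map_zero ofRat]
    exact ofRat_mono (ofNat_nonneg n)
  have h₃ : x - y ≤ ofRat (2 * invSucc n) := by linarith [h n]
  have h₄ : 2 ≤ ofRat (IRat.ofNat n) * (x - y) := by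
    rwa [← div_eq_mul_inv, div_le_iff₀ hpos] at hn
  rw [map_add, map_one] at h₁
  nlinarith

/-- Nonempty internal sets of real numbers that are bounded above have a least upper bound. -/
theorem exists_isLUB (S : ISet V (IReal V)) (hne : S.1.Nonempty) (hbd : BddAbove S.1) :
    ∃ r, IsLUB S.1 r := by
  obtain ⟨s₀, hs₀⟩ := hne
  obtain ⟨b, hb⟩ := hbd
  obtain ⟨M, hM⟩ := exists_nat_ge (1 - s₀)
  obtain ⟨B, hB⟩ := exists_nat_ge b
  -- On the grid of mesh 1 / (n + 1), take the least upper bound of S of the form k / (n + 1) - M.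
  -- The shift by M places the grid's origin below `s₀`, so natural numerators suffice; k = (B +
  -- M)(n + 1) gives the upper bound B. Leastness of k replaces a choice.
  have key : ∀ n : INat V, ∃ k, ∀ l, l = k ↔
      (∀ s, s ∈ S.1 → s ≤ ofRat (IRat.ofNat l * invSucc n - IRat.ofNat M)) ∧
        ∀ j, (∀ s, s ∈ S.1 → s ≤ ofRat (IRat.ofNat j * invSucc n - IRat.ofNat M)) → l ≤ j := by
    intro n
    obtain ⟨k, hk, hk'⟩ := INat.exists_least
      (fun l => ∀ s, s ∈ S.1 → s ≤ ofRat (IRat.ofNat l * invSucc n - IRat.ofNat M))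
      ⟨(B + M) * (n + 1), fun s hs => ((hb hs).trans hB).trans_eq (by
        rw [map_mul, map_add, map_add, map_one, invSucc, mul_inv_cancel_right₀
          (ofNat_add_one_pos n).ne', add_sub_cancel_right])⟩
    refine ⟨k, fun l => ⟨?_, fun h => le_antisymm (h.2 k hk) (hk' l h.1)⟩⟩
    rintro rfl
    exact ⟨hk, hk'⟩
  choose k hk using key
  have : IMap V k := IMap.of_graph (fun n l =>
      (∀ s, s ∈ S.1 → s ≤ ofRat (IRat.ofNat l * invSucc n - IRat.ofNat M)) ∧
        ∀ j, (∀ s, s ∈ S.1 → s ≤ ofRat (IRat.ofNat j * invSucc n - IRat.ofNat M)) → l ≤ j)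
    (by infer_instance) hk
  let f : IFun V (INat V) (IRat V) := ifun V fun n => IRat.ofNat (k n) * invSucc n - IRat.ofNat M
  have upper : ∀ n s, s ∈ S.1 → s ≤ ofRat (f.1 n) := fun n => ((hk n _).1 rfl).1
  have lower : ∀ n, ∃ s, s ∈ S.1 ∧ ofRat (f.1 n - invSucc n) < s := by
    intro n
    -- The numerator 0 is excluded, because -M ≤ s₀ - 1 is not an upper bound. Otherwise the
    -- preceding grid point is not an upper bound.
    rcases INat.eq_zero_or_eq_add_one (k n) with h | ⟨l, h⟩
    · have := upper n s₀ hs₀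
      change s₀ ≤ ofRat (IRat.ofNat (k n) * invSucc n - IRat.ofNat M) at this
      rw [h, map_zero, zero_mul, zero_sub, map_neg] at this
      linarith
    · by_contra! hl
      refine absurd (((hk n _).1 rfl).2 l fun s hs => (hl s hs).trans_eq ?_)
        (not_le.2 (h ▸ INat.lt_add_one l))
      change ofRat (IRat.ofNat (k n) * invSucc n - IRat.ofNat M - invSucc n) = _
      rw [h, map_add, map_one]
      congr 1
      ring
  -- Every `f n` is an upper bound of S, and `f m - invSucc m` lies below an element of S. This
  -- comparison yields both the Cauchy property and the error bounds for the limit.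
  have hlt : ∀ m n, f.1 m - invSucc m < f.1 n := fun m n =>
    let ⟨s, hs, h⟩ := lower m
    lt_of_ofRat_lt (h.trans_le (upper n s hs))
  have hf : IsCauchy f.1 := by
    intro ε hε
    obtain ⟨N, hN⟩ := exists_invSucc_le hε
    refine ⟨N, fun m n hm hn => abs_le.2 ⟨?_, ?_⟩⟩
    · linarith [hlt n m, invSucc_anti hn]
    · linarith [hlt m n, invSucc_anti hm]
  refine ⟨lim ⟨f, hf⟩, fun s hs => le_of_forall_invSucc fun n => (upper n s hs).trans ?_,
    fun t ht => le_of_forall_invSucc fun n => ?_⟩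
  · change lim ⟨ifun V fun _ => f.1 n, _⟩ ≤ lim ⟨ifun V fun m => f.1 m + (2 : IRat V) * invSucc n,
      hf.add (IsCauchy.const _)⟩
    refine lim_le_lim (N := 0) fun m _ => ?_
    change f.1 n ≤ f.1 m + 2 * invSucc n
    linarith [hlt n m, invSucc_pos n]
  · obtain ⟨s, hs, h⟩ := lower n
    have h₁ : lim ⟨f, hf⟩ ≤ ofRat (f.1 n + invSucc n) := by
      refine lim_le_lim (N := n) fun m hm => ?_
      change f.1 m ≤ f.1 n + invSucc n
      linarith [hlt m n, invSucc_anti hm]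
    rw [show f.1 n + invSucc n = f.1 n - invSucc n + 2 * invSucc n by ring, map_add] at h₁
    linarith [ht hs]

end IReal

end Completeness

/-! ## Transport to a set of the model -/

section Transport

variable (V : Type u) [Membership V V] [IsModel V] (F : Type u) [Coded V F] [IType V F]

/-- An internal type is in bijection with the elements of a set of the model. -/
noncomputable def elEquiv : El (car V F) ≃ F where
  toFun x := (mem_car.1 x.2).choose
  invFun a := ⟨cd V a, mem_car.2 ⟨a, rfl⟩⟩
  left_inv x := Subtype.ext (mem_car.1 x.2).choose_spec.symm
  right_inv a := by
    have h : ∃ b : F, cd V a = cd V b := ⟨a, rfl⟩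
    exact (cd_inj.1 h.choose_spec).symm

instance : IMap V (elEquiv V F).symm :=
  IMap.of_dfn (fun x y => y = x) fun a b => by
    rw [cd_el]
    exact Subtype.ext_iff

instance : IMap V (elEquiv V F) :=
  IMap.of_graph (fun x a => x = (elEquiv V F).symm a) (by infer_instance) fun x a =>
    eq_comm.trans (Equiv.eq_symm_apply _).symm

/-- The field of Cauchy real numbers, on a set of the model. -/
noncomputable def realField : RealField V :=
  let e := elEquiv V (IReal V)
  letI : Field (El (car V (IReal V))) := e.field
  letI : LinearOrder (El (car V (IReal V))) := LinearOrder.lift' e e.injective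
  { carrier := car V (IReal V)
    isStrictOrderedRing := Function.Injective.isStrictOrderedRing e (e.apply_symm_apply 0)
      (e.apply_symm_apply 1) (fun _ _ => e.apply_symm_apply _) (fun _ _ => e.apply_symm_apply _)
      Iff.rfl Iff.rfl
    internal_add := (inferInstance : IMap V fun p : El (car V (IReal V)) × El (car V (IReal V)) =>
      (elEquiv V (IReal V)).symm (elEquiv V (IReal V) p.1 + elEquiv V (IReal V) p.2)).out
    internal_mul := (inferInstance : IMap V fun p : El (car V (IReal V)) × El (car V (IReal V)) =>
      (elEquiv V (IReal V)).symm (elEquiv V (IReal V) p.1 * elEquiv V (IReal V) p.2)).out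
    internal_le := (inferInstance : IPred V fun p : El (car V (IReal V)) × El (car V (IReal V)) =>
      elEquiv V (IReal V) p.1 ≤ elEquiv V (IReal V) p.2).out
    exists_isLUB := fun S ⟨s, hs⟩ ⟨b, hb⟩ => by
      have hupper : ∀ t ∈ upperBounds S.1, ∀ x, (elEquiv V (IReal V)).symm x ∈ S.1 → x ≤ e t :=
        fun t ht x hx => (e.apply_symm_apply x).ge.trans (ht hx)
      obtain ⟨r, hr⟩ := IReal.exists_isLUB (iset V fun x => (elEquiv V (IReal V)).symm x ∈ S.1)
        ⟨e s, by simpa [e] using hs⟩ ⟨e b, hupper b hb⟩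
      refine ⟨e.symm r, fun x hx => ?_, fun t ht => ?_⟩
      · exact (hr.1 (by simpa [e] using hx)).trans (e.apply_symm_apply r).ge
      · exact (e.apply_symm_apply r).le.trans (hr.2 (hupper t ht)) }

end Transport

end ZF

theorem theoremT (V : Type u) [Membership V V] [ZF.IsModel V] :
    Nonempty (ZF.RealField V) ∧
    ∀ (R : ZF.RealField V) (X : V), ZF.PowerDedekindFinite X →
      ∀ T : ZF.L2 R X → ZF.L2 R X, ZF.IsBoundedOperator T →
        ZF.IsFinite V (ZF.opSpectrum T) ∧ ∀ c ∈ ZF.opSpectrum T, ZF.IsEigenvalue T c :=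
  ⟨⟨ZF.realField V⟩, fun _ _ hX _ hT => hT.spectrum_finite hX⟩
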